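/- Let $\mathbb{S}=\{1,\dots,N\}$ and let $\Gamma=(\gamma_{ij})\in\mathbb{R}^{N\times N}$ be an irreducible conservative generator ($\gamma_{ij}\ge 0$ for $i\ne j$, zero row sums) with stationary distribution $\mu$ ($\mu\Gamma=0$, $\sum_j\mu_j=1$, $\mu_j>0$). Let $f:\mathbb{R}^n\times\mathbb{S}\to\mathbb{R}^n$ and $g:\mathbb{R}^n\times\mathbb{S}\to\mathbb{R}^{n\times d}$ be continuous, and write $|\cdot|$ for the Euclidean norm of vectors and the Hilbert–Schmidt norm of matrices. Assume: 1. there are $a_i>0$ and $q\ge 2$ with $$|f(x,i)-f(y,i)|^2\vee|g(x,i)-g(y,i)|^2\le a_i\bigl(1+|x|^{q-2}+|y|^{q-2}\bigr)|x-y|^2\qquad(x,y\in\mathbb{R}^n,\ i\in\mathbb{S});$$ 2. there are $n_i\in\mathbb{R}$ and $l_1>4$ with $$2\langle x-y,f(x,i)-f(y,i)\rangle+l_1|g(x,i)-g(y,i)|^2\le n_i|x-y|^2\qquad(x,y\in\mathbb{R}^n,\ i\in\mathbb{S});$$ 3. with $n_M=\max_i|n_i|$, $$\sum_{j\in\mathbb{S}}\mu_j\frac{n_j+1}{1-(n_j+1)/(n_M+2)}<0\quad\text{and}\quad\sum_{j\in\mathbb{S}}\mu_j\frac{n_j}{1-n_j/(n_M+2)}<0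 .$$ For $0<\Delta<1/(n_M+2)$ consider the backward Euler–Maruyama scheme $$X_{k+1}=X_k+f(X_{k+1},r_{k+1})\Delta+g(X_k,r_k)\,\Delta B_k,\qquad X_0=x_0,\ r_0=i_0,$$ where $\Delta B_k=B((k+1)\Delta)-B(k\Delta)$ for a $d$-dimensional Brownian motion $B$, and $(r_k)$ is a Markov chain on $\mathbb{S}$, independent of $B$, with one-step transition matrix $\exp(\Delta\Gamma)$. Let $\mathbf{P}^\Delta_k((x,i),\cdot)$ be the $k$-step transition probability on $\mathbb{R}^n\times\mathbb{S}$ obtained by iterating the one-step transition in which, from $(x,i)$, one moves to $(u,j)$ with $j$ drawn with probability $\exp(\Delta\Gamma)_{ij}$ and $u$ the solution of $u-\Delta f(u,j)=x+g(x,i)\sqrt{\Delta}\,\xi$, with $\xi\sim N(0,I_d)$ independent of $j$. For $p\in(0,1)$ let $$d_p((x,i),(y,j))=|x-y|^p+\mathbb{1}_{\{i\ne j\}},\qquad W_p(u,v)=\inf_{\theta}\int d_p\,\mathrm{d}\theta\in[0,\infty],$$ the infimum being over all couplings $\theta$ of the probability measures $u,v$ on $\mathbb{R}^n\times\mathbb{S}$.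 Then there is $p_0\in(0,1]$, not depending on $\Delta$, such that for every $\Delta\in(0,1/(n_M+2))$: * for all $i\in\mathbb{S}$ and $y\in\mathbb{R}^n$ the equation $u-\Delta f(u,i)=y$ has exactly one solution $u\in\mathbb{R}^n$, and the law of $(X_k,r_k)$ started from $(x_0,i_0)$ is $\mathbf{P}^\Delta_k((x_0,i_0),\cdot)$ for every $k\ge 0$; * there is exactly one invariant measure of the chain, i.e. exactly one probability measure $\pi^\Delta$ on $\mathbb{R}^n\times\mathbb{S}$ with $$\pi^\Delta(A\times\{j\})=\int\mathbf{P}^\Delta_k(z,A\times\{j\})\,\pi^\Delta(\mathrm{d}z)$$ for all $k\ge0$, all Borel sets $A\subseteq\mathbb{R}^n$ and all $j\in\mathbb{S}$; * for every $p\in(0,p_0)$ there is a rate $\gamma_\Delta>0$ such that for every initial state $(x_0,i_0)$ there is a constant $C>0$ with $$W_p\bigl(\mathbf{P}^\Delta_k((x_0,i_0),\cdot),\pi^\Delta\bigr)\le C\,e^{-\gamma_\Delta k\Delta}\qquad\text{for all }k\ge 0 .$$ -/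

import Mathlib

open MeasureTheory ProbabilityTheory
open scoped NNReal ENNReal

noncomputable section

namespace HybridBEM

/-- `ℝⁿ` with the Euclidean norm. -/
abbrev Vec (n : ℕ) : Type := EuclideanSpace ℝ (Fin n)

/-- The Hilbert–Schmidt norm of a matrix. -/
def hsNorm {n d : ℕ} (A : Matrix (Fin n) (Fin d) ℝ) : ℝ :=
  Real.sqrt (∑ i, ∑ j, A i j ^ 2)

/-! ### The switching chain -/

/-- `Γ` is a conservative generator on `{1, …, N}`: nonnegative off-diagonal rates, zero row
sums. -/
def IsGenerator {N : ℕ} (Γ : Matrix (Fin N) (Fin N) ℝ) : Prop :=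
  (∀ i j, i ≠ j → 0 ≤ Γ i j) ∧ ∀ i, ∑ j, Γ i j = 0

/-- Irreducibility of a generator: any state is reached from any other one through transitions of
positive rate (diagonal entries of a generator are never positive). -/
def IsIrreducibleGenerator {N : ℕ} (Γ : Matrix (Fin N) (Fin N) ℝ) : Prop :=
  ∀ i j, Relation.ReflTransGen (fun a b => 0 < Γ a b) i j

/-- `μ` is the stationary distribution of the chain with generator `Γ`. -/
def IsStationaryDistribution {N : ℕ} (Γ : Matrix (Fin N) (Fin N) ℝ) (μ : Fin N → ℝ) : Prop :=
  Matrix.vecMul μ Γ = 0 ∧ ∑ j, μ j = 1 ∧ ∀ j, 0 < μ j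

/-- The transition matrix `exp(Δ Γ)` of the switching chain over a time step `Δ`. -/
def stepMatrix {N : ℕ} (Γ : Matrix (Fin N) (Fin N) ℝ) (Δ : ℝ) : Matrix (Fin N) (Fin N) ℝ :=
  NormedSpace.exp (Δ • Γ)

/-- `n_M = max_i |n_i|`. -/
def maxAbs {N : ℕ} (ν : Fin N → ℝ) : ℝ := ⨆ i, |ν i|

/-! ### The assumptions on the coefficients -/

/-- Continuity and the polynomial local Lipschitz condition. -/
def PolynomialLipschitz {n d N : ℕ} (f : Vec n → Fin N → Vec n)
    (g : Vec n → Fin N → Matrix (Fin n) (Fin d) ℝ) (a : Fin N → ℝ) (q : ℝ) : Prop :=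
  (∀ i, Continuous fun x => f x i) ∧ (∀ i, Continuous fun x => g x i) ∧
  (∀ i, 0 < a i) ∧ 2 ≤ q ∧
  ∀ x y i, max (‖f x i - f y i‖ ^ 2) (hsNorm (g x i - g y i) ^ 2) ≤
    a i * (1 + ‖x‖ ^ (q - 2) + ‖y‖ ^ (q - 2)) * ‖x - y‖ ^ 2

/-- The one-sided (Khasminskii-type) monotonicity condition. -/
def KhasminskiiMonotone {n d N : ℕ} (f : Vec n → Fin N → Vec n)
    (g : Vec n → Fin N → Matrix (Fin n) (Fin d) ℝ) (ν : Fin N → ℝ) (l₁ : ℝ) : Prop :=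
  4 < l₁ ∧ ∀ x y i,
    2 * inner ℝ (x - y) (f x i - f y i) + l₁ * hsNorm (g x i - g y i) ^ 2 ≤ ν i * ‖x - y‖ ^ 2

/-- The averaged stability condition with respect to the stationary distribution `μ`. -/
def AveragedStable {N : ℕ} (μ ν : Fin N → ℝ) : Prop :=
  (∃ lam₁ > 0, ∑ j, μ j * ((ν j + 1) / (1 - (ν j + 1) / (maxAbs ν + 2))) = -lam₁) ∧
  (∃ lam₂ > 0, ∑ j, μ j * (ν j / (1 - ν j / (maxAbs ν + 2))) = -lam₂)

/-! ### The backward Euler–Maruyama chain -/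

/-- `B = (B_1, …, B_d)` is a `d`-dimensional Brownian motion. -/
structure IsBrownianMotion {Ω : Type*} [MeasurableSpace Ω] (P : Measure Ω) {d : ℕ}
    (B : Fin d → ℝ≥0 → Ω → ℝ) : Prop where
  measurable : ∀ l t, Measurable (B l t)
  brownian : ∀ l, IsBrownianReal (B l) P
  indep : iIndepFun (fun l ω t => B l t ω) P

/-- The increment `ΔB_k = B((k+1)Δ) - B(kΔ)`. -/
def increment {Ω : Type*} {d : ℕ} (B : Fin d → ℝ≥0 → Ω → ℝ) (Δ : ℝ) (k : ℕ) (ω : Ω) : Vec d :=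
  WithLp.toLp 2 fun l =>
    B l (Real.toNNReal ((k + 1 : ℝ) * Δ)) ω - B l (Real.toNNReal ((k : ℝ) * Δ)) ω

/-- `r` is a Markov chain with one-step transition matrix `Q` started from `i₀`, expressed through
its finite-dimensional distributions. -/
structure IsMarkovChain {Ω : Type*} [MeasurableSpace Ω] (P : Measure Ω) {N : ℕ}
    (Q : Matrix (Fin N) (Fin N) ℝ) (i₀ : Fin N) (r : ℕ → Ω → Fin N) : Prop where
  measurable : ∀ k, Measurable (r k)
  law : ∀ (k : ℕ) (s : ℕ → Fin N),
    P {ω | ∀ m ≤ k, r m ω = s m} =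
      if s 0 = i₀ then ENNReal.ofReal (∏ m ∈ Finset.range k, Q (s m) (s (m + 1))) else 0

/-- `(X_k, r_k)` is produced by the backward Euler–Maruyama scheme
`X_{k+1} = X_k + f(X_{k+1}, r_{k+1}) Δ + g(X_k, r_k) ΔB_k`, `X_0 = x₀`, `r_0 = i₀`, driven by a
Brownian motion `B` and an independent chain `r` with transition matrix `exp(Δ Γ)`. -/
structure IsBEMSolution {Ω : Type*} [MeasurableSpace Ω] (P : Measure Ω) {n d N : ℕ}
    (f : Vec n → Fin N → Vec n) (g : Vec n → Fin N → Matrix (Fin n) (Fin d) ℝ)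
    (Γ : Matrix (Fin N) (Fin N) ℝ) (Δ : ℝ) (x₀ : Vec n) (i₀ : Fin N)
    (B : Fin d → ℝ≥0 → Ω → ℝ) (X : ℕ → Ω → Vec n) (r : ℕ → Ω → Fin N) : Prop where
  brownian : IsBrownianMotion P B
  chain : IsMarkovChain P (stepMatrix Γ Δ) i₀ r
  indep : IndepFun (fun ω l t => B l t ω) (fun ω k => r k ω) P
  measurable : ∀ k, Measurable (X k)
  initial : ∀ᵐ ω ∂P, X 0 ω = x₀
  step : ∀ k, ∀ᵐ ω ∂P, X (k + 1) ω = X k ω + Δ • f (X (k + 1) ω) (r (k + 1) ω) +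
    Matrix.toEuclideanLin (g (X k ω) (r k ω)) (increment B Δ k ω)

/-- The implicit solution map: the solution `u` of `u - Δ f(u, j) = y` (the scheme is used only
for step sizes for which this solution exists and is unique). -/
def implicitSolve {n N : ℕ} (f : Vec n → Fin N → Vec n) (Δ : ℝ) (j : Fin N) : Vec n → Vec n :=
  Function.invFun fun u => u - Δ • f u j

/-- The one-step transition probability of `(X_k, r_k)`: from `(x, i)` the chain switches to `j`
with probability `exp(Δ Γ)_{ij}`, and the new position solves the implicit equation with an
independent Gaussian increment `√Δ ξ`, `ξ ∼ N(0, I_d)`. -/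
def bemStep {n d N : ℕ} (f : Vec n → Fin N → Vec n)
    (g : Vec n → Fin N → Matrix (Fin n) (Fin d) ℝ) (Γ : Matrix (Fin N) (Fin N) ℝ) (Δ : ℝ)
    (z : Vec n × Fin N) : Measure (Vec n × Fin N) :=
  ∑ j, ENNReal.ofReal (stepMatrix Γ Δ z.2 j) •
    (stdGaussian (Vec d)).map fun ξ =>
      (implicitSolve f Δ j (z.1 + Matrix.toEuclideanLin (g z.1 z.2) (Real.sqrt Δ • ξ)), j)

/-- The `k`-step transition probability `𝐏^Δ_k((x, i), ·)` of `(X_k, r_k)`. -/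
def bemKernel {n d N : ℕ} (f : Vec n → Fin N → Vec n)
    (g : Vec n → Fin N → Matrix (Fin n) (Fin d) ℝ) (Γ : Matrix (Fin N) (Fin N) ℝ) (Δ : ℝ) :
    ℕ → Vec n × Fin N → Measure (Vec n × Fin N)
  | 0, z => Measure.dirac z
  | k + 1, z => (bemKernel f g Γ Δ k z).bind (bemStep f g Γ Δ)

/-- `π` is an invariant probability measure of the family `K` of `k`-step transition
probabilities. -/
def IsInvariantMeasure {n N : ℕ} (K : ℕ → Vec n × Fin N → Measure (Vec n × Fin N))
    (π : Measure (Vec n × Fin N)) : Prop :=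
  IsProbabilityMeasure π ∧ ∀ (k : ℕ) (A : Set (Vec n)) (j : Fin N), MeasurableSet A →
    π (A ×ˢ {j}) = ∫⁻ z, K k z (A ×ˢ {j}) ∂π

/-! ### The Wasserstein distance -/

/-- `d_p((x, i), (y, j)) = |x - y|^p + 1_{i ≠ j}`. -/
def dp {n N : ℕ} (p : ℝ) (z w : Vec n × Fin N) : ℝ :=
  ‖z.1 - w.1‖ ^ p + if z.2 ≠ w.2 then 1 else 0

/-- `W_p(u, v)`: the infimum of `∫ d_p dθ` over all couplings `θ` of `u` and `v`, with values in
`[0, ∞]`. -/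
def wasserstein {n N : ℕ} (p : ℝ) (u v : Measure (Vec n × Fin N)) : ℝ≥0∞ :=
  ⨅ θ : {θ : Measure ((Vec n × Fin N) × (Vec n × Fin N)) //
      θ.map Prod.fst = u ∧ θ.map Prod.snd = v},
    ∫⁻ zw, ENNReal.ofReal (dp p zw.1 zw.2) ∂θ.1

end HybridBEM

end

/-!
Monotonicity bounds `‖u - v‖ ^ 2 + Δ * hsNorm (g u j - g v j) ^ 2` by `(1 - ν j * Δ)⁻¹` times the
squared distance of the right-hand sides of the implicit equations in the state `j` solved by `u`
and `v`. Under the same Gaussian noise, the conditional mean of the latter is the former quantity at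
the previous time, and Jensen's inequality passes to `p / 2`-th powers. The factors may exceed `1`
in some states, but

`(1 - ν j * Δ)⁻¹ ^ (p / 2) ≤ exp (p / 2 * Δ * (ν j / (1 - ν j / (maxAbs ν + 2))))`,

and the stationary mean of the rates in the exponent is negative. Solving a Poisson equation for `Γ`
therefore gives, for small `p` and every `Δ`, a weight on the switching states for which the
weighted `p / 2`-th power is contracted in the mean.

This yields both a geometric drift condition, hence an invariant measure by Krylov–Bogolyubov, and a
contraction of two copies driven by the same Gaussian noise once their switching states agree. Until
then the switching states move independently; they meet in one step with probability bounded below,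
because `exp (Δ • Γ)` has positive entries. A cost combining the two regimes is contracted by the
coupling, which gives uniqueness and the exponential rate in `wasserstein`.
-/

noncomputable section

namespace HybridBEM

open Filter Topology

/-! ### Invariant measures of Feller kernels -/

section Feller

variable {Z : Type*} [MeasurableSpace Z] {P : Kernel Z Z}

/-- The Feller property: a kernel maps bounded continuous functions to continuous functions. -/
def IsFeller [TopologicalSpace Z] (P : Kernel Z Z) : Prop :=
  ∀ φ : BoundedContinuousFunction Z ℝ, Continuous fun z => ∫ w, φ w ∂P z

/-- The Cesàro mean `(n + 1)⁻¹ ∑_{k ≤ n} P ^ k (z, ·)` of the orbit of a point. -/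
def cesaroMean (P : Kernel Z Z) (z : Z) (n : ℕ) : Measure Z :=
  (n + 1 : ℝ≥0∞)⁻¹ • ∑ k ∈ Finset.range (n + 1), (P ^ k) z

instance isMarkovKernel_pow [IsMarkovKernel P] (k : ℕ) : IsMarkovKernel (P ^ k) := by
  induction k with
  | zero => exact inferInstanceAs (IsMarkovKernel Kernel.id)
  | succ k ih => rw [pow_succ]; exact inferInstanceAs (IsMarkovKernel ((P ^ k) ∘ₖ P))

lemma comp_pow_apply (P : Kernel Z Z) (k : ℕ) (z : Z) : P ∘ₘ (P ^ k) z = (P ^ (k + 1)) z := by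
  rw [pow_succ']; exact (Kernel.comp_apply _ _ _).symm

lemma inv_natCast_add_one_mul_le {c : ℝ≥0∞} {n : ℕ} {s : ℕ → ℝ≥0∞} (h : ∀ k, s k ≤ c) :
    (n + 1 : ℝ≥0∞)⁻¹ * ∑ k ∈ Finset.range (n + 1), s k ≤ c :=
  calc (n + 1 : ℝ≥0∞)⁻¹ * ∑ k ∈ Finset.range (n + 1), s k
      ≤ (n + 1 : ℝ≥0∞)⁻¹ * ((n + 1 : ℝ≥0∞) * c) := by
        gcongr; exact (Finset.sum_le_card_nsmul _ _ _ fun k _ => h k).trans_eq (by simp)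
    _ = c := ENNReal.inv_mul_cancel_left (by simp) (by finiteness)

instance isProbabilityMeasure_cesaroMean [IsMarkovKernel P] (z : Z) (n : ℕ) :
    IsProbabilityMeasure (cesaroMean P z n) :=
  ⟨by simpa [cesaroMean] using ENNReal.inv_mul_cancel (by simp) (by finiteness)⟩

lemma comp_cesaroMean_add (P : Kernel Z Z) (z : Z) (n : ℕ) :
    P ∘ₘ cesaroMean P z n + (n + 1 : ℝ≥0∞)⁻¹ • (P ^ 0) z =
      cesaroMean P z n + (n + 1 : ℝ≥0∞)⁻¹ • (P ^ (n + 1)) z := by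
  have hsum (s : Finset ℕ) : P ∘ₘ ∑ k ∈ s, (P ^ k) z = ∑ k ∈ s, (P ^ (k + 1)) z := by
    induction s using Finset.induction with
    | empty => simp
    | insert k s hk ih =>
      rw [Finset.sum_insert hk, Finset.sum_insert hk, Measure.comp_add, ih, comp_pow_apply]
  rw [cesaroMean, Measure.comp_smul, hsum, ← smul_add, ← smul_add,
    ← Finset.sum_range_succ' fun k => (P ^ k) z, Finset.sum_range_succ]

lemma tendsto_integral_comp_cesaroMean_sub [TopologicalSpace Z] [OpensMeasurableSpace Z]
    [IsMarkovKernel P] (z : Z) (φ : BoundedContinuousFunction Z ℝ) :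
    Tendsto (fun n => ∫ w, φ w ∂(P ∘ₘ cesaroMean P z n) - ∫ w, φ w ∂cesaroMean P z n)
      atTop (𝓝 0) := by
  have hdiff (n : ℕ) : ∫ w, φ w ∂(P ∘ₘ cesaroMean P z n) - ∫ w, φ w ∂cesaroMean P z n =
      (n + 1 : ℝ)⁻¹ * (∫ w, φ w ∂(P ^ (n + 1)) z - ∫ w, φ w ∂(P ^ 0) z) := by
    have hfin : (n + 1 : ℝ≥0∞)⁻¹ ≠ ∞ := by simp
    have h := congrArg (fun ν => ∫ w, φ w ∂ν) (comp_cesaroMean_add P z n)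
    rw [integral_add_measure (φ.integrable _) ((φ.integrable _).smul_measure hfin),
      integral_add_measure (φ.integrable _) ((φ.integrable _).smul_measure hfin),
      integral_smul_measure, integral_smul_measure] at h
    have hreal : ((n + 1 : ℝ≥0∞)⁻¹).toReal = (n + 1 : ℝ)⁻¹ := by
      rw [ENNReal.toReal_inv, ENNReal.toReal_add (by simp) (by simp)]; simp
    simp only [smul_eq_mul, hreal] at h
    linear_combination h
  have hbound (n : ℕ) :
      ‖∫ w, φ w ∂(P ^ (n + 1)) z - ∫ w, φ w ∂(P ^ 0) z‖ ≤ ‖φ‖ + ‖φ‖ :=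
    norm_sub_le_of_le (φ.norm_integral_le_norm _) (φ.norm_integral_le_norm _)
  simp_rw [hdiff]
  refine (tendsto_one_div_add_atTop_nhds_zero_nat (𝕜 := ℝ)).congr (fun n => one_div _)
    |>.zero_mul_isBoundedUnder_le ?_
  exact isBoundedUnder_of ⟨_, hbound⟩

end Feller

/-- Krylov–Bogolyubov: cluster points of the Cesàro means are invariant. -/
theorem IsFeller.exists_invariant {Z : Type*} [TopologicalSpace Z] [T2Space Z]
    [HasOuterApproxClosed Z] [MeasurableSpace Z] [BorelSpace Z] {P : Kernel Z Z}
    [IsMarkovKernel P] (hP : IsFeller P) (z : Z)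
    (htight : IsTightMeasureSet (Set.range fun k => (P ^ k) z)) :
    ∃ π : Measure Z, IsProbabilityMeasure π ∧ P.Invariant π := by
  let ν : ℕ → ProbabilityMeasure Z := fun n => ⟨cesaroMean P z n, inferInstance⟩
  have hν : IsTightMeasureSet {((μ : ProbabilityMeasure Z) : Measure Z) | μ ∈ Set.range ν} := by
    rw [isTightMeasureSet_iff_exists_isCompact_measure_compl_le] at htight ⊢
    intro ε hε
    obtain ⟨K, hK, hKε⟩ := htight ε hε
    refine ⟨K, hK, ?_⟩
    rintro _ ⟨_, ⟨n, rfl⟩, rfl⟩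
    simpa [ν, cesaroMean] using inv_natCast_add_one_mul_le (n := n) fun k => hKε _ ⟨k, rfl⟩
  obtain ⟨π, -, hπ⟩ := (isCompact_closure_of_isTightMeasureSet hν).ultrafilter_le_nhds
    ((hyperfilter ℕ : Ultrafilter ℕ).map ν)
    (le_principal_iff.2 <| mem_map.2 <| univ_mem' fun n => subset_closure ⟨n, rfl⟩)
  have hweak := ProbabilityMeasure.tendsto_iff_forall_integral_tendsto.1
    (show Tendsto ν (hyperfilter ℕ) (𝓝 π) from hπ)
  refine ⟨π, inferInstance, ext_of_forall_integral_eq_of_IsFiniteMeasure fun φ => ?_⟩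
  let Pφ : BoundedContinuousFunction Z ℝ := .ofNormedAddCommGroup _ (hP φ) ‖φ‖ fun z =>
    φ.norm_integral_le_norm (P z)
  have hPφ (u : Measure Z) [IsProbabilityMeasure u] :
      ∫ w, φ w ∂(P ∘ₘ u) = ∫ w, Pφ w ∂u := by
    rw [Measure.comp_eq_comp_const_apply, Kernel.integral_comp (φ.integrable _), Kernel.const_apply]
    rfl
  have hlim := (hweak Pφ).sub (hweak φ)
  have hzero := (tendsto_integral_comp_cesaroMean_sub (P := P) z φ).mono_left
    (Nat.hyperfilter_le_atTop)
  simp_rw [hPφ] at hzero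
  rw [hPφ]
  exact sub_eq_zero.1 (tendsto_nhds_unique hlim hzero)

/-! ### Drift conditions -/

section Drift

variable {Z : Type*} [MeasurableSpace Z] {P : Kernel Z Z} {Φ : Z → ℝ≥0∞} {ρ b : ℝ≥0∞}

/-- The geometric drift condition `P Φ ≤ ρ Φ + b` for a Lyapunov function `Φ`. -/
def HasDrift (P : Kernel Z Z) (Φ : Z → ℝ≥0∞) (ρ b : ℝ≥0∞) : Prop :=
  ∀ z, ∫⁻ w, Φ w ∂P z ≤ ρ * Φ z + b

lemma mul_mul_one_sub_inv_add (hρ : ρ < 1) : ρ * (b * (1 - ρ)⁻¹) + b = b * (1 - ρ)⁻¹ := by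
  have hcancel : (1 - ρ) * (1 - ρ)⁻¹ = 1 :=
    ENNReal.mul_inv_cancel (tsub_pos_of_lt hρ).ne' (by finiteness)
  calc ρ * (b * (1 - ρ)⁻¹) + b = b * (ρ * (1 - ρ)⁻¹ + (1 - ρ) * (1 - ρ)⁻¹) := by
        rw [hcancel]; ring
    _ = b * (1 - ρ)⁻¹ := by rw [← add_mul, add_tsub_cancel_of_le hρ.le, one_mul]

lemma HasDrift.lintegral_pow_le [IsMarkovKernel P] (hΦ : Measurable Φ) (hP : HasDrift P Φ ρ b)
    (hρ : ρ < 1) (k : ℕ) (z : Z) : ∫⁻ w, Φ w ∂(P ^ k) z ≤ ρ ^ k * Φ z + b * (1 - ρ)⁻¹ := by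
  induction k with
  | zero =>
    rw [pow_zero, show (1 : Kernel Z Z) = Kernel.id from rfl, Kernel.id_apply,
      lintegral_dirac' _ hΦ]
    simp
  | succ k ih =>
    rw [← comp_pow_apply, Measure.lintegral_bind P.aemeasurable hΦ.aemeasurable]
    calc ∫⁻ w, ∫⁻ w', Φ w' ∂P w ∂(P ^ k) z ≤ ∫⁻ w, (ρ * Φ w + b) ∂(P ^ k) z := lintegral_mono hP
      _ = ρ * ∫⁻ w, Φ w ∂(P ^ k) z + b := by
        rw [lintegral_add_right _ measurable_const, lintegral_const_mul _ hΦ]; simp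
      _ ≤ ρ * (ρ ^ k * Φ z + b * (1 - ρ)⁻¹) + b := by gcongr
      _ = ρ ^ (k + 1) * Φ z + b * (1 - ρ)⁻¹ := by
        rw [mul_add, add_assoc, mul_mul_one_sub_inv_add hρ]; ring

lemma HasDrift.isTightMeasureSet_range_pow [TopologicalSpace Z] [IsMarkovKernel P]
    (hΦ : Measurable Φ) (hcpt : ∀ r : ℝ≥0, ∃ K : Set Z, IsCompact K ∧ {z | Φ z ≤ r} ⊆ K)
    (hP : HasDrift P Φ ρ b) (hρ : ρ < 1) (hb : b ≠ ∞) {z : Z} (hz : Φ z ≠ ∞) :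
    IsTightMeasureSet (Set.range fun k => (P ^ k) z) := by
  set B := Φ z + b * (1 - ρ)⁻¹
  have hBtop : B ≠ ∞ := by
    have : 1 - ρ ≠ 0 := (tsub_pos_of_lt hρ).ne'
    finiteness
  have hmoment (k : ℕ) : ∫⁻ w, Φ w ∂(P ^ k) z ≤ B :=
    (hP.lintegral_pow_le hΦ hρ k z).trans
      (add_le_add_left (mul_le_of_le_one_left' (pow_le_one' hρ.le k)) _)
  rw [isTightMeasureSet_iff_exists_isCompact_measure_compl_le]
  intro ε hε
  obtain ⟨r, hr, hrε⟩ : ∃ r : ℝ≥0, r ≠ 0 ∧ B / r ≤ ε := by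
    obtain ⟨r, hr⟩ := ENNReal.exists_nnreal_pos_mul_lt hBtop hε.ne'
    exact ⟨r⁻¹, inv_ne_zero hr.1.ne', by
      rw [ENNReal.coe_inv hr.1.ne', div_eq_mul_inv, inv_inv, mul_comm]; exact hr.2.le⟩
  obtain ⟨K, hK, hΦK⟩ := hcpt r
  refine ⟨K, hK, ?_⟩
  rintro _ ⟨k, rfl⟩
  calc (P ^ k) z Kᶜ ≤ (P ^ k) z {w | r ≤ Φ w} :=
        measure_mono fun w hw => (not_le.1 fun h : Φ w ≤ r => hw (hΦK h)).le
    _ ≤ (∫⁻ w, Φ w ∂(P ^ k) z) / r :=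
        meas_ge_le_lintegral_div hΦ.aemeasurable (by simpa using hr) ENNReal.coe_ne_top
    _ ≤ B / r := by gcongr; exact hmoment k
    _ ≤ ε := hrε

lemma invariant_pow {π : Measure Z} (hπ : P.Invariant π) (k : ℕ) : (P ^ k).Invariant π := by
  induction k with
  | zero => exact Measure.id_comp
  | succ k ih => rw [pow_succ]; exact ih.comp hπ

lemma lintegral_le_of_forall_min_le {π : Measure Z} (hΦ : Measurable Φ) {B : ℝ≥0∞}
    (h : ∀ M : ℕ, ∫⁻ z, min (Φ z) M ∂π ≤ B) : ∫⁻ z, Φ z ∂π ≤ B := by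
  have hsup (z : Z) : ⨆ M : ℕ, min (Φ z) M = Φ z := by
    rw [← inf_iSup_eq, ENNReal.iSup_natCast, inf_top_eq]
  calc ∫⁻ z, Φ z ∂π = ∫⁻ z, ⨆ M : ℕ, min (Φ z) M ∂π := by simp_rw [hsup]
    _ = ⨆ M : ℕ, ∫⁻ z, min (Φ z) M ∂π :=
        lintegral_iSup (fun M => hΦ.min measurable_const) fun i j hij z =>
          min_le_min_left _ (Nat.cast_le.2 hij)
    _ ≤ B := iSup_le h

-- The truncation is needed because `Φ` is not known to be `π`-integrable beforehand.
lemma HasDrift.lintegral_le_of_invariant [IsMarkovKernel P] (hΦ : Measurable Φ)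
    (hΦtop : ∀ z, Φ z ≠ ∞) (hP : HasDrift P Φ ρ b) (hρ : ρ < 1) {π : Measure Z}
    [IsProbabilityMeasure π] (hπ : P.Invariant π) : ∫⁻ z, Φ z ∂π ≤ b * (1 - ρ)⁻¹ := by
  set B := b * (1 - ρ)⁻¹
  refine lintegral_le_of_forall_min_le hΦ fun M => ?_
  have hstep (k : ℕ) : ∫⁻ z, min (Φ z) M ∂π ≤ ∫⁻ z, min (ρ ^ k * Φ z + B) M ∂π := by
    conv_lhs => rw [← (invariant_pow hπ k).def, Measure.lintegral_bind (P ^ k).aemeasurable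
      (hΦ.min measurable_const).aemeasurable]
    refine lintegral_mono fun z => le_min ?_ ?_
    · exact (lintegral_mono fun w => min_le_left _ _).trans (hP.lintegral_pow_le hΦ hρ k z)
    · exact (lintegral_mono fun w => min_le_right _ _).trans_eq (by simp)
  have hlim : Tendsto (fun k => ∫⁻ z, min (ρ ^ k * Φ z + B) M ∂π) atTop
      (𝓝 (∫⁻ _, min (0 + B) M ∂π)) := by
    refine tendsto_lintegral_of_dominated_convergence (fun _ => (M : ℝ≥0∞))
      (fun k => by fun_prop) (fun k => .of_forall fun z => min_le_right _ _) (by simp)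
      (.of_forall fun z => ?_)
    have hpow : Tendsto (fun k => ρ ^ k * Φ z) atTop (𝓝 (0 * Φ z)) :=
      ENNReal.Tendsto.mul_const (ENNReal.tendsto_pow_atTop_nhds_zero_of_lt_one hρ)
        (Or.inr (hΦtop z))
    rw [zero_mul] at hpow
    exact (hpow.add tendsto_const_nhds).min tendsto_const_nhds
  exact (ge_of_tendsto' hlim hstep).trans (by simp)

end Drift

/-! ### Markovian couplings -/

section Coupling

variable {W Z : Type*} [MeasurableSpace W] [MeasurableSpace Z] {P : Kernel Z Z}

lemma map_comp_of_intertwine {Q : Kernel W W} {f : W → Z} (hf : Measurable f)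
    (h : ∀ w, (Q w).map f = P (f w)) (θ : Measure W) : (Q ∘ₘ θ).map f = P ∘ₘ θ.map f := by
  rw [Measure.map_comp _ _ hf, Measure.bind, Measure.bind, Measure.map_map P.measurable hf]
  congr 2
  exact funext fun w => (Kernel.map_apply Q hf w).trans (h w)

lemma map_pow_comp_of_intertwine {Q : Kernel W W} {f : W → Z} (hf : Measurable f)
    (h : ∀ w, (Q w).map f = P (f w)) (θ : Measure W) (k : ℕ) :
    ((Q ^ k) ∘ₘ θ).map f = (P ^ k) ∘ₘ θ.map f := by
  induction k with
  | zero => exact (congrArg (Measure.map f) Measure.id_comp).trans Measure.id_comp.symm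
  | succ k ih =>
    rw [pow_succ', pow_succ']
    calc ((Q ∘ₖ (Q ^ k)) ∘ₘ θ).map f = P ∘ₘ ((Q ^ k) ∘ₘ θ).map f := by
          rw [← Measure.comp_assoc, map_comp_of_intertwine hf h]
      _ = (P ∘ₖ (P ^ k)) ∘ₘ θ.map f := by rw [ih, Measure.comp_assoc]

/-- `Q` is a Markovian coupling of two copies of the chain with transition kernel `P`. -/
structure IsMarkovCoupling (Q : Kernel (Z × Z) (Z × Z)) (P : Kernel Z Z) : Prop where
  map_fst : ∀ zw, (Q zw).map Prod.fst = P zw.1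
  map_snd : ∀ zw, (Q zw).map Prod.snd = P zw.2

variable {Q : Kernel (Z × Z) (Z × Z)} {Φ : Z → ℝ≥0∞} {L : Z × Z → ℝ≥0∞} {ρ ρ' b R : ℝ≥0∞}

lemma IsMarkovCoupling.exists_coupling_pow [IsMarkovKernel Q] (hQ : IsMarkovCoupling Q P)
    (hL : Measurable L) (hLρ : HasDrift Q L ρ 0) (hρ : ρ < 1) (u v : Measure Z)
    [IsProbabilityMeasure u] [IsProbabilityMeasure v] (k : ℕ) :
    ∃ θ : Measure (Z × Z), θ.map Prod.fst = (P ^ k) ∘ₘ u ∧ θ.map Prod.snd = (P ^ k) ∘ₘ v ∧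
      ∫⁻ zw, L zw ∂θ ≤ ρ ^ k * ∫⁻ zw, L zw ∂u.prod v := by
  refine ⟨Measure.bind (u.prod v) (Q ^ k : Kernel _ _), ?_, ?_, ?_⟩
  · rw [map_pow_comp_of_intertwine measurable_fst hQ.map_fst, Measure.map_fst_prod,
      measure_univ, one_smul]
  · rw [map_pow_comp_of_intertwine measurable_snd hQ.map_snd, Measure.map_snd_prod,
      measure_univ, one_smul]
  · rw [Measure.lintegral_bind (Q ^ k).aemeasurable hL.aemeasurable, ← lintegral_const_mul _ hL]
    exact lintegral_mono fun zw => by simpa using hLρ.lintegral_pow_le hL hρ k zw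

lemma IsMarkovCoupling.hasDrift_add (hQ : IsMarkovCoupling Q P)
    (hΦ : Measurable Φ) (hP : HasDrift P Φ ρ b) :
    HasDrift Q (fun zw => Φ zw.1 + Φ zw.2) ρ (2 * b) := fun zw =>
  calc ∫⁻ zw', (Φ zw'.1 + Φ zw'.2) ∂Q zw = ∫⁻ z, Φ z ∂P zw.1 + ∫⁻ z, Φ z ∂P zw.2 := by
        rw [lintegral_add_left (by fun_prop), ← hQ.map_fst, ← hQ.map_snd,
          lintegral_map hΦ measurable_fst, lintegral_map hΦ measurable_snd]
    _ ≤ (ρ * Φ zw.1 + b) + (ρ * Φ zw.2 + b) := add_le_add (hP _) (hP _)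
    _ = ρ * (Φ zw.1 + Φ zw.2) + 2 * b := by ring

lemma lintegral_prod_ne_top (hΦ : Measurable Φ) (hLΦ : ∀ z w, L (z, w) ≤ Φ z + Φ w + R)
    (hR : R ≠ ∞) {u v : Measure Z} [IsProbabilityMeasure u] [IsProbabilityMeasure v]
    (hu : ∫⁻ z, Φ z ∂u ≠ ∞) (hv : ∫⁻ z, Φ z ∂v ≠ ∞) : ∫⁻ zw, L zw ∂u.prod v ≠ ∞ := by
  refine ne_top_of_le_ne_top (b := ∫⁻ z, Φ z ∂u + ∫⁻ z, Φ z ∂v + R) (by finiteness) ?_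
  calc ∫⁻ zw, L zw ∂u.prod v ≤ ∫⁻ zw, (Φ zw.1 + Φ zw.2 + R) ∂u.prod v :=
        lintegral_mono fun zw => hLΦ zw.1 zw.2
    _ = ∫⁻ zw, Φ zw.1 ∂u.prod v + ∫⁻ zw, Φ zw.2 ∂u.prod v + R := by
        rw [lintegral_add_right _ measurable_const, lintegral_add_left (by fun_prop)]
        simp
    _ = ∫⁻ z, Φ z ∂u + ∫⁻ z, Φ z ∂v + R := by
        rw [← lintegral_map hΦ measurable_fst, ← lintegral_map hΦ measurable_snd,
          Measure.map_fst_prod, Measure.map_snd_prod, measure_univ, measure_univ, one_smul,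
          one_smul]

lemma HasDrift.lintegral_ne_top_of_invariant [IsMarkovKernel P] (hP : HasDrift P Φ ρ b)
    (hΦ : Measurable Φ) (hΦtop : ∀ z, Φ z ≠ ∞) (hρ : ρ < 1) (hb : b ≠ ∞)
    {π : Measure Z} [IsProbabilityMeasure π] (hπ : P.Invariant π) : ∫⁻ z, Φ z ∂π ≠ ∞ := by
  have : 1 - ρ ≠ 0 := (tsub_pos_of_lt hρ).ne'
  exact ne_top_of_le_ne_top (by finiteness) (hP.lintegral_le_of_invariant hΦ hΦtop hρ hπ)

lemma IsMarkovCoupling.exists_coupling_pow_invariant [IsMarkovKernel P] [IsMarkovKernel Q]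
    (hQ : IsMarkovCoupling Q P) (hΦ : Measurable Φ) (hΦtop : ∀ z, Φ z ≠ ∞)
    (hP : HasDrift P Φ ρ b) (hρ : ρ < 1) (hb : b ≠ ∞)
    (hL : Measurable L) (hLρ : HasDrift Q L ρ' 0) (hρ' : ρ' < 1)
    (hLΦ : ∀ z w, L (z, w) ≤ Φ z + Φ w + R) (hR : R ≠ ∞)
    {π : Measure Z} [IsProbabilityMeasure π] (hπ : P.Invariant π) (z : Z) :
    ∃ C ≠ ∞, ∀ k, ∃ θ : Measure (Z × Z), θ.map Prod.fst = (P ^ k) z ∧ θ.map Prod.snd = π ∧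
      ∫⁻ zw, L zw ∂θ ≤ ρ' ^ k * C := by
  have hπΦ := hP.lintegral_ne_top_of_invariant hΦ hΦtop hρ hb hπ
  have hzΦ : ∫⁻ w, Φ w ∂Measure.dirac z ≠ ∞ := by
    rw [lintegral_dirac' _ hΦ]; exact hΦtop z
  refine ⟨_, lintegral_prod_ne_top hΦ hLΦ hR hzΦ hπΦ, fun k => ?_⟩
  obtain ⟨θ, hθ₁, hθ₂, hθ⟩ := hQ.exists_coupling_pow hL hLρ hρ' (Measure.dirac z) π k
  refine ⟨θ, ?_, ?_, hθ⟩
  · rw [hθ₁, Measure.dirac_bind (P ^ k).measurable]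
  · rw [hθ₂, (invariant_pow hπ k).def]

end Coupling

section Uniqueness

variable {Z : Type*} [MetricSpace Z] [MeasurableSpace Z] [BorelSpace Z]

lemma enorm_integral_map_fst_sub_le {φ : Z → ℝ} {A K : ℝ≥0} (hA : ∀ x y, dist (φ x) (φ y) ≤ A)
    (hK : LipschitzWith K φ) (θ : Measure (Z × Z)) [IsProbabilityMeasure θ] :
    ‖∫ z, φ z ∂θ.map Prod.fst - ∫ z, φ z ∂θ.map Prod.snd‖ₑ ≤
      (max A K : ℝ≥0) * ∫⁻ zw, min 1 (edist zw.1 zw.2) ∂θ := by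
  obtain ⟨zw₀⟩ := nonempty_of_isProbabilityMeasure θ
  have hbound (z : Z) : ‖φ z‖ ≤ ‖φ zw₀.1‖ + A := by
    have := hA z zw₀.1
    rw [dist_eq_norm] at this
    linarith [norm_sub_norm_le (φ z) (φ zw₀.1)]
  have hφ := hK.continuous.measurable
  have hint {p : Z × Z → Z} (hp : Measurable p) : Integrable (fun zw => φ (p zw)) θ :=
    .of_bound (hφ.comp hp).aestronglyMeasurable _ (.of_forall fun zw => hbound (p zw))
  rw [integral_map measurable_fst.aemeasurable hφ.aestronglyMeasurable,
    integral_map measurable_snd.aemeasurable hφ.aestronglyMeasurable,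
    ← integral_sub (hint measurable_fst) (hint measurable_snd),
    ← lintegral_const_mul' _ _ ENNReal.coe_ne_top]
  refine (enorm_integral_le_lintegral_enorm _).trans (lintegral_mono fun zw => ?_)
  rw [← edist_eq_enorm_sub, ENNReal.coe_max, mul_min, mul_one]
  refine le_min (le_max_of_le_left ?_) ((hK zw.1 zw.2).trans (by gcongr; exact le_max_right _ _))
  rw [edist_le_coe, ← NNReal.coe_le_coe, coe_nndist]
  exact hA _ _

lemma ext_of_forall_exists_coupling {u v : Measure Z} [IsProbabilityMeasure u]
    [IsProbabilityMeasure v]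
    (h : ∀ ε > 0, ∃ θ : Measure (Z × Z), θ.map Prod.fst = u ∧ θ.map Prod.snd = v ∧
      ∫⁻ zw, min 1 (edist zw.1 zw.2) ∂θ ≤ ε) : u = v := by
  have hlip (φ : Z → ℝ) (A K : ℝ≥0) (hA : ∀ x y, dist (φ x) (φ y) ≤ A)
      (hK : LipschitzWith K φ) : ∫ z, φ z ∂u = ∫ z, φ z ∂v := by
    rw [← sub_eq_zero, ← enorm_eq_zero]
    refine le_antisymm (ENNReal.le_of_forall_pos_le_add fun ε hε _ => ?_) zero_le
    obtain ⟨δ, hδ, hδε⟩ := ENNReal.exists_nnreal_pos_mul_lt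
      (ENNReal.coe_ne_top (r := max A K)) (ENNReal.coe_ne_zero.2 hε.ne')
    obtain ⟨θ, rfl, rfl, hθ⟩ := h δ (by simpa using hδ)
    have : IsProbabilityMeasure θ := Measure.isProbabilityMeasure_of_map Prod.fst
    calc _ ≤ _ := enorm_integral_map_fst_sub_le hA hK θ
      _ ≤ (max A K : ℝ≥0) * δ := by gcongr
      _ ≤ 0 + ε := by rw [zero_add, mul_comm]; exact hδε.le
  let u' : ProbabilityMeasure Z := ⟨u, inferInstance⟩
  let v' : ProbabilityMeasure Z := ⟨v, inferInstance⟩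
  have hlim : Tendsto (fun _ : ℕ => u') atTop (𝓝 v') := by
    rw [tendsto_iff_forall_lipschitz_integral_tendsto]
    rintro φ ⟨A, hA⟩ ⟨K, hK⟩
    have := hlip φ A.toNNReal K (fun x y => (hA x y).trans (Real.le_coe_toNNReal A)) hK
    exact tendsto_const_nhds.congr fun _ => this.symm
  have huv : u' = v' := tendsto_nhds_unique tendsto_const_nhds hlim
  exact congrArg Subtype.val huv

variable {P : Kernel Z Z} {Q : Kernel (Z × Z) (Z × Z)} {Φ : Z → ℝ≥0∞} {L : Z × Z → ℝ≥0∞}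
  {ρ ρ' b R : ℝ≥0∞}

lemma IsMarkovCoupling.invariant_unique [IsMarkovKernel P] [IsMarkovKernel Q]
    (hQ : IsMarkovCoupling Q P) (hΦ : Measurable Φ) (hΦtop : ∀ z, Φ z ≠ ∞)
    (hP : HasDrift P Φ ρ b) (hρ : ρ < 1) (hb : b ≠ ∞)
    (hL : Measurable L) (hLρ : HasDrift Q L ρ' 0) (hρ' : ρ' < 1)
    (hLΦ : ∀ z w, L (z, w) ≤ Φ z + Φ w + R) (hR : R ≠ ∞)
    (hdist : ∀ z w, min 1 (edist z w) ≤ L (z, w)) {u v : Measure Z} [IsProbabilityMeasure u]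
    [IsProbabilityMeasure v] (hu : P.Invariant u) (hv : P.Invariant v) : u = v := by
  have huΦ := hP.lintegral_ne_top_of_invariant hΦ hΦtop hρ hb hu
  have hvΦ := hP.lintegral_ne_top_of_invariant hΦ hΦtop hρ hb hv
  have hlim : Tendsto (fun k => ρ' ^ k * ∫⁻ zw, L zw ∂u.prod v) atTop (𝓝 0) := by
    simpa using ENNReal.Tendsto.mul_const (ENNReal.tendsto_pow_atTop_nhds_zero_of_lt_one hρ')
      (Or.inr (lintegral_prod_ne_top hΦ hLΦ hR huΦ hvΦ))
  refine ext_of_forall_exists_coupling fun ε hε => ?_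
  obtain ⟨k, hk⟩ := (hlim.eventually_le_const hε).exists
  obtain ⟨θ, hθ₁, hθ₂, hθ⟩ := hQ.exists_coupling_pow hL hLρ hρ' u v k
  rw [(invariant_pow hu k).def] at hθ₁
  rw [(invariant_pow hv k).def] at hθ₂
  exact ⟨θ, hθ₁, hθ₂, (lintegral_mono fun zw : Z × Z => hdist zw.1 zw.2).trans (hθ.trans hk)⟩

end Uniqueness

/-! ### Contraction of a cost that distinguishes coupled and uncoupled pairs -/

section Cost

variable {W : Type*} {S : Set W} {D V : W → ℝ≥0∞}

open Classical in
/-- The cost of a pair: `D` once the pair is coupled (lies in `S`), and the Lyapunov function `V`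
plus a penalty `R` before. -/
def couplingCost (S : Set W) (D V : W → ℝ≥0∞) (R : ℝ≥0∞) : W → ℝ≥0∞ :=
  S.piecewise D fun w => V w + R

lemma couplingCost_of_mem (R : ℝ≥0∞) {w : W} (hw : w ∈ S) : couplingCost S D V R w = D w :=
  if_pos hw

lemma couplingCost_of_notMem (R : ℝ≥0∞) {w : W} (hw : w ∉ S) :
    couplingCost S D V R w = V w + R :=
  if_neg hw

lemma couplingCost_le_add_indicator (hDV : ∀ w ∈ S, D w ≤ V w) (R : ℝ≥0∞) (w : W) :
    couplingCost S D V R w ≤ V w + Sᶜ.indicator (fun _ => R) w := by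
  by_cases hw : w ∈ S
  · simpa [couplingCost_of_mem R hw, hw] using hDV w hw
  · simp [couplingCost_of_notMem R hw, hw]

variable [MeasurableSpace W] {Q : Kernel W W} {ρ θ b : ℝ≥0∞}

lemma measurable_couplingCost (hS : MeasurableSet S) (hD : Measurable D) (hV : Measurable V)
    (R : ℝ≥0∞) : Measurable (couplingCost S D V R) := by
  classical
  unfold couplingCost
  exact hD.piecewise hS (hV.add_const R)

-- With `R` large, the decrease of the penalty at the meeting absorbs the constant of the drift.
theorem exists_hasDrift_couplingCost (hS : MeasurableSet S) (hV : Measurable V)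
    (hSS : ∀ w ∈ S, ∀ᵐ w' ∂Q w, w' ∈ S) (hD : ∀ w ∈ S, ∫⁻ w', D w' ∂Q w ≤ ρ * D w)
    (hVρ : HasDrift Q V ρ b) (hρ : ρ < 1) (hb : b ≠ ∞) (hDV : ∀ w ∈ S, D w ≤ V w)
    (hmeet : ∀ w ∉ S, Q w Sᶜ ≤ θ) (hθ : θ < 1) :
    ∃ R ρ' : ℝ≥0∞, 1 ≤ R ∧ R ≠ ∞ ∧ ρ' < 1 ∧ HasDrift Q (couplingCost S D V R) ρ' 0 := by
  obtain ⟨ρ', hmax, hρ'⟩ := exists_between (max_lt hρ hθ)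
  obtain ⟨hρρ', hθρ'⟩ := max_lt_iff.1 hmax
  have hgap : ρ' - θ ≠ 0 := (tsub_pos_of_lt hθρ').ne'
  have hgaptop : ρ' - θ ≠ ∞ := by finiteness
  refine ⟨b / (ρ' - θ) + 1, ρ', le_add_self, by finiteness, hρ', fun w => ?_⟩
  set R := b / (ρ' - θ) + 1
  have hbR : θ * R + b ≤ ρ' * R :=
    calc θ * R + b = θ * R + (ρ' - θ) * (b / (ρ' - θ)) := by
          rw [ENNReal.mul_div_cancel hgap hgaptop]
      _ ≤ θ * R + (ρ' - θ) * R := by gcongr; exact le_self_add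
      _ = ρ' * R := by rw [← add_mul, add_tsub_cancel_of_le hθρ'.le]
  rw [add_zero]
  by_cases hw : w ∈ S
  · rw [couplingCost_of_mem R hw]
    calc ∫⁻ w', couplingCost S D V R w' ∂Q w = ∫⁻ w', D w' ∂Q w :=
          lintegral_congr_ae ((hSS w hw).mono fun w' hw' => couplingCost_of_mem R hw')
      _ ≤ ρ * D w := hD w hw
      _ ≤ ρ' * D w := by gcongr
  · rw [couplingCost_of_notMem R hw]
    calc ∫⁻ w', couplingCost S D V R w' ∂Q w
        ≤ ∫⁻ w', (V w' + Sᶜ.indicator (fun _ => R) w') ∂Q w :=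
          lintegral_mono fun w' => couplingCost_le_add_indicator hDV R w'
      _ = ∫⁻ w', V w' ∂Q w + R * Q w Sᶜ := by
          rw [lintegral_add_left hV, lintegral_indicator_const hS.compl]
      _ ≤ (ρ * V w + b) + R * θ :=
          add_le_add (hVρ w) (mul_le_mul_right (hmeet w hw) R)
      _ ≤ (ρ' * V w + b) + R * θ := by gcongr
      _ = ρ' * V w + (θ * R + b) := by ring
      _ ≤ ρ' * (V w + R) := by rw [mul_add _ (V w)]; gcongr

end Cost

/-! ### Chains driven by random maps -/

section RandomMap

variable {E Z : Type*} [MeasurableSpace E] [MeasurableSpace Z] {m : Measure E}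
  [IsProbabilityMeasure m] {F : E → Z → Z}

/-- The transition kernel of the chain `z ↦ F e z` with noise `e` of law `m`. -/
def randomMapKernel (m : Measure E) (F : E → Z → Z) : Kernel Z Z :=
  (Kernel.const Z m ×ₖ Kernel.id).map (Function.uncurry F)

/-- Two copies of a random map driven by the same noise. -/
def pairMap (F : E → Z → Z) (e : E) (zw : Z × Z) : Z × Z := (F e zw.1, F e zw.2)

lemma measurable_uncurry_pairMap (hF : Measurable (Function.uncurry F)) :
    Measurable (Function.uncurry (pairMap F)) :=
  (hF.comp (measurable_fst.prodMk (measurable_fst.comp measurable_snd))).prodMk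
    (hF.comp (measurable_fst.prodMk (measurable_snd.comp measurable_snd)))

lemma measurable_apply_of_uncurry (hF : Measurable (Function.uncurry F)) (z : Z) :
    Measurable fun e => F e z :=
  hF.comp measurable_prodMk_right

lemma randomMapKernel_apply (hF : Measurable (Function.uncurry F)) (z : Z) :
    randomMapKernel m F z = m.map fun e => F e z := by
  rw [randomMapKernel, Kernel.map_apply _ hF, Kernel.prod_apply, Kernel.const_apply,
    Kernel.id_apply, Measure.prod_dirac, Measure.map_map hF measurable_prodMk_right]
  rfl

lemma isMarkovKernel_randomMapKernel (hF : Measurable (Function.uncurry F)) :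
    IsMarkovKernel (randomMapKernel m F) :=
  Kernel.IsMarkovKernel.map _ hF

lemma lintegral_randomMapKernel (hF : Measurable (Function.uncurry F)) {φ : Z → ℝ≥0∞}
    (hφ : Measurable φ) (z : Z) : ∫⁻ w, φ w ∂randomMapKernel m F z = ∫⁻ e, φ (F e z) ∂m := by
  rw [randomMapKernel_apply hF, lintegral_map hφ (measurable_apply_of_uncurry hF z)]

lemma isMarkovCoupling_randomMapKernel_pairMap (hF : Measurable (Function.uncurry F)) :
    IsMarkovCoupling (randomMapKernel m (pairMap F)) (randomMapKernel m F) where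
  map_fst zw := by
    rw [randomMapKernel_apply hF, randomMapKernel_apply (measurable_uncurry_pairMap hF),
      Measure.map_map measurable_fst
        (measurable_apply_of_uncurry (measurable_uncurry_pairMap hF) zw)]
    rfl
  map_snd zw := by
    rw [randomMapKernel_apply hF, randomMapKernel_apply (measurable_uncurry_pairMap hF),
      Measure.map_map measurable_snd
        (measurable_apply_of_uncurry (measurable_uncurry_pairMap hF) zw)]
    rfl

lemma isFeller_randomMapKernel [TopologicalSpace Z] [FirstCountableTopology Z]
    [OpensMeasurableSpace Z] (hF : Measurable (Function.uncurry F))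
    (hFc : ∀ e, Continuous (F e)) : IsFeller (randomMapKernel m F) := by
  intro φ
  have hφ := φ.continuous.measurable
  have hFz := measurable_apply_of_uncurry hF
  simp_rw [randomMapKernel_apply hF,
    integral_map (hFz _).aemeasurable hφ.aestronglyMeasurable]
  exact continuous_of_dominated (fun z => (hφ.comp (hFz z)).aestronglyMeasurable)
    (fun z => .of_forall fun e => φ.norm_coe_le_norm _) (integrable_const _)
    (.of_forall fun e => φ.continuous.comp (hFc e))

end RandomMap

/-! ### Exponentials of generators -/

section MatrixExp

open Matrix

variable {ι : Type*} [Fintype ι] [DecidableEq ι] {A : Matrix ι ι ℝ}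

lemma hasSum_exp (A : Matrix ι ι ℝ) :
    HasSum (fun k : ℕ => (k.factorial : ℝ)⁻¹ • A ^ k) (NormedSpace.exp A) := by
  let _ : NormedRing (Matrix ι ι ℝ) := Matrix.linftyOpNormedRing
  let _ : NormedAlgebra ℝ (Matrix ι ι ℝ) := Matrix.linftyOpNormedAlgebra
  exact NormedSpace.exp_series_hasSum_exp' (𝕂 := ℝ) A

lemma hasSum_exp_apply (A : Matrix ι ι ℝ) (i j : ι) :
    HasSum (fun k : ℕ => (k.factorial : ℝ)⁻¹ * (A ^ k) i j) (NormedSpace.exp A i j) :=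
  Pi.hasSum.1 (Pi.hasSum.1 (hasSum_exp A) i) j

lemma exp_mulVec_of_mulVec_eq_zero {v : ι → ℝ} (hv : A *ᵥ v = 0) :
    NormedSpace.exp A *ᵥ v = v := by
  have hsum := (hasSum_exp A).map (mulVec.addMonoidHomLeft v)
    (continuous_id.matrix_mulVec continuous_const)
  have hterm (k : ℕ) (hk : k ≠ 0) : ((k.factorial : ℝ)⁻¹ • A ^ k) *ᵥ v = 0 := by
    obtain ⟨l, rfl⟩ := Nat.exists_eq_succ_of_ne_zero hk
    rw [smul_mulVec, pow_succ, ← mulVec_mulVec, hv, mulVec_zero, smul_zero]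
  refine hsum.unique ?_
  have hzero : ((Nat.factorial 0 : ℝ)⁻¹ • A ^ 0) *ᵥ v = v := by simp
  have hsingle := hasSum_single (f := fun k : ℕ => ((k.factorial : ℝ)⁻¹ • A ^ k) *ᵥ v) 0 hterm
  simp only [hzero] at hsingle
  exact hsingle

lemma vecMul_exp_of_vecMul_eq_zero {v : ι → ℝ} (hv : v ᵥ* A = 0) :
    v ᵥ* NormedSpace.exp A = v := by
  rw [← mulVec_transpose, ← exp_transpose, exp_mulVec_of_mulVec_eq_zero]
  rw [mulVec_transpose, hv]

lemma pow_apply_nonneg (hA : ∀ i j, 0 ≤ A i j) (k : ℕ) (i j : ι) : 0 ≤ (A ^ k) i j := by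
  induction k generalizing i j with
  | zero => rw [pow_zero, one_apply]; positivity
  | succ k ih =>
    rw [pow_succ, mul_apply]
    exact Finset.sum_nonneg fun l _ => mul_nonneg (ih i l) (hA l j)

lemma exists_pow_apply_pos (hA : ∀ i j, 0 ≤ A i j) {i j : ι}
    (hij : Relation.ReflTransGen (fun a b => 0 < A a b) i j) : ∃ k, 0 < (A ^ k) i j := by
  induction hij with
  | refl => exact ⟨0, by simp⟩
  | @tail b c _ hbc ih =>
    obtain ⟨k, hk⟩ := ih
    refine ⟨k + 1, ?_⟩
    rw [pow_succ, mul_apply]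
    exact Finset.sum_pos' (fun l _ => mul_nonneg (pow_apply_nonneg hA k i l) (hA l c))
      ⟨b, Finset.mem_univ b, mul_pos hk hbc⟩

lemma exp_eq_smul_exp_add_smul_one (A : Matrix ι ι ℝ) (c : ℝ) :
    NormedSpace.exp A = Real.exp (-c) • NormedSpace.exp (A + c • (1 : Matrix ι ι ℝ)) := by
  have hscalar : NormedSpace.exp ((-c) • (1 : Matrix ι ι ℝ)) = Real.exp (-c) • 1 := by
    rw [smul_one_eq_diagonal, exp_diagonal, smul_one_eq_diagonal]
    congr 1
    ext i
    rw [Pi.coe_exp, Real.exp_eq_exp_ℝ]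
  calc NormedSpace.exp A
      = NormedSpace.exp ((A + c • (1 : Matrix ι ι ℝ)) + (-c) • (1 : Matrix ι ι ℝ)) := by
        rw [neg_smul, add_neg_cancel_right]
    _ = _ := by
        rw [exp_add_of_commute _ _ ((Commute.one_right _).smul_right _), hscalar, mul_smul_one]

lemma exists_add_smul_one_nonneg {ι : Type*} [Finite ι] [DecidableEq ι] {A : Matrix ι ι ℝ}
    (hA : ∀ i j, i ≠ j → 0 ≤ A i j) :
    ∃ c : ℝ, 0 ≤ c ∧ ∀ i j, 0 ≤ (A + c • (1 : Matrix ι ι ℝ)) i j := by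
  cases nonempty_fintype ι
  refine ⟨∑ l, |A l l|, by positivity, fun i j => ?_⟩
  obtain rfl | hij := eq_or_ne i j
  · have : |A i i| ≤ ∑ l, |A l l| :=
      Finset.single_le_sum (f := fun l => |A l l|) (fun _ _ => abs_nonneg _) (Finset.mem_univ i)
    simp only [Matrix.add_apply, Matrix.smul_apply, one_apply_eq, smul_eq_mul, mul_one]
    linarith [neg_abs_le (A i i)]
  · simpa [hij] using hA i j hij

lemma exp_apply_nonneg (hA : ∀ i j, i ≠ j → 0 ≤ A i j) (i j : ι) :
    0 ≤ NormedSpace.exp A i j := by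
  obtain ⟨c, -, hAc⟩ := exists_add_smul_one_nonneg hA
  rw [exp_eq_smul_exp_add_smul_one A c]
  exact mul_nonneg (Real.exp_pos _).le <| (hasSum_exp_apply _ i j).nonneg fun k =>
    mul_nonneg (by positivity) (pow_apply_nonneg hAc k i j)

lemma exp_apply_pos (hA : ∀ i j, i ≠ j → 0 ≤ A i j) {i j : ι}
    (hij : Relation.ReflTransGen (fun a b => 0 < A a b) i j) : 0 < NormedSpace.exp A i j := by
  obtain ⟨c, hc, hAc⟩ := exists_add_smul_one_nonneg hA
  rw [exp_eq_smul_exp_add_smul_one A c]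
  have hle (a b : ι) : A a b ≤ (A + c • (1 : Matrix ι ι ℝ)) a b := by
    rw [Matrix.add_apply, Matrix.smul_apply, one_apply, smul_eq_mul, le_add_iff_nonneg_right]
    positivity
  obtain ⟨k, hk⟩ := exists_pow_apply_pos hAc (Relation.ReflTransGen.mono
    (fun a b hab => hab.trans_le (hle a b)) _ _ hij)
  have hterm := le_hasSum (hasSum_exp_apply _ i j) k fun l _ =>
    mul_nonneg (by positivity) (pow_apply_nonneg hAc l i j)
  exact mul_pos (Real.exp_pos _) (lt_of_lt_of_le (by positivity) hterm)

end MatrixExp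

section Stochastic

open Matrix

variable {ι : Type*} [Fintype ι] {Q : Matrix ι ι ℝ} {μ u : ι → ℝ}

lemma norm_mulVec_le_of_sum_eq [Nonempty ι] {R : Matrix ι ι ℝ} {r : ℝ} (hR : ∀ i j, 0 ≤ R i j)
    (hr : ∀ i, ∑ j, R i j = r) (u : ι → ℝ) : ‖R *ᵥ u‖ ≤ r * ‖u‖ := by
  refine (pi_norm_le_iff_of_nonempty _).2 fun i => ?_
  calc ‖∑ j, R i j * u j‖ ≤ ∑ j, ‖R i j * u j‖ := norm_sum_le _ _
    _ ≤ ∑ j, R i j * ‖u‖ := Finset.sum_le_sum fun j _ => by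
        rw [norm_mul, Real.norm_of_nonneg (hR i j)]
        exact mul_le_mul_of_nonneg_left (norm_le_pi_norm u j) (hR i j)
    _ = r * ‖u‖ := by rw [← Finset.sum_mul, hr]

variable [DecidableEq ι]

lemma norm_mulVec_le_of_mem_rowStochastic [Nonempty ι] (hQ : Q ∈ rowStochastic ℝ ι)
    (u : ι → ℝ) : ‖Q *ᵥ u‖ ≤ ‖u‖ :=
  (norm_mulVec_le_of_sum_eq (fun _ _ => nonneg_of_mem_rowStochastic hQ)
    (sum_row_of_mem_rowStochastic hQ) u).trans_eq (one_mul _)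

-- Subtracting `δ μ` from each row does not change the action on centered functions.
lemma norm_mulVec_le_of_forall_mul_le [Nonempty ι] {δ : ℝ} (hQ : Q ∈ rowStochastic ℝ ι)
    (hδ : ∀ i j, δ * μ j ≤ Q i j) (hμ : ∑ j, μ j = 1) (hu : μ ⬝ᵥ u = 0) :
    ‖Q *ᵥ u‖ ≤ (1 - δ) * ‖u‖ := by
  have hcenter : Q *ᵥ u = (Q - of fun _ j => δ * μ j) *ᵥ u := by
    rw [sub_mulVec, eq_comm, sub_eq_self]
    ext i
    simp_rw [mulVec, dotProduct, of_apply, mul_assoc, ← Finset.mul_sum]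
    rw [show ∑ j, μ j * u j = 0 from hu, mul_zero, Pi.zero_apply]
  rw [hcenter]
  refine norm_mulVec_le_of_sum_eq (fun i j => sub_nonneg.2 (hδ i j)) (fun i => ?_) u
  calc ∑ j, (Q i j - δ * μ j) = ∑ j, Q i j - δ * ∑ j, μ j := by
        rw [Finset.sum_sub_distrib, Finset.mul_sum]
    _ = 1 - δ := by rw [sum_row_of_mem_rowStochastic hQ, hμ, mul_one]

lemma norm_sum_pow_mulVec_le [Nonempty ι] (hQ : Q ∈ rowStochastic ℝ ι) (u : ι → ℝ) (M : ℕ) :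
    ‖∑ l ∈ Finset.range M, Q ^ (l + 1) *ᵥ u‖ ≤ M * ‖u‖ := by
  refine (norm_sum_le_of_le _ fun l _ => norm_mulVec_le_of_mem_rowStochastic
    (pow_mem hQ (l + 1)) u).trans_eq ?_
  rw [Finset.sum_const, Finset.card_range, nsmul_eq_mul]

lemma mulVec_sum_pow_mulVec_add (hQ : Q *ᵥ 1 = 1) (u : ι → ℝ) (m : ℝ) (M : ℕ) :
    Q *ᵥ (∑ l ∈ Finset.range M, Q ^ (l + 1) *ᵥ u + (u + m • 1)) =
      ∑ l ∈ Finset.range M, Q ^ (l + 1) *ᵥ u + Q ^ (M + 1) *ᵥ u + m • 1 := by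
  have hstep (l : ℕ) : Q *ᵥ (Q ^ l *ᵥ u) = Q ^ (l + 1) *ᵥ u := by
    rw [mulVec_mulVec, pow_succ']
  have hsum : ∑ l ∈ Finset.range M, Q ^ (l + 1) *ᵥ u + u =
      ∑ l ∈ Finset.range (M + 1), Q ^ l *ᵥ u := by
    rw [Finset.sum_range_succ', pow_zero, one_mulVec]
  rw [← add_assoc, hsum, mulVec_add, mulVec_smul, hQ, mulVec_sum, ← Finset.sum_range_succ]
  simp_rw [hstep]

end Stochastic

section Generator

open Matrix

variable {N : ℕ} {Γ : Matrix (Fin N) (Fin N) ℝ} {μ : Fin N → ℝ}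

lemma stepMatrix_mem_rowStochastic (hΓ : IsGenerator Γ) {t : ℝ} (ht : 0 ≤ t) :
    stepMatrix Γ t ∈ rowStochastic ℝ (Fin N) := by
  refine ⟨exp_apply_nonneg fun i j hij => mul_nonneg ht (hΓ.1 i j hij),
    exp_mulVec_of_mulVec_eq_zero ?_⟩
  ext i
  simp [mulVec, dotProduct, ← Finset.mul_sum, hΓ.2]

lemma stepMatrix_pos (hΓ : IsGenerator Γ) (hirr : IsIrreducibleGenerator Γ) {t : ℝ} (ht : 0 < t)
    (i j : Fin N) : 0 < stepMatrix Γ t i j :=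
  exp_apply_pos (fun a b hab => mul_nonneg ht.le (hΓ.1 a b hab))
    (Relation.ReflTransGen.mono (fun _ _ hab => mul_pos ht hab) _ _ (hirr i j))

lemma stepMatrix_add (Γ : Matrix (Fin N) (Fin N) ℝ) (s t : ℝ) :
    stepMatrix Γ (s + t) = stepMatrix Γ s * stepMatrix Γ t := by
  rw [stepMatrix, add_smul, Matrix.exp_add_of_commute _ _
    (((Commute.refl Γ).smul_left s).smul_right t)]
  rfl

lemma stepMatrix_pow (Γ : Matrix (Fin N) (Fin N) ℝ) (t : ℝ) (k : ℕ) :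
    stepMatrix Γ t ^ k = stepMatrix Γ (k * t) := by
  rw [stepMatrix, stepMatrix, ← Matrix.exp_nsmul, ← Nat.cast_smul_eq_nsmul ℝ, smul_smul]

lemma vecMul_stepMatrix (hμ : IsStationaryDistribution Γ μ) (t : ℝ) :
    μ ᵥ* stepMatrix Γ t = μ :=
  vecMul_exp_of_vecMul_eq_zero (by rw [vecMul_smul, hμ.1, smul_zero])

lemma IsStationaryDistribution.nonempty (hμ : IsStationaryDistribution Γ μ) :
    Nonempty (Fin N) := by
  by_contra h
  rw [not_nonempty_iff] at h
  simpa using hμ.2.1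

lemma exists_mul_le_stepMatrix_one (hΓ : IsGenerator Γ) (hirr : IsIrreducibleGenerator Γ)
    (hμ : IsStationaryDistribution Γ μ) :
    ∃ δ : ℝ, 0 < δ ∧ δ ≤ 1 ∧ ∀ i j, δ * μ j ≤ stepMatrix Γ 1 i j := by
  have := hμ.nonempty
  obtain ⟨⟨a, b⟩, hab⟩ := Finite.exists_min fun p : Fin N × Fin N => stepMatrix Γ 1 p.1 p.2
  have hpos := stepMatrix_pos hΓ hirr one_pos a b
  refine ⟨stepMatrix Γ 1 a b, hpos,
    le_one_of_mem_rowStochastic (stepMatrix_mem_rowStochastic hΓ zero_le_one), fun i j => ?_⟩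
  have hμ1 : μ j ≤ 1 := by
    rw [← hμ.2.1]
    exact Finset.single_le_sum (fun i _ => (hμ.2.2 i).le) (Finset.mem_univ j)
  exact (mul_le_of_le_one_right hpos.le hμ1).trans (hab (i, j))

lemma tendsto_stepMatrix_mulVec (hΓ : IsGenerator Γ) (hirr : IsIrreducibleGenerator Γ)
    (hμ : IsStationaryDistribution Γ μ) {u : Fin N → ℝ} (hu : μ ⬝ᵥ u = 0) :
    Tendsto (fun t => stepMatrix Γ t *ᵥ u) atTop (𝓝 0) := by
  have := hμ.nonempty
  obtain ⟨δ, hδ0, hδ1, hδ⟩ := exists_mul_le_stepMatrix_one hΓ hirr hμ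
  have hnat (k : ℕ) : ‖stepMatrix Γ k *ᵥ u‖ ≤ (1 - δ) ^ k * ‖u‖ := by
    induction k with
    | zero => simp [stepMatrix]
    | succ k ih =>
      have hcenter : μ ⬝ᵥ (stepMatrix Γ k *ᵥ u) = 0 := by
        rw [dotProduct_mulVec, vecMul_stepMatrix hμ, hu]
      rw [Nat.cast_succ, add_comm, stepMatrix_add, ← mulVec_mulVec, pow_succ', mul_assoc]
      exact (norm_mulVec_le_of_forall_mul_le (stepMatrix_mem_rowStochastic hΓ zero_le_one) hδ
        hμ.2.1 hcenter).trans (mul_le_mul_of_nonneg_left ih (by linarith))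
  have hle (t : ℝ) (ht : 0 ≤ t) : ‖stepMatrix Γ t *ᵥ u‖ ≤ (1 - δ) ^ ⌊t⌋₊ * ‖u‖ := by
    have hsplit : stepMatrix Γ t = stepMatrix Γ (t - ⌊t⌋₊) * stepMatrix Γ ⌊t⌋₊ := by
      rw [← stepMatrix_add, sub_add_cancel]
    rw [hsplit, ← mulVec_mulVec]
    exact (norm_mulVec_le_of_mem_rowStochastic (stepMatrix_mem_rowStochastic hΓ
      (sub_nonneg.2 (Nat.floor_le ht))) _).trans (hnat _)
  have hlim : Tendsto (fun t : ℝ => (1 - δ) ^ ⌊t⌋₊ * ‖u‖) atTop (𝓝 0) := by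
    simpa using ((tendsto_pow_atTop_nhds_zero_of_lt_one (by linarith) (by linarith)).comp
      tendsto_nat_floor_atTop).mul_const ‖u‖
  exact squeeze_zero_norm' ((eventually_ge_atTop 0).mono hle) hlim

lemma exists_nat_mul_mem_Icc (T : ℝ) {Δ : ℝ} (hΔ : 0 < Δ) (hΔ1 : Δ ≤ 1) :
    ∃ M : ℕ, M * Δ ∈ Set.Icc T (|T| + 1) := by
  refine ⟨⌈|T| / Δ⌉₊, ?_, ?_⟩
  · rw [← div_le_iff₀ hΔ]
    exact (div_le_div_of_nonneg_right (le_abs_self T) hΔ.le).trans (Nat.le_ceil _)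
  · calc ⌈|T| / Δ⌉₊ * Δ ≤ (|T| / Δ + 1) * Δ := by
          gcongr
          exact (Nat.ceil_lt_add_one (by positivity)).le
      _ = |T| + Δ := by field_simp
      _ ≤ |T| + 1 := by gcongr

-- A Riemann sum of `∫₀ᵀ exp(tΓ) u dt` with `u = c - μ ⬝ᵥ c` solves the Poisson equation up to the
-- remainder `exp(TΓ) u`, which is small for large `T`.
lemma exists_corrector (hΓ : IsGenerator Γ) (hirr : IsIrreducibleGenerator Γ)
    (hμ : IsStationaryDistribution Γ μ) {c : Fin N → ℝ} {β : ℝ} (hβ : μ ⬝ᵥ c < β) :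
    ∃ W, ∀ Δ, 0 < Δ → Δ ≤ 1 → ∃ w : Fin N → ℝ, ‖w‖ ≤ W ∧
      ∀ i, (stepMatrix Γ Δ *ᵥ (w + Δ • c)) i ≤ w i + Δ * β := by
  have := hμ.nonempty
  set u : Fin N → ℝ := c - fun _ => μ ⬝ᵥ c with hu
  have hμu : μ ⬝ᵥ u = 0 := by
    rw [hu, dotProduct_sub, sub_eq_zero]
    simp [dotProduct, ← Finset.sum_mul, hμ.2.1]
  have hsmall : ∀ᶠ t in atTop, ‖stepMatrix Γ t *ᵥ u‖ ≤ β - μ ⬝ᵥ c := by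
    have hlim := (tendsto_stepMatrix_mulVec hΓ hirr hμ hμu).norm
    rw [norm_zero] at hlim
    exact hlim.eventually_le_const (sub_pos.2 hβ)
  obtain ⟨T, hT⟩ := eventually_atTop.1 hsmall
  refine ⟨(|T| + 1) * ‖u‖, fun Δ hΔ hΔ1 => ?_⟩
  set Q := stepMatrix Γ Δ
  have hQ : Q ∈ rowStochastic ℝ (Fin N) := stepMatrix_mem_rowStochastic hΓ hΔ.le
  obtain ⟨M, hTM, hM⟩ := exists_nat_mul_mem_Icc T hΔ hΔ1
  set w := ∑ l ∈ Finset.range M, Q ^ (l + 1) *ᵥ u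
  refine ⟨Δ • w, ?_, fun i => ?_⟩
  · rw [norm_smul, Real.norm_of_nonneg hΔ.le]
    calc Δ * ‖w‖ ≤ Δ * (M * ‖u‖) := by gcongr; exact norm_sum_pow_mulVec_le hQ u M
      _ = M * Δ * ‖u‖ := by ring
      _ ≤ (|T| + 1) * ‖u‖ := by gcongr
  · have hc : c = u + (μ ⬝ᵥ c) • 1 := by
      ext j
      simp [hu]
    have hQc : Q *ᵥ (Δ • w + Δ • c) = Δ • (w + Q ^ (M + 1) *ᵥ u + (μ ⬝ᵥ c) • 1) := by
      conv_lhs => rw [← smul_add, mulVec_smul, hc]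
      rw [mulVec_sum_pow_mulVec_add hQ.2]
    have hrem : (Q ^ (M + 1) *ᵥ u) i ≤ β - μ ⬝ᵥ c := by
      refine (Real.le_norm_self _).trans ((norm_le_pi_norm _ i).trans ?_)
      rw [stepMatrix_pow]
      refine hT _ (hTM.trans ?_)
      gcongr
      exact Nat.le_succ M
    rw [hQc]
    calc Δ * (w i + (Q ^ (M + 1) *ᵥ u) i + (μ ⬝ᵥ c) * 1)
        ≤ Δ * (w i + (β - μ ⬝ᵥ c) + (μ ⬝ᵥ c) * 1) := by gcongr
      _ = Δ * w i + Δ * β := by ring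

lemma exp_mul_one_add_mul_le {s Δ c w C W : ℝ} (hs : 0 ≤ s) (hΔ : 0 ≤ Δ) (hΔ1 : Δ ≤ 1)
    (hc : |c| ≤ C) (hw : |w| ≤ W) (hsC : s * C ≤ 1) (hsW : s * W ≤ 1) :
    Real.exp (s * Δ * c) * (1 + s * w) ≤
      1 + s * w + s * (Δ * c) + s ^ 2 * Δ * (C * W + 2 * C ^ 2) := by
  set x := s * Δ * c with hx
  have hC : 0 ≤ C := (abs_nonneg c).trans hc
  have hxC : |x| ≤ s * Δ * C := by
    rw [hx, abs_mul, abs_of_nonneg (by positivity : 0 ≤ s * Δ)]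
    gcongr
  have hx1 : |x| ≤ 1 := hxC.trans <|
    calc s * Δ * C ≤ s * 1 * C := by gcongr
      _ ≤ 1 := by rwa [mul_one]
  have hexp : Real.exp x ≤ 1 + x + x ^ 2 := by
    linarith [(abs_le.1 (Real.abs_exp_sub_one_sub_id_le hx1)).2]
  have hsw : |s * w| ≤ 1 := by
    rw [abs_mul, abs_of_nonneg hs]
    exact (mul_le_mul_of_nonneg_left hw hs).trans hsW
  have hx2 : x ^ 2 * (1 + s * w) ≤ s ^ 2 * Δ * C ^ 2 * 2 := by
    have hsq : x ^ 2 ≤ s ^ 2 * Δ * C ^ 2 :=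
      calc x ^ 2 = |x| ^ 2 := (sq_abs x).symm
        _ ≤ (s * Δ * C) ^ 2 := by gcongr
        _ = s ^ 2 * (Δ * Δ) * C ^ 2 := by ring
        _ ≤ s ^ 2 * (Δ * 1) * C ^ 2 := by gcongr
        _ = s ^ 2 * Δ * C ^ 2 := by rw [mul_one]
    exact mul_le_mul hsq (by linarith [(abs_le.1 hsw).2]) (by linarith [(abs_le.1 hsw).1])
      (by positivity)
  have hxw : x * (s * w) ≤ s ^ 2 * Δ * (C * W) :=
    calc x * (s * w) ≤ |x * (s * w)| := le_abs_self _
      _ = |x| * (s * |w|) := by rw [abs_mul, abs_mul s, abs_of_nonneg hs]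
      _ ≤ s * Δ * C * (s * W) := by gcongr
      _ = s ^ 2 * Δ * (C * W) := by ring
  calc Real.exp x * (1 + s * w) ≤ (1 + x + x ^ 2) * (1 + s * w) := by
        gcongr
        linarith [(abs_le.1 hsw).1]
    _ = 1 + s * w + x + x * (s * w) + x ^ 2 * (1 + s * w) := by ring
    _ ≤ 1 + s * w + x + s ^ 2 * Δ * (C * W) + s ^ 2 * Δ * C ^ 2 * 2 := by gcongr
    _ = 1 + s * w + s * (Δ * c) + s ^ 2 * Δ * (C * W + 2 * C ^ 2) := by rw [hx]; ring

lemma sum_mul_exp_mul_one_add_le {Q : Matrix (Fin N) (Fin N) ℝ}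
    (hQ : Q ∈ rowStochastic ℝ (Fin N)) {s Δ κ C W : ℝ} {c w : Fin N → ℝ} (hs : 0 ≤ s)
    (hΔ : 0 ≤ Δ) (hΔ1 : Δ ≤ 1) (hc : ‖c‖ ≤ C) (hw : ‖w‖ ≤ W) (hsC : s * C ≤ 1) (hsW : s * W ≤ 1)
    (hsκ : s * (C * W + 2 * C ^ 2) ≤ κ) (i : Fin N)
    (hQw : (Q *ᵥ (w + Δ • c)) i ≤ w i - Δ * (2 * κ)) :
    ∑ j, Q i j * (Real.exp (s * Δ * c j) * (1 + s * w j)) ≤ 1 + s * w i - s * Δ * κ := by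
  calc ∑ j, Q i j * (Real.exp (s * Δ * c j) * (1 + s * w j))
      ≤ ∑ j, Q i j * (1 + s * w j + s * (Δ * c j) + s ^ 2 * Δ * (C * W + 2 * C ^ 2)) := by
        refine Finset.sum_le_sum fun j _ => mul_le_mul_of_nonneg_left ?_
          (nonneg_of_mem_rowStochastic hQ)
        exact exp_mul_one_add_mul_le hs hΔ hΔ1 ((norm_le_pi_norm c j).trans hc)
          ((norm_le_pi_norm w j).trans hw) hsC hsW
    _ = (∑ j, Q i j) * (1 + s ^ 2 * Δ * (C * W + 2 * C ^ 2)) + s * (Q *ᵥ (w + Δ • c)) i := by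
        simp only [mulVec, dotProduct, Finset.sum_mul, Finset.mul_sum, ← Finset.sum_add_distrib,
          Pi.add_apply, Pi.smul_apply, smul_eq_mul]
        exact Finset.sum_congr rfl fun j _ => by ring
    _ ≤ 1 * (1 + s ^ 2 * Δ * (C * W + 2 * C ^ 2)) + s * (w i - Δ * (2 * κ)) := by
        rw [sum_row_of_mem_rowStochastic hQ]
        gcongr
    _ = 1 + s * w i - s * Δ * (2 * κ) + s * Δ * (s * (C * W + 2 * C ^ 2)) := by ring
    _ ≤ 1 + s * w i - s * Δ * (2 * κ) + s * Δ * κ := by gcongr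
    _ = 1 + s * w i - s * Δ * κ := by ring

/-- `h` is a positive weight which the matrix `Q`, with columns scaled by `b`, contracts by the
factor `ρ`. The lower bound on `h` is a normalisation. -/
structure IsContractingWeight (Q : Matrix (Fin N) (Fin N) ℝ) (b h : Fin N → ℝ) (ρ : ℝ) :
    Prop where
  one_le : ∀ i, 1 ≤ h i
  sum_le : ∀ i, ∑ j, Q i j * (b j * h j) ≤ ρ * h i

theorem exists_isContractingWeight (hΓ : IsGenerator Γ) (hirr : IsIrreducibleGenerator Γ)
    (hμ : IsStationaryDistribution Γ μ) {c : Fin N → ℝ} (hc : ∑ j, μ j * c j < 0) :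
    ∃ s₀ : ℝ, 0 < s₀ ∧ ∀ Δ, 0 < Δ → Δ ≤ 1 → ∀ s, 0 < s → s ≤ s₀ →
      ∃ (h : Fin N → ℝ) (ρ : ℝ), ρ < 1 ∧
        IsContractingWeight (stepMatrix Γ Δ) (fun j => Real.exp (s * Δ * c j)) h ρ := by
  obtain ⟨β, hβ, hβ0⟩ := exists_between (show μ ⬝ᵥ c < 0 from hc)
  obtain ⟨W, hW⟩ := exists_corrector hΓ hirr hμ hβ
  have hsmall (K r : ℝ) (hr : 0 < r) : ∀ᶠ s in 𝓝[>] (0 : ℝ), s * K ≤ r := by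
    have hlim : Tendsto (fun s : ℝ => s * K) (𝓝[>] 0) (𝓝 0) :=
      tendsto_nhdsWithin_of_tendsto_nhds (by simpa using (continuous_mul_const K).tendsto 0)
    exact hlim.eventually_le_const hr
  obtain ⟨s₀, hs₀, hs₀'⟩ := mem_nhdsGT_iff_exists_Ioc_subset.1 <|
    (hsmall ‖c‖ 1 one_pos).and <| (hsmall W (1 / 2) one_half_pos).and <|
      hsmall (‖c‖ * W + 2 * ‖c‖ ^ 2) (-β / 2) (by linarith)
  refine ⟨s₀, hs₀, fun Δ hΔ hΔ1 s hs hss₀ => ?_⟩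
  obtain ⟨hsC, hsW, hsκ⟩ := hs₀' ⟨hs, hss₀⟩
  obtain ⟨w, hw, hQw⟩ := hW Δ hΔ hΔ1
  have hsw (i : Fin N) : |s * w i| ≤ 1 / 2 := by
    rw [abs_mul, abs_of_pos hs]
    exact (mul_le_mul_of_nonneg_left ((norm_le_pi_norm w i).trans hw) hs.le).trans hsW
  have hle2 (i : Fin N) : 1 + s * w i ≤ 2 := by linarith [(abs_le.1 (hsw i)).2]
  have hgap : 0 < s * Δ * (-β / 4) := mul_pos (by positivity) (by linarith)
  refine ⟨fun i => 2 * (1 + s * w i), 1 - s * Δ * (-β / 4), by linarith,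
    fun i => by linarith [(abs_le.1 (hsw i)).1], fun i => ?_⟩
  calc ∑ j, stepMatrix Γ Δ i j * (Real.exp (s * Δ * c j) * (2 * (1 + s * w j)))
      = 2 * ∑ j, stepMatrix Γ Δ i j * (Real.exp (s * Δ * c j) * (1 + s * w j)) := by
        rw [Finset.mul_sum]
        exact Finset.sum_congr rfl fun j _ => by ring
    _ ≤ 2 * (1 + s * w i - s * Δ * (-β / 2)) := by
        gcongr
        exact sum_mul_exp_mul_one_add_le (stepMatrix_mem_rowStochastic hΓ hΔ.le) hs.le hΔ.le hΔ1
          le_rfl hw hsC (hsW.trans (by norm_num)) hsκ i (by linarith [hQw i])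
    _ = 2 * (1 + s * w i - s * Δ * (-β / 4) * 2) := by ring
    _ ≤ 2 * (1 + s * w i - s * Δ * (-β / 4) * (1 + s * w i)) := by gcongr; exact hle2 i
    _ = (1 - s * Δ * (-β / 4)) * (2 * (1 + s * w i)) := by ring

end Generator

/-! ### Strongly monotone equations -/

section Monotone

open Metric

lemma exists_fixedPoint_of_lipschitzOnWith_closedBall {E : Type*} [NormedAddCommGroup E]
    [CompleteSpace E] {G : E → E} {k : ℝ≥0} {R : ℝ} (hk : k < 1)
    (hG : LipschitzOnWith k G (closedBall 0 R)) (h0 : ‖G 0‖ ≤ (1 - k) * R) : ∃ u, G u = u := by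
  have hk' : (k : ℝ) < 1 := mod_cast hk
  have hR : 0 ≤ R := nonneg_of_mul_nonneg_right ((norm_nonneg _).trans h0) (sub_pos.2 hk')
  have hzero : (0 : E) ∈ closedBall (0 : E) R := mem_closedBall_self hR
  have hmaps : Set.MapsTo G (closedBall 0 R) (closedBall 0 R) := fun u hu => by
    have hdist := hG.dist_le_mul u hu 0 hzero
    rw [mem_closedBall_zero_iff] at hu ⊢
    rw [dist_zero_right, dist_eq_norm] at hdist
    calc ‖G u‖ ≤ ‖G u - G 0‖ + ‖G 0‖ := norm_le_norm_sub_add _ _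
      _ ≤ k * R + (1 - k) * R := by gcongr; exact hdist.trans (by gcongr)
      _ = R := by ring
  obtain ⟨u, -, hu, -⟩ := ContractingWith.exists_fixedPoint' isClosed_closedBall.isComplete hmaps
    ⟨hk, hG.mapsToRestrict hmaps⟩ hzero (edist_ne_top _ _)
  exact ⟨u, hu⟩

variable {H : Type*} [NormedAddCommGroup H] [InnerProductSpace ℝ H]

lemma norm_sub_smul_le {w z : H} {c K t : ℝ} (hwz : c * ‖w‖ ^ 2 ≤ inner ℝ w z)
    (hz : ‖z‖ ≤ K * ‖w‖) (ht : 0 ≤ t) (htK : t * K ^ 2 ≤ c) (htc : t * c ≤ 2) :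
    ‖w - t • z‖ ≤ (1 - t * c / 2) * ‖w‖ := by
  have hz2 : ‖z‖ ^ 2 ≤ K ^ 2 * ‖w‖ ^ 2 := by
    rw [← mul_pow]; gcongr
  have hcross : t * (c * ‖w‖ ^ 2) ≤ t * inner ℝ w z := by gcongr
  have hsq : (t * ‖z‖) ^ 2 ≤ t * c * ‖w‖ ^ 2 :=
    calc (t * ‖z‖) ^ 2 = t ^ 2 * ‖z‖ ^ 2 := mul_pow _ _ _
      _ ≤ t ^ 2 * (K ^ 2 * ‖w‖ ^ 2) := by gcongr
      _ = t * (t * K ^ 2) * ‖w‖ ^ 2 := by ring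
      _ ≤ t * c * ‖w‖ ^ 2 := by gcongr
  refine le_of_sq_le_sq ?_ (mul_nonneg (by linarith) (norm_nonneg _))
  rw [norm_sub_sq_real, inner_smul_right, norm_smul, Real.norm_of_nonneg ht]
  nlinarith [sq_nonneg (t * c / 2 * ‖w‖)]

lemma surjective_of_strongly_monotone [CompleteSpace H] {T : H → H} {c : ℝ} (hc : 0 < c)
    (hmono : ∀ u v, c * ‖u - v‖ ^ 2 ≤ inner ℝ (u - v) (T u - T v))
    (hlip : ∀ R, ∃ K : ℝ≥0, LipschitzOnWith K T (closedBall 0 R)) :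
    Function.Surjective T := by
  intro y
  set R := 2 * ‖y - T 0‖ / c with hR
  obtain ⟨K, hK⟩ := hlip R
  obtain ⟨t, ht, htK, htc⟩ : ∃ t : ℝ, 0 < t ∧ t * (K + 1 : ℝ) ^ 2 ≤ c ∧ t * c ≤ 2 :=
    ⟨min (c / (K + 1) ^ 2) (2 / c), by positivity,
      (le_div_iff₀ (by positivity)).1 (min_le_left _ _), (le_div_iff₀ hc).1 (min_le_right _ _)⟩
  obtain ⟨k, hk⟩ : ∃ k : ℝ≥0, (k : ℝ) = 1 - t * c / 2 := ⟨.mk _ (by linarith), rfl⟩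
  have hlipG : LipschitzOnWith k (fun u => u - t • (T u - y)) (closedBall 0 R) := by
    refine LipschitzOnWith.of_dist_le_mul fun u hu v hv => ?_
    have hT := hK.dist_le_mul u hu v hv
    rw [dist_eq_norm, dist_eq_norm] at hT ⊢
    rw [show u - t • (T u - y) - (v - t • (T v - y)) = u - v - t • (T u - T v) by module]
    rw [hk]
    exact norm_sub_smul_le (hmono u v) (hT.trans (by gcongr; linarith)) ht.le htK htc
  obtain ⟨u, hu⟩ := exists_fixedPoint_of_lipschitzOnWith_closedBall
    (NNReal.coe_lt_coe.1 (by rw [hk, NNReal.coe_one]; linarith [mul_pos ht hc])) hlipG <| by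
      rw [zero_sub, norm_neg, norm_smul, Real.norm_of_nonneg ht.le, norm_sub_rev, hk, hR]
      exact le_of_eq (by field_simp; ring)
  exact ⟨u, sub_eq_zero.1 ((smul_eq_zero.1 (sub_eq_self.1 hu)).resolve_left ht.ne')⟩

lemma surjective_sub_smul_of_inner_le [CompleteSpace H] {f : H → H} {ν t : ℝ}
    (hlip : ∀ R, ∃ K : ℝ≥0, LipschitzOnWith K f (closedBall 0 R))
    (hf : ∀ x y, 2 * inner ℝ (x - y) (f x - f y) ≤ ν * ‖x - y‖ ^ 2) (ht : 0 ≤ t)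
    (hνt : ν * t < 2) : Function.Surjective fun u => u - t • f u := by
  refine surjective_of_strongly_monotone (c := 1 - ν * t / 2) (by linarith) (fun u v => ?_)
    fun R => ?_
  · rw [show u - t • f u - (v - t • f v) = u - v - t • (f u - f v) by module, inner_sub_right,
      inner_smul_right, real_inner_self_eq_norm_sq]
    nlinarith [mul_le_mul_of_nonneg_left (hf u v) ht]
  · obtain ⟨K, hK⟩ := hlip R
    exact ⟨_, (LipschitzWith.id.lipschitzOnWith (s := closedBall 0 R)).sub
      ((lipschitzWith_smul t).comp_lipschitzOnWith hK)⟩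

lemma mul_add_le_norm_sub_smul_sq {w z : H} {ν l a t : ℝ}
    (hwz : 2 * inner ℝ w z + l * a ≤ ν * ‖w‖ ^ 2) (ha : 0 ≤ a) (ht : 0 ≤ t)
    (hνt : 1 - ν * t ≤ l) : (1 - ν * t) * (‖w‖ ^ 2 + t * a) ≤ ‖w - t • z‖ ^ 2 := by
  rw [norm_sub_sq_real, inner_smul_right]
  nlinarith [sq_nonneg ‖t • z‖, mul_le_mul_of_nonneg_left hwz ht,
    mul_le_mul_of_nonneg_right hνt (mul_nonneg ht ha)]

end Monotone

/-! ### Gaussian moments -/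

section Moments

variable {Ω E : Type*} [MeasurableSpace Ω] {m : Measure Ω} [IsProbabilityMeasure m]
  [NormedAddCommGroup E]

lemma integral_norm_const_add_sq [InnerProductSpace ℝ E] [CompleteSpace E] {Y : Ω → E}
    (hY : MemLp Y 2 m) (hY0 : ∫ ω, Y ω ∂m = 0) (x : E) :
    ∫ ω, ‖x + Y ω‖ ^ 2 ∂m = ‖x‖ ^ 2 + ∫ ω, ‖Y ω‖ ^ 2 ∂m := by
  have hint : Integrable Y m := hY.integrable one_le_two
  have hinner : Integrable (fun ω => 2 * inner ℝ x (Y ω)) m := (hint.const_inner x).const_mul 2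
  have hsum : Integrable (fun ω => ‖x‖ ^ 2 + 2 * inner ℝ x (Y ω)) m :=
    (integrable_const _).add hinner
  simp_rw [norm_add_sq_real]
  rw [integral_add hsum (hY.integrable_norm_pow two_ne_zero),
    integral_add (integrable_const _) hinner, integral_const_mul, integral_inner hint, hY0]
  simp

lemma lintegral_norm_rpow_le {Y : Ω → E} (hY : MemLp Y 2 m) {p : ℝ} (hp : 0 < p) (hp2 : p ≤ 2) :
    ∫⁻ ω, ENNReal.ofReal (‖Y ω‖ ^ p) ∂m ≤ ENNReal.ofReal ((∫ ω, ‖Y ω‖ ^ 2 ∂m) ^ (p / 2)) := by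
  have henorm : ∀ r : ℝ, 0 ≤ r → ∀ ω, ‖Y ω‖ₑ ^ r = ENNReal.ofReal (‖Y ω‖ ^ r) := fun r hr ω => by
    rw [← ofReal_norm, ENNReal.ofReal_rpow_of_nonneg (norm_nonneg _) hr]
  have h := ENNReal.rpow_le_rpow (eLpNorm'_le_eLpNorm'_of_exponent_le hp hp2 m hY.1) hp.le
  simp_rw [eLpNorm', ← ENNReal.rpow_mul, henorm p hp.le, henorm 2 two_pos.le, Real.rpow_two] at h
  rwa [one_div_mul_cancel hp.ne', ENNReal.rpow_one, one_div_mul_eq_div,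
    ← ofReal_integral_eq_lintegral_ofReal (hY.integrable_norm_pow two_ne_zero)
      (.of_forall fun ω => sq_nonneg _),
    ENNReal.ofReal_rpow_of_nonneg (integral_nonneg fun ω => sq_nonneg _) (by positivity)] at h

end Moments

section Gaussian

variable {n d : ℕ} (A : Matrix (Fin n) (Fin d) ℝ)

lemma hsNorm_sq : hsNorm A ^ 2 = ∑ i, ∑ j, A i j ^ 2 :=
  Real.sq_sqrt (Finset.sum_nonneg fun _ _ => Finset.sum_nonneg fun _ _ => sq_nonneg _)

lemma memLp_toEuclideanLin_stdGaussian :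
    MemLp (fun ξ => Matrix.toEuclideanLin A ξ) 2 (stdGaussian (Vec d)) :=
  (Matrix.toEuclideanLin A).toContinuousLinearMap.comp_memLp' IsGaussian.memLp_two_id

lemma integral_toEuclideanLin_stdGaussian :
    ∫ ξ, Matrix.toEuclideanLin A ξ ∂stdGaussian (Vec d) = 0 := by
  have h := (Matrix.toEuclideanLin A).toContinuousLinearMap.integral_comp_comm
    ((IsGaussian.memLp_two_id (μ := stdGaussian (Vec d))).integrable one_le_two)
  simp only [id_eq, integral_id_stdGaussian, map_zero] at h
  exact h

lemma integral_inner_sq_stdGaussian (v : Vec d) :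
    ∫ ξ, inner ℝ v ξ ^ 2 ∂stdGaussian (Vec d) = ‖v‖ ^ 2 := by
  have hL : MemLp (innerSL ℝ v) 2 (stdGaussian (Vec d)) := IsGaussian.memLp_two_id.const_inner v
  have hvar := variance_dual_stdGaussian (innerSL ℝ v)
  rw [variance_eq_sub hL, innerSL_apply_norm,
    integral_strongDual_stdGaussian] at hvar
  simpa using hvar

lemma integral_norm_toEuclideanLin_sq_stdGaussian :
    ∫ ξ, ‖Matrix.toEuclideanLin A ξ‖ ^ 2 ∂stdGaussian (Vec d) = hsNorm A ^ 2 := by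
  let v : Fin n → Vec d := fun i => WithLp.toLp 2 (A i)
  have hcoord : ∀ ξ, ‖Matrix.toEuclideanLin A ξ‖ ^ 2 = ∑ i, inner ℝ (v i) ξ ^ 2 := fun ξ => by
    simp [EuclideanSpace.real_norm_sq_eq, Matrix.toEuclideanLin, Matrix.mulVec, dotProduct,
      PiLp.inner_apply, mul_comm, v]
  have hint : ∀ i, Integrable (fun ξ => inner ℝ (v i) ξ ^ 2) (stdGaussian (Vec d)) := fun i =>
    (IsGaussian.memLp_two_id.const_inner (v i)).integrable_sq
  simp_rw [hcoord]
  rw [integral_finsetSum _ fun i _ => hint i, hsNorm_sq]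
  simp_rw [integral_inner_sq_stdGaussian, EuclideanSpace.real_norm_sq_eq, v]

lemma lintegral_norm_add_rpow_stdGaussian_le (x : Vec n) {Δ p : ℝ} (hΔ : 0 ≤ Δ) (hp : 0 < p)
    (hp2 : p ≤ 2) :
    ∫⁻ ξ, ENNReal.ofReal (‖x + Matrix.toEuclideanLin A (Real.sqrt Δ • ξ)‖ ^ p) ∂stdGaussian (Vec d)
      ≤ ENNReal.ofReal ((‖x‖ ^ 2 + Δ * hsNorm A ^ 2) ^ (p / 2)) := by
  have hY : MemLp (fun ξ => Real.sqrt Δ • Matrix.toEuclideanLin A ξ) 2 (stdGaussian (Vec d)) :=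
    (memLp_toEuclideanLin_stdGaussian A).const_smul (Real.sqrt Δ)
  have hY0 : ∫ ξ, Real.sqrt Δ • Matrix.toEuclideanLin A ξ ∂stdGaussian (Vec d) = 0 := by
    rw [integral_smul, integral_toEuclideanLin_stdGaussian, smul_zero]
  have hY2 : ∫ ξ, ‖Real.sqrt Δ • Matrix.toEuclideanLin A ξ‖ ^ 2 ∂stdGaussian (Vec d) =
      Δ * hsNorm A ^ 2 := by
    simp_rw [norm_smul, mul_pow, Real.norm_eq_abs, sq_abs, Real.sq_sqrt hΔ]
    rw [integral_const_mul, integral_norm_toEuclideanLin_sq_stdGaussian]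
  rw [← hY2, ← integral_norm_const_add_sq hY hY0 x]
  simp_rw [map_smul]
  exact lintegral_norm_rpow_le ((memLp_const x).add hY) hp hp2

end Gaussian

/-! ### The implicit step -/

section ImplicitStep

variable {n d N : ℕ} {f : Vec n → Fin N → Vec n} {g : Vec n → Fin N → Matrix (Fin n) (Fin d) ℝ}
  {ν : Fin N → ℝ} {Δ : ℝ}

/-- Monotone coefficients: a locally Lipschitz drift and a one-sided Lipschitz bound with constant
`ν i` in the state `i`. The diffusion enters with the factor `2` rather than the usual `1`, because
the scheme treats the drift implicitly but the diffusion explicitly. -/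
structure MonotoneCoefficients (f : Vec n → Fin N → Vec n)
    (g : Vec n → Fin N → Matrix (Fin n) (Fin d) ℝ) (ν : Fin N → ℝ) : Prop where
  locallyLipschitz : ∀ i, LocallyLipschitz fun x => f x i
  continuous : ∀ i, Continuous fun x => g x i
  inner_le : ∀ x y i,
    2 * inner ℝ (x - y) (f x i - f y i) + 2 * hsNorm (g x i - g y i) ^ 2 ≤ ν i * ‖x - y‖ ^ 2

/-- Step sizes for which the implicit step is well posed under the one-sided Lipschitz
constants `ν`. -/
structure IsStepSize (ν : Fin N → ℝ) (Δ : ℝ) : Prop where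
  pos : 0 < Δ
  abs_mul_lt_one : ∀ i, |ν i * Δ| < 1

/-- The squared distance contracted by the implicit step in the state `i`. The diffusion term is
included because the scheme treats the diffusion explicitly. -/
def sqDist (g : Vec n → Fin N → Matrix (Fin n) (Fin d) ℝ) (Δ : ℝ) (x y : Vec n) (i : Fin N) : ℝ :=
  ‖x - y‖ ^ 2 + Δ * hsNorm (g x i - g y i) ^ 2

lemma IsStepSize.one_sub_pos (hΔ : IsStepSize ν Δ) (i : Fin N) : 0 < 1 - ν i * Δ :=
  sub_pos.2 (lt_of_abs_lt (hΔ.abs_mul_lt_one i))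

lemma norm_sq_le_sqDist (g : Vec n → Fin N → Matrix (Fin n) (Fin d) ℝ) (hΔ : 0 ≤ Δ) (x y : Vec n)
    (i : Fin N) : ‖x - y‖ ^ 2 ≤ sqDist g Δ x y i :=
  le_add_of_nonneg_right (by positivity)

lemma sqDist_nonneg (g : Vec n → Fin N → Matrix (Fin n) (Fin d) ℝ) (hΔ : 0 ≤ Δ) (x y : Vec n)
    (i : Fin N) : 0 ≤ sqDist g Δ x y i :=
  (sq_nonneg _).trans (norm_sq_le_sqDist g hΔ x y i)

lemma norm_sub_sq_le_two_mul {E : Type*} [SeminormedAddCommGroup E] (x y z : E) :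
    ‖x - y‖ ^ 2 ≤ 2 * (‖x - z‖ ^ 2 + ‖y - z‖ ^ 2) := by
  rw [← sub_sub_sub_cancel_right x y z]
  exact (pow_le_pow_left₀ (norm_nonneg _) (norm_sub_le _ _) 2).trans add_sq_le

lemma hsNorm_sub_sq_le_two_mul (A B C : Matrix (Fin n) (Fin d) ℝ) :
    hsNorm (A - B) ^ 2 ≤ 2 * (hsNorm (A - C) ^ 2 + hsNorm (B - C) ^ 2) := by
  simp only [hsNorm_sq, ← Finset.sum_add_distrib, Finset.mul_sum]
  gcongr with k _ l _
  simpa only [Matrix.sub_apply, Real.norm_eq_abs, sq_abs]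
    using norm_sub_sq_le_two_mul (A k l) (B k l) (C k l)

lemma sqDist_le_two_mul (g : Vec n → Fin N → Matrix (Fin n) (Fin d) ℝ) (hΔ : 0 ≤ Δ)
    (x y z : Vec n) (i : Fin N) :
    sqDist g Δ x y i ≤ 2 * (sqDist g Δ x z i + sqDist g Δ y z i) :=
  calc sqDist g Δ x y i ≤ 2 * (‖x - z‖ ^ 2 + ‖y - z‖ ^ 2) +
        Δ * (2 * (hsNorm (g x i - g z i) ^ 2 + hsNorm (g y i - g z i) ^ 2)) := by
        unfold sqDist
        gcongr
        exacts [norm_sub_sq_le_two_mul x y z, hsNorm_sub_sq_le_two_mul _ _ _]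
    _ = 2 * (sqDist g Δ x z i + sqDist g Δ y z i) := by unfold sqDist; ring

lemma continuous_hsNorm : Continuous (hsNorm : Matrix (Fin n) (Fin d) ℝ → ℝ) := by
  unfold hsNorm
  fun_prop

lemma continuous_sqDist (hg : ∀ i, Continuous fun x => g x i) (i : Fin N) :
    Continuous fun p : Vec n × Vec n => sqDist g Δ p.1 p.2 i := by
  unfold sqDist
  have := continuous_hsNorm.comp (((hg i).comp continuous_fst).sub ((hg i).comp continuous_snd))
  exact ((continuous_fst.sub continuous_snd).norm.pow 2).add ((this.pow 2).const_mul Δ)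

namespace MonotoneCoefficients

lemma mul_sqDist_le (hfg : MonotoneCoefficients f g ν) (hΔ : IsStepSize ν Δ) (i : Fin N)
    (u v : Vec n) :
    (1 - ν i * Δ) * sqDist g Δ u v i ≤ ‖(u - Δ • f u i) - (v - Δ • f v i)‖ ^ 2 := by
  rw [show u - Δ • f u i - (v - Δ • f v i) = u - v - Δ • (f u i - f v i) by module]
  exact mul_add_le_norm_sub_smul_sq (hfg.inner_le u v i) (sq_nonneg _) hΔ.pos.le
    (by linarith [neg_lt_of_abs_lt (hΔ.abs_mul_lt_one i)])

lemma injective_sub_smul (hfg : MonotoneCoefficients f g ν) (hΔ : IsStepSize ν Δ) (i : Fin N) :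
    Function.Injective fun u => u - Δ • f u i := by
  intro u v huv
  have hmul : (1 - ν i * Δ) * sqDist g Δ u v i ≤ 0 :=
    (hfg.mul_sqDist_le hΔ i u v).trans_eq (by simp [sub_eq_zero.2 huv])
  have hsq : ‖u - v‖ ^ 2 ≤ 0 := (norm_sq_le_sqDist g hΔ.pos.le u v i).trans
    (nonpos_of_mul_nonpos_right hmul (hΔ.one_sub_pos i))
  simpa [sub_eq_zero] using hsq.antisymm (sq_nonneg _)

lemma surjective_sub_smul (hfg : MonotoneCoefficients f g ν) (hΔ : IsStepSize ν Δ) (i : Fin N) :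
    Function.Surjective fun u => u - Δ • f u i := by
  refine surjective_sub_smul_of_inner_le (ν := ν i) (f := fun u => f u i) (fun R => ?_)
    (fun x y => ?_) hΔ.pos.le (by linarith [hΔ.one_sub_pos i])
  · exact (hfg.locallyLipschitz i).locallyLipschitzOn.exists_lipschitzOnWith_of_compact
      (isCompact_closedBall 0 R)
  · linarith [hfg.inner_le x y i, sq_nonneg (hsNorm (g x i - g y i))]

lemma implicitSolve_spec (hfg : MonotoneCoefficients f g ν) (hΔ : IsStepSize ν Δ) (i : Fin N)
    (y : Vec n) : implicitSolve f Δ i y - Δ • f (implicitSolve f Δ i y) i = y :=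
  Function.rightInverse_invFun (hfg.surjective_sub_smul hΔ i) y

lemma implicitSolve_eq (hfg : MonotoneCoefficients f g ν) (hΔ : IsStepSize ν Δ) (i : Fin N)
    (u : Vec n) : implicitSolve f Δ i (u - Δ • f u i) = u :=
  Function.leftInverse_invFun (hfg.injective_sub_smul hΔ i) u

lemma sqDist_implicitSolve_le (hfg : MonotoneCoefficients f g ν) (hΔ : IsStepSize ν Δ)
    (i : Fin N) (y y' : Vec n) :
    sqDist g Δ (implicitSolve f Δ i y) (implicitSolve f Δ i y') i ≤
      (1 - ν i * Δ)⁻¹ * ‖y - y'‖ ^ 2 := by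
  rw [inv_mul_eq_div, le_div_iff₀' (hΔ.one_sub_pos i)]
  simpa only [hfg.implicitSolve_spec hΔ] using
    hfg.mul_sqDist_le hΔ i (implicitSolve f Δ i y) (implicitSolve f Δ i y')

lemma continuous_implicitSolve (hfg : MonotoneCoefficients f g ν) (hΔ : IsStepSize ν Δ)
    (i : Fin N) : Continuous (implicitSolve f Δ i) := by
  refine (LipschitzWith.of_dist_le_mul (K := NNReal.sqrt (1 - ν i * Δ)⁻¹.toNNReal)
    fun y y' => ?_).continuous
  have hinv : 0 ≤ (1 - ν i * Δ)⁻¹ := (inv_pos.2 (hΔ.one_sub_pos i)).le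
  rw [dist_eq_norm, dist_eq_norm]
  refine le_of_sq_le_sq ?_ (by positivity)
  rw [mul_pow, Real.coe_sqrt, Real.coe_toNNReal _ hinv, Real.sq_sqrt hinv]
  exact (norm_sq_le_sqDist g hΔ.pos.le _ _ i).trans (hfg.sqDist_implicitSolve_le hΔ i y y')

end MonotoneCoefficients

end ImplicitStep

/-! ### The weighted distance -/

section WeightedDist

variable {n d N : ℕ} {f : Vec n → Fin N → Vec n} {g : Vec n → Fin N → Matrix (Fin n) (Fin d) ℝ}
  {ν h : Fin N → ℝ} {Δ p : ℝ}

/-- The `p`-th power of the distance contracted by the implicit step in the state `i`, weighted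
by `h i`. -/
def weightedDist (g : Vec n → Fin N → Matrix (Fin n) (Fin d) ℝ) (Δ p : ℝ) (h : Fin N → ℝ)
    (i : Fin N) (x y : Vec n) : ℝ≥0∞ :=
  ENNReal.ofReal (h i * sqDist g Δ x y i ^ (p / 2))

/-- The factor by which the implicit step in the state `i` changes `p`-th powers of distances. -/
def stepFactor (ν : Fin N → ℝ) (Δ p : ℝ) (i : Fin N) : ℝ := (1 - ν i * Δ)⁻¹ ^ (p / 2)

lemma measurable_weightedDist (hg : ∀ i, Continuous fun x => g x i) (i : Fin N) :
    Measurable fun xy : Vec n × Vec n => weightedDist g Δ p h i xy.1 xy.2 :=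
  (((continuous_sqDist hg i).measurable.pow_const (p / 2)).const_mul (h i)).ennreal_ofReal

lemma norm_rpow_eq_sq_rpow_half {E : Type*} [SeminormedAddCommGroup E] (x : E) (p : ℝ) :
    ‖x‖ ^ p = (‖x‖ ^ 2) ^ (p / 2) := by
  rw [← Real.rpow_natCast, ← Real.rpow_mul (norm_nonneg _), Nat.cast_ofNat, mul_div_cancel₀ p
    two_ne_zero]

lemma ofReal_norm_sub_rpow_le_weightedDist (hΔ : 0 ≤ Δ) (hp : 0 ≤ p) {i : Fin N} (hi : 1 ≤ h i)
    (x y : Vec n) : ENNReal.ofReal (‖x - y‖ ^ p) ≤ weightedDist g Δ p h i x y := by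
  refine ENNReal.ofReal_le_ofReal ?_
  rw [norm_rpow_eq_sq_rpow_half]
  calc (‖x - y‖ ^ 2) ^ (p / 2) ≤ sqDist g Δ x y i ^ (p / 2) := by
        gcongr
        exact norm_sq_le_sqDist g hΔ x y i
    _ ≤ h i * sqDist g Δ x y i ^ (p / 2) :=
        le_mul_of_one_le_left (Real.rpow_nonneg (sqDist_nonneg g hΔ x y i) _) hi

lemma weightedDist_le_two_mul (hΔ : 0 ≤ Δ) (hp : 0 ≤ p) (hp2 : p ≤ 2) {i : Fin N} (hi : 0 ≤ h i)
    (x y z : Vec n) : weightedDist g Δ p h i x y ≤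
      2 * weightedDist g Δ p h i x z + 2 * weightedDist g Δ p h i y z := by
  have hx := sqDist_nonneg g hΔ x z i
  have hy := sqDist_nonneg g hΔ y z i
  have hreal : sqDist g Δ x y i ^ (p / 2) ≤
      2 * (sqDist g Δ x z i ^ (p / 2) + sqDist g Δ y z i ^ (p / 2)) :=
    calc sqDist g Δ x y i ^ (p / 2) ≤ (2 * (sqDist g Δ x z i + sqDist g Δ y z i)) ^ (p / 2) := by
          have := sqDist_nonneg g hΔ x y i
          gcongr
          exact sqDist_le_two_mul g hΔ x y z i
      _ = 2 ^ (p / 2) * (sqDist g Δ x z i + sqDist g Δ y z i) ^ (p / 2) :=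
          Real.mul_rpow two_pos.le (add_nonneg hx hy)
      _ ≤ 2 * (sqDist g Δ x z i ^ (p / 2) + sqDist g Δ y z i ^ (p / 2)) := by
          gcongr
          · exact Real.rpow_le_self_of_one_le one_le_two (by linarith)
          · exact Real.rpow_add_le_add_rpow hx hy (by linarith) (by linarith)
  have hofReal (r : ℝ) : 2 * ENNReal.ofReal r = ENNReal.ofReal (2 * r) := by
    rw [ENNReal.ofReal_mul two_pos.le, ENNReal.ofReal_ofNat]
  unfold weightedDist
  rw [hofReal, hofReal, ← ENNReal.ofReal_add (by positivity) (by positivity)]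
  refine ENNReal.ofReal_le_ofReal ?_
  calc h i * sqDist g Δ x y i ^ (p / 2)
      ≤ h i * (2 * (sqDist g Δ x z i ^ (p / 2) + sqDist g Δ y z i ^ (p / 2))) := by gcongr
    _ = _ := by ring

lemma MonotoneCoefficients.weightedDist_implicitSolve_le (hfg : MonotoneCoefficients f g ν)
    (hΔ : IsStepSize ν Δ) (hp : 0 ≤ p) {i : Fin N} (hi : 0 ≤ h i) (y y' : Vec n) :
    weightedDist g Δ p h i (implicitSolve f Δ i y) (implicitSolve f Δ i y') ≤
      ENNReal.ofReal (stepFactor ν Δ p i * h i) * ENNReal.ofReal (‖y - y'‖ ^ p) := by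
  have hinv : 0 ≤ (1 - ν i * Δ)⁻¹ := (inv_pos.2 (hΔ.one_sub_pos i)).le
  rw [← ENNReal.ofReal_mul' (by positivity)]
  refine ENNReal.ofReal_le_ofReal ?_
  calc h i * sqDist g Δ (implicitSolve f Δ i y) (implicitSolve f Δ i y') i ^ (p / 2)
      ≤ h i * ((1 - ν i * Δ)⁻¹ * ‖y - y'‖ ^ 2) ^ (p / 2) := by
        have := sqDist_nonneg g hΔ.pos.le (implicitSolve f Δ i y) (implicitSolve f Δ i y') i
        gcongr
        exact hfg.sqDist_implicitSolve_le hΔ i y y'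
    _ = stepFactor ν Δ p i * h i * ‖y - y'‖ ^ p := by
        rw [Real.mul_rpow hinv (sq_nonneg _), norm_rpow_eq_sq_rpow_half, stepFactor]
        ring

end WeightedDist

/-! ### The scheme as a random map -/

section Scheme

open Matrix (rowStochastic)

variable {n d N : ℕ} {f : Vec n → Fin N → Vec n} {g : Vec n → Fin N → Matrix (Fin n) (Fin d) ℝ}
  {Q : Matrix (Fin N) (Fin N) ℝ} {ν h : Fin N → ℝ} {Δ p ρ : ℝ}

/-- The law of the successor of the state `i` under the transition matrix `Q`. -/
def switchLaw (Q : Matrix (Fin N) (Fin N) ℝ) (i : Fin N) : Measure (Fin N) :=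
  ∑ j, ENNReal.ofReal (Q i j) • Measure.dirac j

/-- The law of the noise of one step: a successor for every switching state, all of them
independent, and an independent standard Gaussian vector. Two copies of the scheme driven by the
same noise switch independently until they meet, and together afterwards. -/
def noiseLaw (d : ℕ) (Q : Matrix (Fin N) (Fin N) ℝ) : Measure ((Fin N → Fin N) × Vec d) :=
  (Measure.pi (switchLaw Q)).prod (stdGaussian (Vec d))

/-- The point at which the implicit equation is solved from `z` with Gaussian noise `ξ`. -/
def explicitStep (g : Vec n → Fin N → Matrix (Fin n) (Fin d) ℝ) (Δ : ℝ) (z : Vec n × Fin N)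
    (ξ : Vec d) : Vec n :=
  z.1 + Matrix.toEuclideanLin (g z.1 z.2) (Real.sqrt Δ • ξ)

/-- The random map driving the scheme. -/
def bemMap (f : Vec n → Fin N → Vec n) (g : Vec n → Fin N → Matrix (Fin n) (Fin d) ℝ) (Δ : ℝ)
    (e : (Fin N → Fin N) × Vec d) (z : Vec n × Fin N) : Vec n × Fin N :=
  (implicitSolve f Δ (e.1 z.2) (explicitStep g Δ z e.2), e.1 z.2)

instance (Q : Matrix (Fin N) (Fin N) ℝ) (i : Fin N) : IsFiniteMeasure (switchLaw Q i) where
  measure_univ_lt_top := by simp [switchLaw]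

instance (d : ℕ) (Q : Matrix (Fin N) (Fin N) ℝ) : IsFiniteMeasure (noiseLaw d Q) := by
  unfold noiseLaw
  infer_instance

lemma isProbabilityMeasure_switchLaw (hQ : Q ∈ rowStochastic ℝ (Fin N)) (i : Fin N) :
    IsProbabilityMeasure (switchLaw Q i) where
  measure_univ := by
    simp only [switchLaw, Measure.coe_finsetSum, Measure.coe_smul, Finset.sum_apply, Pi.smul_apply,
      measure_univ, smul_eq_mul, mul_one]
    rw [← ENNReal.ofReal_sum_of_nonneg fun j _ => Matrix.nonneg_of_mem_rowStochastic hQ,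
      Matrix.sum_row_of_mem_rowStochastic hQ, ENNReal.ofReal_one]

lemma isProbabilityMeasure_noiseLaw (d : ℕ) (hQ : Q ∈ rowStochastic ℝ (Fin N)) :
    IsProbabilityMeasure (noiseLaw d Q) := by
  have := isProbabilityMeasure_switchLaw hQ
  unfold noiseLaw
  infer_instance

lemma lintegral_noiseLaw (hQ : Q ∈ rowStochastic ℝ (Fin N)) (i : Fin N)
    {H : Fin N → Vec d → ℝ≥0∞} (hH : ∀ j, Measurable (H j)) :
    ∫⁻ e, H (e.1 i) e.2 ∂noiseLaw d Q =
      ∑ j, ENNReal.ofReal (Q i j) * ∫⁻ ξ, H j ξ ∂stdGaussian (Vec d) := by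
  have := isProbabilityMeasure_switchLaw hQ
  have hm : Measurable fun e : (Fin N → Fin N) × Vec d => H (e.1 i) e.2 :=
    measurable_from_prod_countable_right fun τ => hH (τ i)
  have hmarginal := (measurePreserving_eval (switchLaw Q) i).lintegral_comp
    (f := fun j => ∫⁻ ξ, H j ξ ∂stdGaussian (Vec d)) .of_discrete
  simp only [Function.eval] at hmarginal
  rw [noiseLaw, lintegral_prod _ hm.aemeasurable, hmarginal, switchLaw,
    lintegral_finsetSum_measure]
  simp only [lintegral_smul_measure, lintegral_dirac, smul_eq_mul]

lemma continuous_explicitStep (hg : ∀ i, Continuous fun x => g x i) (i : Fin N) :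
    Continuous fun p : Vec n × Vec d => explicitStep g Δ (p.1, i) p.2 := by
  have hmul : Continuous fun p : Vec n × Vec d =>
      (g p.1 i).mulVec (WithLp.ofLp (Real.sqrt Δ • p.2)) :=
    ((hg i).comp continuous_fst).matrix_mulVec
      ((PiLp.continuous_ofLp 2 _).comp (by fun_prop))
  exact continuous_fst.add ((PiLp.continuous_toLp 2 _).comp hmul)

lemma measurable_explicitStep (hg : ∀ i, Continuous fun x => g x i) :
    Measurable (Function.uncurry (explicitStep g Δ)) := by
  have hswap : Measurable fun p : Fin N × (Vec n × Vec d) => explicitStep g Δ (p.2.1, p.1) p.2.2 :=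
    measurable_from_prod_countable_right fun i => (continuous_explicitStep hg i).measurable
  exact hswap.comp (f := fun q : (Vec n × Fin N) × Vec d => (q.1.2, (q.1.1, q.2))) (by fun_prop)

lemma MonotoneCoefficients.measurable_implicitSolve (hfg : MonotoneCoefficients f g ν)
    (hΔ : IsStepSize ν Δ) : Measurable (Function.uncurry (implicitSolve f Δ)) :=
  measurable_from_prod_countable_right fun j => (hfg.continuous_implicitSolve hΔ j).measurable

lemma MonotoneCoefficients.measurable_bemMap (hfg : MonotoneCoefficients f g ν)
    (hΔ : IsStepSize ν Δ) : Measurable (Function.uncurry (bemMap f g Δ)) := by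
  have hswitch : Measurable fun q : ((Fin N → Fin N) × Vec d) × (Vec n × Fin N) => q.1.1 q.2.2 :=
    (Measurable.of_discrete (f := fun q : (Fin N → Fin N) × Fin N => q.1 q.2)).comp
      (f := fun q : ((Fin N → Fin N) × Vec d) × (Vec n × Fin N) => (q.1.1, q.2.2)) (by fun_prop)
  have hexplicit := (measurable_explicitStep (Δ := Δ) hfg.continuous).comp
    (f := fun q : ((Fin N → Fin N) × Vec d) × (Vec n × Fin N) => (q.2, q.1.2)) (by fun_prop)
  exact ((hfg.measurable_implicitSolve hΔ).comp (hswitch.prodMk hexplicit)).prodMk hswitch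

lemma MonotoneCoefficients.continuous_bemMap (hfg : MonotoneCoefficients f g ν)
    (hΔ : IsStepSize ν Δ) (e : (Fin N → Fin N) × Vec d) : Continuous (bemMap f g Δ e) := by
  refine continuous_prod_of_discrete_right.2 fun i => ?_
  have hpos : Continuous fun x => implicitSolve f Δ (e.1 i) (explicitStep g Δ (x, i) e.2) :=
    (hfg.continuous_implicitSolve hΔ (e.1 i)).comp
      ((continuous_explicitStep hfg.continuous i).comp (.prodMk_left e.2))
  exact hpos.prodMk (continuous_const (y := e.1 i))

/-! ### Drift and contraction of the scheme -/

/-- The transition kernel of the scheme when the switching chain has transition matrix `Q`. -/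
def bemChain (f : Vec n → Fin N → Vec n) (g : Vec n → Fin N → Matrix (Fin n) (Fin d) ℝ)
    (Q : Matrix (Fin N) (Fin N) ℝ) (Δ : ℝ) : Kernel (Vec n × Fin N) (Vec n × Fin N) :=
  randomMapKernel (noiseLaw d Q) (bemMap f g Δ)

/-- The synchronous coupling of two copies of the scheme. -/
def bemCoupling (f : Vec n → Fin N → Vec n) (g : Vec n → Fin N → Matrix (Fin n) (Fin d) ℝ)
    (Q : Matrix (Fin N) (Fin N) ℝ) (Δ : ℝ) :
    Kernel ((Vec n × Fin N) × (Vec n × Fin N)) ((Vec n × Fin N) × (Vec n × Fin N)) :=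
  randomMapKernel (noiseLaw d Q) (pairMap (bemMap f g Δ))

/-- The Lyapunov function of the scheme. The factor `2` makes the sum of its values at two points
in the same state dominate their weighted distance. -/
def lyapunov (g : Vec n → Fin N → Matrix (Fin n) (Fin d) ℝ) (Δ p : ℝ) (h : Fin N → ℝ)
    (z : Vec n × Fin N) : ℝ≥0∞ :=
  2 * weightedDist g Δ p h z.2 z.1 0

/-- The pairs whose switching states agree. -/
def coupledPairs (n N : ℕ) : Set ((Vec n × Fin N) × (Vec n × Fin N)) :=
  {zw | zw.1.2 = zw.2.2}

lemma measurable_lyapunov (hg : ∀ i, Continuous fun x => g x i) :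
    Measurable (lyapunov g Δ p h) :=
  measurable_from_prod_countable_left fun i =>
    ((measurable_weightedDist hg i).comp (f := fun x : Vec n => (x, 0)) (by fun_prop)).const_mul 2

lemma measurableSet_coupledPairs : MeasurableSet (coupledPairs n N) :=
  measurableSet_eq_fun (by fun_prop) (by fun_prop)

lemma measurable_weightedDist_pair (hg : ∀ i, Continuous fun x => g x i) :
    Measurable fun zw : (Vec n × Fin N) × (Vec n × Fin N) =>
      weightedDist g Δ p h zw.1.2 zw.1.1 zw.2.1 := by
  have hswap : Measurable fun q : Fin N × (Vec n × Vec n) =>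
      weightedDist g Δ p h q.1 q.2.1 q.2.2 :=
    measurable_from_prod_countable_right fun i => measurable_weightedDist hg i
  exact hswap.comp (f := fun zw : (Vec n × Fin N) × (Vec n × Fin N) =>
    (zw.1.2, (zw.1.1, zw.2.1))) (by fun_prop)

lemma MonotoneCoefficients.lintegral_weightedDist_implicitSolve_le
    (hfg : MonotoneCoefficients f g ν) (hΔ : IsStepSize ν Δ) (hQ : Q ∈ rowStochastic ℝ (Fin N))
    (hh : IsContractingWeight Q (stepFactor ν Δ p) h ρ) (hp : 0 ≤ p) (i : Fin N)
    {Y : Vec d → Vec n} {Y' : Fin N → Vec d → Vec n} (hY : Measurable Y)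
    (hY' : ∀ j, Measurable (Y' j)) {S : ℝ≥0∞}
    (hS : ∀ j, ∫⁻ ξ, ENNReal.ofReal (‖Y ξ - Y' j ξ‖ ^ p) ∂stdGaussian (Vec d) ≤ S) :
    ∫⁻ e, weightedDist g Δ p h (e.1 i) (implicitSolve f Δ (e.1 i) (Y e.2))
        (implicitSolve f Δ (e.1 i) (Y' (e.1 i) e.2)) ∂noiseLaw d Q ≤
      ENNReal.ofReal ρ * (ENNReal.ofReal (h i) * S) := by
  have hh0 (j : Fin N) : 0 ≤ h j := zero_le_one.trans (hh.one_le j)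
  have hfactor (j : Fin N) : 0 ≤ stepFactor ν Δ p j :=
    Real.rpow_nonneg (inv_pos.2 (hΔ.one_sub_pos j)).le _
  have hm (j : Fin N) : Measurable fun ξ => ENNReal.ofReal (‖Y ξ - Y' j ξ‖ ^ p) :=
    ((hY.sub (hY' j)).norm.pow_const p).ennreal_ofReal
  have hQ0 (j : Fin N) : 0 ≤ Q i j := Matrix.nonneg_of_mem_rowStochastic hQ
  calc ∫⁻ e, weightedDist g Δ p h (e.1 i) (implicitSolve f Δ (e.1 i) (Y e.2))
        (implicitSolve f Δ (e.1 i) (Y' (e.1 i) e.2)) ∂noiseLaw d Q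
      ≤ ∫⁻ e, ENNReal.ofReal (stepFactor ν Δ p (e.1 i) * h (e.1 i)) *
          ENNReal.ofReal (‖Y e.2 - Y' (e.1 i) e.2‖ ^ p) ∂noiseLaw d Q :=
        lintegral_mono fun e => hfg.weightedDist_implicitSolve_le hΔ hp (hh0 _) _ _
    _ = ∑ j, ENNReal.ofReal (Q i j) * (ENNReal.ofReal (stepFactor ν Δ p j * h j) *
          ∫⁻ ξ, ENNReal.ofReal (‖Y ξ - Y' j ξ‖ ^ p) ∂stdGaussian (Vec d)) := by
        rw [lintegral_noiseLaw hQ i (H := fun j ξ => ENNReal.ofReal (stepFactor ν Δ p j * h j) *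
          ENNReal.ofReal (‖Y ξ - Y' j ξ‖ ^ p)) fun j => (hm j).const_mul _]
        simp only [lintegral_const_mul _ (hm _)]
    _ ≤ ∑ j, ENNReal.ofReal (Q i j) * (ENNReal.ofReal (stepFactor ν Δ p j * h j) * S) := by
        gcongr with j
        exact hS j
    _ = ENNReal.ofReal (∑ j, Q i j * (stepFactor ν Δ p j * h j)) * S := by
        rw [ENNReal.ofReal_sum_of_nonneg fun j _ =>
          mul_nonneg (hQ0 j) (mul_nonneg (hfactor j) (hh0 j)), Finset.sum_mul]
        simp only [ENNReal.ofReal_mul (hQ0 _), mul_assoc]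
    _ ≤ ENNReal.ofReal (ρ * h i) * S := by
        gcongr
        exact hh.sum_le i
    _ = ENNReal.ofReal ρ * (ENNReal.ofReal (h i) * S) := by
        rw [ENNReal.ofReal_mul' (hh0 i), mul_assoc]

lemma weightedDist_eq_mul (hi : ∀ i, 1 ≤ h i) (i : Fin N) (x y : Vec n) :
    weightedDist g Δ p h i x y =
      ENNReal.ofReal (h i) * ENNReal.ofReal (sqDist g Δ x y i ^ (p / 2)) :=
  ENNReal.ofReal_mul (zero_le_one.trans (hi i))

lemma explicitStep_sub (g : Vec n → Fin N → Matrix (Fin n) (Fin d) ℝ) (Δ : ℝ) (x y : Vec n)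
    (i : Fin N) (ξ : Vec d) : explicitStep g Δ (x, i) ξ - explicitStep g Δ (y, i) ξ =
      x - y + Matrix.toEuclideanLin (g x i - g y i) (Real.sqrt Δ • ξ) := by
  rw [map_sub, LinearMap.sub_apply]
  exact add_sub_add_comm _ _ _ _

lemma measurable_explicitStep_right (hg : ∀ i, Continuous fun x => g x i) (z : Vec n × Fin N) :
    Measurable (explicitStep g Δ z) :=
  (measurable_explicitStep hg).comp measurable_prodMk_left

lemma MonotoneCoefficients.lintegral_weightedDist_bemCoupling_le
    (hfg : MonotoneCoefficients f g ν) (hΔ : IsStepSize ν Δ) (hQ : Q ∈ rowStochastic ℝ (Fin N))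
    (hh : IsContractingWeight Q (stepFactor ν Δ p) h ρ) (hp : 0 < p) (hp2 : p ≤ 2)
    {w : (Vec n × Fin N) × (Vec n × Fin N)} (hw : w ∈ coupledPairs n N) :
    ∫⁻ w', weightedDist g Δ p h w'.1.2 w'.1.1 w'.2.1 ∂bemCoupling f g Q Δ w ≤
      ENNReal.ofReal ρ * weightedDist g Δ p h w.1.2 w.1.1 w.2.1 := by
  obtain ⟨⟨x, i⟩, ⟨y, j⟩⟩ := w
  obtain rfl : i = j := hw
  have := isProbabilityMeasure_noiseLaw d hQ
  rw [bemCoupling, lintegral_randomMapKernel (measurable_uncurry_pairMap (hfg.measurable_bemMap hΔ))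
    (measurable_weightedDist_pair hfg.continuous), weightedDist_eq_mul hh.one_le]
  refine hfg.lintegral_weightedDist_implicitSolve_le hΔ hQ hh hp.le i
    (measurable_explicitStep_right hfg.continuous (x, i))
    (fun _ => measurable_explicitStep_right hfg.continuous (y, i)) fun _ => ?_
  simp only [explicitStep_sub]
  exact lintegral_norm_add_rpow_stdGaussian_le _ _ hΔ.pos.le hp hp2

lemma MonotoneCoefficients.lintegral_norm_explicitStep_rpow_le
    (hfg : MonotoneCoefficients f g ν) (hΔ : IsStepSize ν Δ) (hp : 0 < p) (hp1 : p ≤ 1)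
    (x y : Vec n) (i : Fin N) :
    ∫⁻ ξ, ENNReal.ofReal (‖explicitStep g Δ (x, i) ξ - y‖ ^ p) ∂stdGaussian (Vec d) ≤
      ENNReal.ofReal (sqDist g Δ x 0 i ^ (p / 2)) +
        ENNReal.ofReal ((‖-y‖ ^ 2 + Δ * hsNorm (g 0 i) ^ 2) ^ (p / 2)) := by
  have hm : Measurable fun ξ =>
      ENNReal.ofReal (‖explicitStep g Δ (x, i) ξ - explicitStep g Δ (0, i) ξ‖ ^ p) :=
    (((measurable_explicitStep_right hfg.continuous _).sub
      (measurable_explicitStep_right hfg.continuous _)).norm.pow_const p).ennreal_ofReal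
  have htri (ξ : Vec d) : ENNReal.ofReal (‖explicitStep g Δ (x, i) ξ - y‖ ^ p) ≤
      ENNReal.ofReal (‖explicitStep g Δ (x, i) ξ - explicitStep g Δ (0, i) ξ‖ ^ p) +
        ENNReal.ofReal (‖-y + Matrix.toEuclideanLin (g 0 i) (Real.sqrt Δ • ξ)‖ ^ p) := by
    rw [← ENNReal.ofReal_add (by positivity) (by positivity)]
    refine ENNReal.ofReal_le_ofReal (le_trans ?_
      (Real.rpow_add_le_add_rpow (norm_nonneg _) (norm_nonneg _) hp.le hp1))
    gcongr
    refine (congrArg norm ?_).trans_le (norm_add_le _ _)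
    simp only [explicitStep]
    abel
  refine (lintegral_mono htri).trans ?_
  rw [lintegral_add_left hm]
  simp only [explicitStep_sub]
  exact add_le_add (lintegral_norm_add_rpow_stdGaussian_le _ _ hΔ.pos.le hp (by linarith))
    (lintegral_norm_add_rpow_stdGaussian_le _ _ hΔ.pos.le hp (by linarith))

theorem MonotoneCoefficients.exists_hasDrift_lyapunov
    (hfg : MonotoneCoefficients f g ν) (hΔ : IsStepSize ν Δ) (hQ : Q ∈ rowStochastic ℝ (Fin N))
    (hh : IsContractingWeight Q (stepFactor ν Δ p) h ρ) (hp : 0 < p) (hp1 : p ≤ 1) :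
    ∃ b ≠ ∞, HasDrift (bemChain f g Q Δ) (lyapunov g Δ p h) (ENNReal.ofReal ρ) b := by
  have := isProbabilityMeasure_noiseLaw d hQ
  -- `0` is the solution of the implicit equation in the state `j` at the point `y j`.
  let y (j : Fin N) : Vec n := 0 - Δ • f 0 j
  let S (i j : Fin N) : ℝ≥0∞ :=
    ENNReal.ofReal ((‖-y j‖ ^ 2 + Δ * hsNorm (g 0 i) ^ 2) ^ (p / 2))
  let b : ℝ≥0∞ := ∑ i, 2 * (ENNReal.ofReal ρ * (ENNReal.ofReal (h i) * ∑ j, S i j))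
  have hb : b ≠ ∞ := ENNReal.sum_ne_top.2 fun i _ => by
    have hS : ∑ j, S i j ≠ ∞ := ENNReal.sum_ne_top.2 fun j _ => ENNReal.ofReal_ne_top
    finiteness
  refine ⟨b, hb, fun ⟨x, i⟩ => ?_⟩
  have hmoment (j : Fin N) :
      ∫⁻ ξ, ENNReal.ofReal (‖explicitStep g Δ (x, i) ξ - y j‖ ^ p) ∂stdGaussian (Vec d) ≤
        ENNReal.ofReal (sqDist g Δ x 0 i ^ (p / 2)) + ∑ j, S i j :=
    (hfg.lintegral_norm_explicitStep_rpow_le hΔ hp hp1 x (y j) i).trans <| by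
      gcongr
      exact Finset.single_le_sum (f := S i) (fun _ _ => zero_le) (Finset.mem_univ j)
  have hcontr := hfg.lintegral_weightedDist_implicitSolve_le hΔ hQ hh hp.le i
    (measurable_explicitStep_right hfg.continuous (x, i)) (fun _ => measurable_const) hmoment
  simp only [y, hfg.implicitSolve_eq hΔ] at hcontr
  have hbi : 2 * (ENNReal.ofReal ρ * (ENNReal.ofReal (h i) * ∑ j, S i j)) ≤ b :=
    Finset.single_le_sum (f := fun i => 2 * (ENNReal.ofReal ρ *
      (ENNReal.ofReal (h i) * ∑ j, S i j))) (fun _ _ => zero_le) (Finset.mem_univ i)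
  calc ∫⁻ w, lyapunov g Δ p h w ∂bemChain f g Q Δ (x, i)
      = 2 * ∫⁻ e, weightedDist g Δ p h (bemMap f g Δ e (x, i)).2 (bemMap f g Δ e (x, i)).1 0
          ∂noiseLaw d Q := by
        rw [bemChain, lintegral_randomMapKernel (hfg.measurable_bemMap hΔ)
          (measurable_lyapunov hfg.continuous)]
        exact lintegral_const_mul' _ _ ENNReal.ofNat_ne_top
    _ ≤ 2 * (ENNReal.ofReal ρ * (ENNReal.ofReal (h i) *
          (ENNReal.ofReal (sqDist g Δ x 0 i ^ (p / 2)) + ∑ j, S i j))) := by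
        gcongr
        exact hcontr
    _ = ENNReal.ofReal ρ * lyapunov g Δ p h (x, i) +
          2 * (ENNReal.ofReal ρ * (ENNReal.ofReal (h i) * ∑ j, S i j)) := by
        rw [lyapunov, weightedDist_eq_mul hh.one_le]
        ring
    _ ≤ ENNReal.ofReal ρ * lyapunov g Δ p h (x, i) + b := by gcongr

lemma noiseLaw_ne_le (hQ : Q ∈ rowStochastic ℝ (Fin N)) (l i j : Fin N) :
    noiseLaw d Q {e | e.1 i ≠ e.1 j} ≤ 1 - ENNReal.ofReal (∏ k, Q k l) := by
  have := isProbabilityMeasure_switchLaw hQ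
  have := isProbabilityMeasure_noiseLaw d hQ
  set A : Set ((Fin N → Fin N) × Vec d) := (Set.univ.pi fun _ => {l}) ×ˢ Set.univ
  have hAm : MeasurableSet A :=
    (MeasurableSet.univ_pi fun _ => measurableSet_singleton l).prod MeasurableSet.univ
  have hA : noiseLaw d Q A = ENNReal.ofReal (∏ k, Q k l) := by
    rw [noiseLaw, Measure.prod_prod, Measure.pi_pi, measure_univ, mul_one,
      ENNReal.ofReal_prod_of_nonneg fun k _ => Matrix.nonneg_of_mem_rowStochastic hQ]
    refine Finset.prod_congr rfl fun k _ => ?_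
    simp [switchLaw, Set.indicator_apply, Finset.sum_ite_eq']
  rw [← hA, ← prob_compl_eq_one_sub hAm]
  refine measure_mono fun e he heA => he ?_
  exact (heA.1 i (Set.mem_univ _)).trans (heA.1 j (Set.mem_univ _)).symm

end Scheme

/-! ### Ergodicity of the scheme -/

section Ergodicity

open Matrix (rowStochastic)

variable {n d N : ℕ} {f : Vec n → Fin N → Vec n} {g : Vec n → Fin N → Matrix (Fin n) (Fin d) ℝ}
  {Q : Matrix (Fin N) (Fin N) ℝ} {ν h : Fin N → ℝ} {Δ p ρ : ℝ} {R : ℝ≥0∞} {l : Fin N}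

lemma MonotoneCoefficients.isMarkovKernel_bemChain (hfg : MonotoneCoefficients f g ν)
    (hΔ : IsStepSize ν Δ) (hQ : Q ∈ rowStochastic ℝ (Fin N)) :
    IsMarkovKernel (bemChain f g Q Δ) :=
  have := isProbabilityMeasure_noiseLaw d hQ
  isMarkovKernel_randomMapKernel (hfg.measurable_bemMap hΔ)

lemma MonotoneCoefficients.isMarkovKernel_bemCoupling (hfg : MonotoneCoefficients f g ν)
    (hΔ : IsStepSize ν Δ) (hQ : Q ∈ rowStochastic ℝ (Fin N)) :
    IsMarkovKernel (bemCoupling f g Q Δ) :=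
  have := isProbabilityMeasure_noiseLaw d hQ
  isMarkovKernel_randomMapKernel (measurable_uncurry_pairMap (hfg.measurable_bemMap hΔ))

lemma MonotoneCoefficients.isMarkovCoupling_bemCoupling (hfg : MonotoneCoefficients f g ν)
    (hΔ : IsStepSize ν Δ) (hQ : Q ∈ rowStochastic ℝ (Fin N)) :
    IsMarkovCoupling (bemCoupling f g Q Δ) (bemChain f g Q Δ) :=
  have := isProbabilityMeasure_noiseLaw d hQ
  isMarkovCoupling_randomMapKernel_pairMap (hfg.measurable_bemMap hΔ)

lemma lyapunov_ne_top (z : Vec n × Fin N) : lyapunov g Δ p h z ≠ ∞ :=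
  ENNReal.mul_ne_top ENNReal.ofNat_ne_top ENNReal.ofReal_ne_top

lemma ofReal_norm_rpow_le_lyapunov (hΔ : 0 ≤ Δ) (hp : 0 ≤ p) (hh : ∀ i, 1 ≤ h i)
    (z : Vec n × Fin N) : ENNReal.ofReal (‖z.1‖ ^ p) ≤ lyapunov g Δ p h z := by
  have hle := ofReal_norm_sub_rpow_le_weightedDist (g := g) hΔ hp (hh z.2) z.1 0
  rw [sub_zero] at hle
  exact hle.trans (le_mul_of_one_le_left zero_le one_le_two)

lemma exists_isCompact_lyapunov_le_subset (hΔ : 0 ≤ Δ) (hp : 0 < p) (hh : ∀ i, 1 ≤ h i)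
    (r : ℝ≥0) : ∃ K, IsCompact K ∧ {z : Vec n × Fin N | lyapunov g Δ p h z ≤ r} ⊆ K := by
  refine ⟨Metric.closedBall 0 ((r : ℝ) ^ p⁻¹) ×ˢ Set.univ,
    (isCompact_closedBall _ _).prod isCompact_univ, fun z hz => ⟨?_, Set.mem_univ _⟩⟩
  have hle := (ofReal_norm_rpow_le_lyapunov hΔ hp.le hh z).trans hz
  rw [← ENNReal.ofReal_coe_nnreal, ENNReal.ofReal_le_ofReal_iff r.coe_nonneg] at hle
  rw [mem_closedBall_zero_iff]
  exact (Real.le_rpow_inv_iff_of_pos (norm_nonneg _) r.coe_nonneg hp).2 hle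

theorem MonotoneCoefficients.exists_invariant_bemChain (hfg : MonotoneCoefficients f g ν)
    (hΔ : IsStepSize ν Δ) (hQ : Q ∈ rowStochastic ℝ (Fin N))
    (hh : IsContractingWeight Q (stepFactor ν Δ p) h ρ) (hρ : ρ < 1) (hp : 0 < p) (hp1 : p ≤ 1)
    (i : Fin N) : ∃ π, IsProbabilityMeasure π ∧ (bemChain f g Q Δ).Invariant π := by
  have := isProbabilityMeasure_noiseLaw d hQ
  have := hfg.isMarkovKernel_bemChain hΔ hQ
  obtain ⟨b, hb, hdrift⟩ := hfg.exists_hasDrift_lyapunov hΔ hQ hh hp hp1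
  have hfeller : IsFeller (bemChain f g Q Δ) :=
    isFeller_randomMapKernel (hfg.measurable_bemMap hΔ) (hfg.continuous_bemMap hΔ)
  exact hfeller.exists_invariant (0, i) <| hdrift.isTightMeasureSet_range_pow
    (measurable_lyapunov hfg.continuous)
    (exists_isCompact_lyapunov_le_subset hΔ.pos.le hp hh.one_le) (ENNReal.ofReal_lt_one.2 hρ) hb
    (lyapunov_ne_top _)

lemma MonotoneCoefficients.ae_bemCoupling_mem_coupledPairs (hfg : MonotoneCoefficients f g ν)
    (hΔ : IsStepSize ν Δ) (hQ : Q ∈ rowStochastic ℝ (Fin N))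
    {w : (Vec n × Fin N) × (Vec n × Fin N)} (hw : w ∈ coupledPairs n N) :
    ∀ᵐ w' ∂bemCoupling f g Q Δ w, w' ∈ coupledPairs n N := by
  have := isProbabilityMeasure_noiseLaw d hQ
  have hm := measurable_uncurry_pairMap (hfg.measurable_bemMap hΔ)
  rw [bemCoupling, randomMapKernel_apply hm]
  exact (ae_map_iff (measurable_apply_of_uncurry hm w).aemeasurable measurableSet_coupledPairs).2
    (ae_of_all _ fun e => congrArg e.1 hw)

lemma MonotoneCoefficients.bemCoupling_compl_coupledPairs_le (hfg : MonotoneCoefficients f g ν)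
    (hΔ : IsStepSize ν Δ) (hQ : Q ∈ rowStochastic ℝ (Fin N)) (l : Fin N)
    (w : (Vec n × Fin N) × (Vec n × Fin N)) :
    bemCoupling f g Q Δ w (coupledPairs n N)ᶜ ≤ 1 - ENNReal.ofReal (∏ k, Q k l) := by
  have := isProbabilityMeasure_noiseLaw d hQ
  have hm := measurable_uncurry_pairMap (hfg.measurable_bemMap hΔ)
  rw [bemCoupling, randomMapKernel_apply hm, Measure.map_apply (measurable_apply_of_uncurry hm w)
    measurableSet_coupledPairs.compl]
  exact noiseLaw_ne_le hQ l w.1.2 w.2.2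

/-- The cost contracted by the synchronous coupling: the weighted distance of the positions once
the switching states have met, and before that a bound of it in terms of the Lyapunov function,
with the penalty `R`. -/
def bemCost (g : Vec n → Fin N → Matrix (Fin n) (Fin d) ℝ) (Δ p : ℝ) (h : Fin N → ℝ) (R : ℝ≥0∞) :
    (Vec n × Fin N) × (Vec n × Fin N) → ℝ≥0∞ :=
  couplingCost (coupledPairs n N) (fun zw => weightedDist g Δ p h zw.1.2 zw.1.1 zw.2.1)
    (fun zw => lyapunov g Δ p h zw.1 + lyapunov g Δ p h zw.2) R

lemma measurable_lyapunov_add_lyapunov (hg : ∀ i, Continuous fun x => g x i) :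
    Measurable fun zw : (Vec n × Fin N) × (Vec n × Fin N) =>
      lyapunov g Δ p h zw.1 + lyapunov g Δ p h zw.2 :=
  ((measurable_lyapunov hg).comp measurable_fst).add ((measurable_lyapunov hg).comp measurable_snd)

lemma measurable_bemCost (hg : ∀ i, Continuous fun x => g x i) (R : ℝ≥0∞) :
    Measurable (bemCost g Δ p h R) :=
  measurable_couplingCost measurableSet_coupledPairs (measurable_weightedDist_pair hg)
    (measurable_lyapunov_add_lyapunov hg) R

lemma weightedDist_le_lyapunov_add (hΔ : 0 ≤ Δ) (hp : 0 ≤ p) (hp1 : p ≤ 1) (hh : ∀ i, 1 ≤ h i)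
    {w : (Vec n × Fin N) × (Vec n × Fin N)} (hw : w ∈ coupledPairs n N) :
    weightedDist g Δ p h w.1.2 w.1.1 w.2.1 ≤ lyapunov g Δ p h w.1 + lyapunov g Δ p h w.2 := by
  obtain ⟨⟨x, i⟩, ⟨y, j⟩⟩ := w
  obtain rfl : i = j := hw
  exact weightedDist_le_two_mul hΔ hp (hp1.trans one_le_two) (zero_le_one.trans (hh i)) x y 0

lemma bemCost_le (hΔ : 0 ≤ Δ) (hp : 0 ≤ p) (hp1 : p ≤ 1) (hh : ∀ i, 1 ≤ h i)
    (z w : Vec n × Fin N) :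
    bemCost g Δ p h R (z, w) ≤ lyapunov g Δ p h z + lyapunov g Δ p h w + R :=
  (couplingCost_le_add_indicator
    (fun _ hw => weightedDist_le_lyapunov_add hΔ hp hp1 hh hw) R (z, w)).trans
    (add_le_add_right (Set.indicator_le_self' (fun _ _ => zero_le) _) _)

theorem MonotoneCoefficients.exists_hasDrift_bemCost (hfg : MonotoneCoefficients f g ν)
    (hΔ : IsStepSize ν Δ) (hQ : Q ∈ rowStochastic ℝ (Fin N)) (hl : ∀ k, 0 < Q k l)
    (hh : IsContractingWeight Q (stepFactor ν Δ p) h ρ) (hρ : ρ < 1) (hp : 0 < p) (hp1 : p ≤ 1) :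
    ∃ R ρ', 1 ≤ R ∧ R ≠ ∞ ∧ ρ' < 1 ∧
      HasDrift (bemCoupling f g Q Δ) (bemCost g Δ p h R) ρ' 0 := by
  have := hfg.isMarkovKernel_bemCoupling hΔ hQ
  obtain ⟨b, hb, hdrift⟩ := hfg.exists_hasDrift_lyapunov hΔ hQ hh hp hp1
  have hdoeblin : (1 : ℝ≥0∞) - ENNReal.ofReal (∏ k, Q k l) < 1 :=
    ENNReal.sub_lt_self ENNReal.one_ne_top one_ne_zero
      (ENNReal.ofReal_pos.2 (Finset.prod_pos fun k _ => hl k)).ne'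
  exact exists_hasDrift_couplingCost measurableSet_coupledPairs
    (measurable_lyapunov_add_lyapunov hfg.continuous)
    (fun w hw => hfg.ae_bemCoupling_mem_coupledPairs hΔ hQ hw)
    (fun w hw => hfg.lintegral_weightedDist_bemCoupling_le hΔ hQ hh hp (hp1.trans one_le_two) hw)
    ((hfg.isMarkovCoupling_bemCoupling hΔ hQ).hasDrift_add
      (measurable_lyapunov hfg.continuous) hdrift)
    (ENNReal.ofReal_lt_one.2 hρ) (by finiteness)
    (fun w hw => weightedDist_le_lyapunov_add hΔ.pos.le hp.le hp1 hh.one_le hw)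
    (fun w _ => hfg.bemCoupling_compl_coupledPairs_le hΔ hQ l w) hdoeblin

lemma ofReal_dp_le_bemCost (hΔ : 0 ≤ Δ) (hp : 0 ≤ p) (hp1 : p ≤ 1) (hh : ∀ i, 1 ≤ h i)
    (hR : 1 ≤ R) (z w : Vec n × Fin N) : ENNReal.ofReal (dp p z w) ≤ bemCost g Δ p h R (z, w) := by
  obtain ⟨x, i⟩ := z
  obtain ⟨y, j⟩ := w
  by_cases hij : i = j
  · subst hij
    rw [bemCost, couplingCost_of_mem R (show ((x, i), (y, i)) ∈ coupledPairs n N from rfl)]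
    simpa only [dp, ne_eq, not_true_eq_false, if_false, add_zero] using
      ofReal_norm_sub_rpow_le_weightedDist hΔ hp (hh i) x y
  · rw [bemCost, couplingCost_of_notMem R (show ((x, i), (y, j)) ∉ coupledPairs n N from hij)]
    calc ENNReal.ofReal (dp p (x, i) (y, j))
        ≤ ENNReal.ofReal (‖x‖ ^ p + ‖y‖ ^ p + 1) := by
          simp only [dp, ne_eq, hij, not_false_eq_true, if_true]
          gcongr
          exact (Real.rpow_le_rpow (norm_nonneg _) (norm_sub_le x y) hp).trans
            (Real.rpow_add_le_add_rpow (norm_nonneg _) (norm_nonneg _) hp hp1)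
      _ = ENNReal.ofReal (‖x‖ ^ p) + ENNReal.ofReal (‖y‖ ^ p) + 1 := by
          rw [ENNReal.ofReal_add (by positivity) zero_le_one,
            ENNReal.ofReal_add (by positivity) (by positivity), ENNReal.ofReal_one]
      _ ≤ _ := add_le_add (add_le_add (ofReal_norm_rpow_le_lyapunov hΔ hp hh (x, i))
          (ofReal_norm_rpow_le_lyapunov hΔ hp hh (y, j))) hR

lemma min_one_edist_le_ofReal_dp [MetricSpace (Fin N)] (hp : 0 < p) (hp1 : p ≤ 1)
    (z w : Vec n × Fin N) : min 1 (edist z w) ≤ ENNReal.ofReal (dp p z w) := by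
  rw [edist_dist, ← ENNReal.ofReal_one, ← ENNReal.ofReal_min]
  refine ENNReal.ofReal_le_ofReal ?_
  obtain ⟨x, i⟩ := z
  obtain ⟨y, j⟩ := w
  by_cases hij : i = j
  · subst hij
    simp only [dp, Prod.dist_eq, dist_self, ne_eq, not_true_eq_false, if_false, add_zero,
      dist_eq_norm, max_eq_left (norm_nonneg (x - y))]
    rcases le_total 1 ‖x - y‖ with hle | hle
    · exact (min_le_left _ _).trans (Real.one_le_rpow hle hp.le)
    · exact (min_le_right _ _).trans (Real.self_le_rpow_of_le_one (norm_nonneg _) hle hp1)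
  · simp only [dp, ne_eq, hij, not_false_eq_true, if_true]
    exact (min_le_left _ _).trans (le_add_of_nonneg_left (by positivity))

theorem MonotoneCoefficients.bemChain_invariant_unique (hfg : MonotoneCoefficients f g ν)
    (hΔ : IsStepSize ν Δ) (hQ : Q ∈ rowStochastic ℝ (Fin N)) (hl : ∀ k, 0 < Q k l)
    (hh : IsContractingWeight Q (stepFactor ν Δ p) h ρ) (hρ : ρ < 1) (hp : 0 < p) (hp1 : p ≤ 1)
    {u v : Measure (Vec n × Fin N)} [IsProbabilityMeasure u] [IsProbabilityMeasure v]
    (hu : (bemChain f g Q Δ).Invariant u) (hv : (bemChain f g Q Δ).Invariant v) : u = v := by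
  obtain ⟨_⟩ : Nonempty (MetricSpace (Fin N)) := ⟨TopologicalSpace.metrizableSpaceMetric _⟩
  have := hfg.isMarkovKernel_bemChain hΔ hQ
  have := hfg.isMarkovKernel_bemCoupling hΔ hQ
  obtain ⟨b, hb, hdrift⟩ := hfg.exists_hasDrift_lyapunov hΔ hQ hh hp hp1
  obtain ⟨R, ρ', hR, hRtop, hρ', hcost⟩ := hfg.exists_hasDrift_bemCost hΔ hQ hl hh hρ hp hp1
  have hdist (z w : Vec n × Fin N) : min 1 (edist z w) ≤ bemCost g Δ p h R (z, w) :=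
    (min_one_edist_le_ofReal_dp hp hp1 z w).trans
      (ofReal_dp_le_bemCost hΔ.pos.le hp.le hp1 hh.one_le hR z w)
  exact (hfg.isMarkovCoupling_bemCoupling hΔ hQ).invariant_unique
    (measurable_lyapunov hfg.continuous) lyapunov_ne_top hdrift (ENNReal.ofReal_lt_one.2 hρ) hb
    (measurable_bemCost hfg.continuous R) hcost hρ'
    (bemCost_le hΔ.pos.le hp.le hp1 hh.one_le) hRtop
    hdist hu hv

theorem MonotoneCoefficients.exists_wasserstein_bemChain_le (hfg : MonotoneCoefficients f g ν)
    (hΔ : IsStepSize ν Δ) (hQ : Q ∈ rowStochastic ℝ (Fin N)) (hl : ∀ k, 0 < Q k l)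
    (hh : IsContractingWeight Q (stepFactor ν Δ p) h ρ) (hρ : ρ < 1) (hp : 0 < p) (hp1 : p ≤ 1)
    {π : Measure (Vec n × Fin N)} [IsProbabilityMeasure π] (hπ : (bemChain f g Q Δ).Invariant π) :
    ∃ ρ' < 1, ∀ z, ∃ C ≠ ∞, ∀ k : ℕ, wasserstein p ((bemChain f g Q Δ ^ k) z) π ≤ ρ' ^ k * C := by
  have := hfg.isMarkovKernel_bemChain hΔ hQ
  have := hfg.isMarkovKernel_bemCoupling hΔ hQ
  obtain ⟨b, hb, hdrift⟩ := hfg.exists_hasDrift_lyapunov hΔ hQ hh hp hp1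
  obtain ⟨R, ρ', hR, hRtop, hρ', hcost⟩ := hfg.exists_hasDrift_bemCost hΔ hQ hl hh hρ hp hp1
  refine ⟨ρ', hρ', fun z => ?_⟩
  obtain ⟨C, hC, hcoupling⟩ :=
    (hfg.isMarkovCoupling_bemCoupling hΔ hQ).exists_coupling_pow_invariant
      (measurable_lyapunov hfg.continuous) lyapunov_ne_top hdrift (ENNReal.ofReal_lt_one.2 hρ) hb
      (measurable_bemCost hfg.continuous R) hcost hρ'
      (bemCost_le hΔ.pos.le hp.le hp1 hh.one_le) hRtop hπ z
  refine ⟨C, hC, fun k => ?_⟩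
  obtain ⟨θ, hfst, hsnd, hle⟩ := hcoupling k
  calc wasserstein p ((bemChain f g Q Δ ^ k) z) π
      ≤ ∫⁻ zw, ENNReal.ofReal (dp p zw.1 zw.2) ∂θ := iInf_le_of_le ⟨θ, hfst, hsnd⟩ le_rfl
    _ ≤ ∫⁻ zw, bemCost g Δ p h R zw ∂θ := lintegral_mono fun zw =>
        ofReal_dp_le_bemCost hΔ.pos.le hp.le hp1 hh.one_le hR zw.1 zw.2
    _ ≤ ρ' ^ k * C := hle

end Ergodicity

section Identification

open Matrix (rowStochastic)

variable {n d N : ℕ} {f : Vec n → Fin N → Vec n} {g : Vec n → Fin N → Matrix (Fin n) (Fin d) ℝ}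
  {Γ : Matrix (Fin N) (Fin N) ℝ} {ν : Fin N → ℝ} {Δ : ℝ}

lemma MonotoneCoefficients.measurable_implicitSolve_explicitStep
    (hfg : MonotoneCoefficients f g ν) (hΔ : IsStepSize ν Δ) (z : Vec n × Fin N) (j : Fin N) :
    Measurable fun ξ => (implicitSolve f Δ j (explicitStep g Δ z ξ), j) :=
  ((hfg.continuous_implicitSolve hΔ j).measurable.comp
    (measurable_explicitStep_right hfg.continuous z)).prodMk measurable_const

lemma MonotoneCoefficients.lintegral_bemStep (hfg : MonotoneCoefficients f g ν)
    (hΔ : IsStepSize ν Δ) (z : Vec n × Fin N) {φ : Vec n × Fin N → ℝ≥0∞} (hφ : Measurable φ) :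
    ∫⁻ w, φ w ∂bemStep f g Γ Δ z = ∑ j, ENNReal.ofReal (stepMatrix Γ Δ z.2 j) *
      ∫⁻ ξ, φ (implicitSolve f Δ j (explicitStep g Δ z ξ), j) ∂stdGaussian (Vec d) := by
  rw [bemStep, lintegral_finsetSum_measure]
  refine Finset.sum_congr rfl fun j _ => ?_
  rw [lintegral_smul_measure, smul_eq_mul]
  exact congrArg _ (lintegral_map hφ (hfg.measurable_implicitSolve_explicitStep hΔ z j))

lemma MonotoneCoefficients.coe_bemChain_stepMatrix (hfg : MonotoneCoefficients f g ν)
    (hΔ : IsStepSize ν Δ) (hΓ : IsGenerator Γ) :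
    ⇑(bemChain f g (stepMatrix Γ Δ) Δ) = bemStep f g Γ Δ := by
  have hQ := stepMatrix_mem_rowStochastic hΓ hΔ.pos.le
  have := isProbabilityMeasure_noiseLaw d hQ
  refine funext fun z => Measure.ext_of_lintegral _ fun φ hφ => ?_
  rw [bemChain, lintegral_randomMapKernel (hfg.measurable_bemMap hΔ) hφ,
    hfg.lintegral_bemStep hΔ z hφ]
  exact lintegral_noiseLaw hQ z.2 fun j =>
    hφ.comp (hfg.measurable_implicitSolve_explicitStep hΔ z j)

lemma MonotoneCoefficients.bemKernel_eq_pow (hfg : MonotoneCoefficients f g ν)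
    (hΔ : IsStepSize ν Δ) (hΓ : IsGenerator Γ) (k : ℕ) (z : Vec n × Fin N) :
    bemKernel f g Γ Δ k z = (bemChain f g (stepMatrix Γ Δ) Δ ^ k) z := by
  induction k with
  | zero => exact (Kernel.id_apply z).symm
  | succ k ih =>
    rw [bemKernel, ih, ← hfg.coe_bemChain_stepMatrix hΔ hΓ, comp_pow_apply]

lemma ext_of_prod_singleton {α ι : Type*} [MeasurableSpace α] [MeasurableSpace ι] [Countable ι]
    [MeasurableSingletonClass ι] {u v : Measure (α × ι)}
    (huv : ∀ (A : Set α) (j : ι), MeasurableSet A → u (A ×ˢ {j}) = v (A ×ˢ {j})) : u = v := by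
  refine Measure.ext fun S hS => ?_
  have hslice (j : ι) : MeasurableSet ((fun x => (x, j)) ⁻¹' S) := measurable_prodMk_right hS
  have hunion : S = ⋃ j, ((fun x => (x, j)) ⁻¹' S) ×ˢ {j} := by
    ext ⟨x, j⟩
    simp
  have hdisj : Pairwise (Function.onFun Disjoint
      fun j : ι => (((fun x => (x, j)) ⁻¹' S) ×ˢ {j} : Set (α × ι))) := fun i j hij =>
    Set.disjoint_left.2 fun z hz hz' => hij ((show z.2 = i from hz.2).symm.trans hz'.2)
  rw [hunion, measure_iUnion hdisj fun j => (hslice j).prod (measurableSet_singleton j),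
    measure_iUnion hdisj fun j => (hslice j).prod (measurableSet_singleton j)]
  exact tsum_congr fun j => huv _ j (hslice j)

lemma MonotoneCoefficients.isInvariantMeasure_iff (hfg : MonotoneCoefficients f g ν)
    (hΔ : IsStepSize ν Δ) (hΓ : IsGenerator Γ) {π : Measure (Vec n × Fin N)} :
    IsInvariantMeasure (bemKernel f g Γ Δ) π ↔
      IsProbabilityMeasure π ∧ (bemChain f g (stepMatrix Γ Δ) Δ).Invariant π := by
  have hmeas (A : Set (Vec n)) (j : Fin N) (hA : MeasurableSet A) :
      MeasurableSet (A ×ˢ ({j} : Set (Fin N))) := hA.prod (measurableSet_singleton j)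
  refine and_congr_right fun _ => ⟨fun hinv => ext_of_prod_singleton fun A j hA => ?_,
    fun hinv k A j hA => ?_⟩
  · rw [Measure.bind_apply (hmeas A j hA) (Kernel.aemeasurable _), hinv 1 A j hA]
    simp only [hfg.bemKernel_eq_pow hΔ hΓ, pow_one]
  · simp only [hfg.bemKernel_eq_pow hΔ hΓ]
    rw [← Measure.bind_apply (hmeas A j hA) (Kernel.aemeasurable _), (invariant_pow hinv k).def]

end Identification

section StepSize

variable {N : ℕ} {Q : Matrix (Fin N) (Fin N) ℝ} {ν h b c : Fin N → ℝ} {Δ ρ s : ℝ}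

lemma abs_le_maxAbs (ν : Fin N → ℝ) (i : Fin N) : |ν i| ≤ maxAbs ν :=
  le_ciSup (f := fun i => |ν i|) (Set.finite_range _).bddAbove i

lemma maxAbs_nonneg (ν : Fin N → ℝ) : 0 ≤ maxAbs ν :=
  Real.iSup_nonneg fun _ => abs_nonneg _

lemma isStepSize_of_lt (hΔ : 0 < Δ) (hΔ' : Δ < 1 / (maxAbs ν + 2)) : IsStepSize ν Δ where
  pos := hΔ
  abs_mul_lt_one i := by
    have hmax := maxAbs_nonneg ν
    rw [lt_div_iff₀ (by positivity)] at hΔ'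
    rw [abs_mul, abs_of_pos hΔ]
    nlinarith [abs_le_maxAbs ν i]

lemma inv_sub_one_le (hΔ : 0 < Δ) (hΔ' : Δ < 1 / (maxAbs ν + 2)) (j : Fin N) :
    (1 - ν j * Δ)⁻¹ - 1 ≤ Δ * (ν j / (1 - ν j / (maxAbs ν + 2))) := by
  have hpos : 0 < 1 - ν j * Δ := (isStepSize_of_lt hΔ hΔ').one_sub_pos j
  have hmax := maxAbs_nonneg ν
  have hle := (le_abs_self _).trans (abs_le_maxAbs ν j)
  have hpos' : 0 < 1 - ν j / (maxAbs ν + 2) := by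
    rw [sub_pos, div_lt_one (by linarith)]
    linarith
  have hsq : 0 ≤ ν j ^ 2 * (1 / (maxAbs ν + 2) - Δ) :=
    mul_nonneg (sq_nonneg _) (by linarith)
  calc (1 - ν j * Δ)⁻¹ - 1 = Δ * (ν j / (1 - ν j * Δ)) := by field_simp; ring
    _ ≤ Δ * (ν j / (1 - ν j / (maxAbs ν + 2))) := by
      refine mul_le_mul_of_nonneg_left ?_ hΔ.le
      rw [div_le_div_iff₀ hpos hpos', div_eq_mul_one_div (ν j) (maxAbs ν + 2)]
      nlinarith

lemma stepFactor_le_exp (hΔ : 0 < Δ) (hΔ' : Δ < 1 / (maxAbs ν + 2)) {p : ℝ} (hp : 0 ≤ p)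
    (j : Fin N) :
    stepFactor ν Δ p j ≤ Real.exp (p / 2 * Δ * (ν j / (1 - ν j / (maxAbs ν + 2)))) := by
  have hpos : 0 < 1 - ν j * Δ := (isStepSize_of_lt hΔ hΔ').one_sub_pos j
  calc stepFactor ν Δ p j
      ≤ Real.exp ((1 - ν j * Δ)⁻¹ - 1) ^ (p / 2) :=
        Real.rpow_le_rpow (by positivity)
          (by simpa using Real.add_one_le_exp ((1 - ν j * Δ)⁻¹ - 1)) (by positivity)
    _ ≤ Real.exp (Δ * (ν j / (1 - ν j / (maxAbs ν + 2)))) ^ (p / 2) := by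
        gcongr
        exact inv_sub_one_le hΔ hΔ' j
    _ = _ := by rw [← Real.exp_mul, mul_comm, mul_assoc]

lemma IsContractingWeight.mono (hQ : Q ∈ Matrix.rowStochastic ℝ (Fin N))
    (hh : IsContractingWeight Q b h ρ) (hcb : ∀ j, c j ≤ b j) : IsContractingWeight Q c h ρ where
  one_le := hh.one_le
  sum_le i := (Finset.sum_le_sum fun j _ => by
    have := hh.one_le j
    have := Matrix.nonneg_of_mem_rowStochastic hQ (i := i) (j := j)
    have := hcb j
    gcongr).trans (hh.sum_le i)

end StepSize

lemma exists_pow_mul_le_exp {ρ : ℝ≥0∞} (hρ : ρ < 1) {Δ : ℝ} (hΔ : 0 < Δ) :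
    ∃ γ : ℝ, 0 < γ ∧ ∀ C : ℝ≥0∞, C ≠ ∞ → ∃ C' : ℝ, 0 < C' ∧ ∀ k : ℕ,
      ρ ^ k * C ≤ ENNReal.ofReal (C' * Real.exp (-(γ * (k * Δ)))) := by
  obtain ⟨r, hρr, hr1⟩ := ENNReal.lt_iff_exists_nnreal_btwn.1 hρ
  have hr : 0 < (r : ℝ) := by exact_mod_cast pos_of_gt hρr
  have hlog : Real.log r < 0 := Real.log_neg hr (by exact_mod_cast hr1)
  refine ⟨-Real.log r / Δ, by have := neg_pos.2 hlog; positivity,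
    fun C hC => ⟨C.toReal + 1, by positivity, fun k => ?_⟩⟩
  have hexp : Real.exp (-(-Real.log r / Δ * (k * Δ))) = (r : ℝ) ^ k := by
    rw [← Real.rpow_natCast, Real.rpow_def_of_pos hr]
    congr 1
    field_simp
  calc ρ ^ k * C ≤ r ^ k * ENNReal.ofReal (C.toReal + 1) := by
        gcongr
        rw [← ENNReal.ofReal_toReal hC]
        exact ENNReal.ofReal_le_ofReal (by simp)
    _ = ENNReal.ofReal ((C.toReal + 1) * Real.exp (-(-Real.log r / Δ * (k * Δ)))) := by
        rw [hexp, ENNReal.ofReal_mul (by positivity), mul_comm, ENNReal.ofReal_pow r.coe_nonneg,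
          ENNReal.ofReal_coe_nnreal]

/-! ### Recursions driven by a Markov chain and an independent noise -/

section Independence

variable {Ω α β γ : Type*} [MeasurableSpace Ω] [MeasurableSpace α] [MeasurableSpace β]
  [MeasurableSpace γ] {P : Measure Ω} [IsProbabilityMeasure P] {U : Ω → α} {V : Ω → β} {R : Ω → γ}

lemma lintegral_comp_of_indepFun (hU : Measurable U) (hV : Measurable V) (hUV : IndepFun U V P)
    {φ : α → β → ℝ≥0∞} (hφ : Measurable (Function.uncurry φ)) :
    ∫⁻ ω, φ (U ω) (V ω) ∂P = ∫⁻ ω, ∫⁻ v, φ (U ω) v ∂P.map V ∂P := by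
  have := Measure.isProbabilityMeasure_map (μ := P) hV.aemeasurable
  have hlaw := (indepFun_iff_map_prod_eq_prod_map_map hU.aemeasurable hV.aemeasurable).1 hUV
  rw [← lintegral_map (f := fun u => ∫⁻ v, φ u v ∂P.map V) hφ.lintegral_prod_right' hU]
  calc ∫⁻ ω, φ (U ω) (V ω) ∂P
      = ∫⁻ q, Function.uncurry φ q ∂P.map fun ω => (U ω, V ω) :=
        (lintegral_map hφ (hU.prodMk hV)).symm
    _ = ∫⁻ u, ∫⁻ v, φ u v ∂P.map V ∂P.map U := by
        rw [hlaw, lintegral_prod _ hφ.aemeasurable]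
        rfl

lemma lintegral_comp_eq_sum_of_indepFun [Fintype γ] [MeasurableSingletonClass γ]
    (hU : Measurable U) (hR : Measurable R) (hUR : IndepFun U R P) {φ : α → γ → ℝ≥0∞}
    (hφ : ∀ t, Measurable fun u => φ u t) :
    ∫⁻ ω, φ (U ω) (R ω) ∂P = ∑ t, P (R ⁻¹' {t}) * ∫⁻ ω, φ (U ω) t ∂P := by
  rw [lintegral_comp_of_indepFun (φ := fun t u => φ u t) hR hU hUR.symm
    (measurable_from_prod_countable_right hφ),
    ← lintegral_map (f := fun t => ∫⁻ u, φ u t ∂P.map U) .of_discrete hR, lintegral_fintype]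
  refine Finset.sum_congr rfl fun t _ => ?_
  rw [Measure.map_apply hR (measurableSet_singleton t), lintegral_map (hφ t) hU, mul_comm]

lemma indepFun_prodMk_left (hU : Measurable U) (hV : Measurable V) (hR : Measurable R)
    (hUV : IndepFun U V P) (hUVR : IndepFun (fun ω => (U ω, V ω)) R P) :
    IndepFun (fun ω => (U ω, R ω)) V P := by
  have := Measure.isProbabilityMeasure_map (μ := P) hU.aemeasurable
  have := Measure.isProbabilityMeasure_map (μ := P) hV.aemeasurable
  have := Measure.isProbabilityMeasure_map (μ := P) hR.aemeasurable
  have hUR : IndepFun U R P := hUVR.comp measurable_fst measurable_id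
  rw [indepFun_iff_map_prod_eq_prod_map_map (hU.prodMk hR).aemeasurable hV.aemeasurable,
    (indepFun_iff_map_prod_eq_prod_map_map hU.aemeasurable hR.aemeasurable).1 hUR]
  refine Measure.ext_of_lintegral _ fun φ hφ => ?_
  rw [lintegral_map hφ (by fun_prop), lintegral_comp_of_indepFun (U := fun ω => (U ω, V ω))
    (φ := fun q t => φ ((q.1, t), q.2)) (hU.prodMk hV) hR hUVR (by fun_prop),
    lintegral_comp_of_indepFun (φ := fun u v => ∫⁻ t, φ ((u, t), v) ∂P.map R) hU hV hUV
      (Measurable.lintegral_prod_right' (f := fun q : (α × β) × γ => φ ((q.1.1, q.2), q.1.2))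
        (by fun_prop)), lintegral_prod _ hφ.aemeasurable,
    lintegral_prod _ hφ.lintegral_prod_right'.aemeasurable, lintegral_map
      hφ.lintegral_prod_right'.lintegral_prod_right' hU]
  exact lintegral_congr fun ω => lintegral_lintegral_swap (by fun_prop)

end Independence

section Markov

variable {Ω α : Type*} [MeasurableSpace Ω] [MeasurableSpace α] {P : Measure Ω}
  {N : ℕ} {Q : Matrix (Fin N) (Fin N) ℝ} {i₀ : Fin N} {r : ℕ → Ω → Fin N} {U : Ω → α}

lemma IsMarkovChain.measure_path_succ (hr : IsMarkovChain P Q i₀ r) (hQ : ∀ i j, 0 ≤ Q i j)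
    (s : ℕ → Fin N) (k : ℕ) :
    P {ω | ∀ m ≤ k + 1, r m ω = s m} =
      P {ω | ∀ m ≤ k, r m ω = s m} * ENNReal.ofReal (Q (s k) (s (k + 1))) := by
  rw [hr.law, hr.law]
  split_ifs
  · rw [Finset.prod_range_succ, ENNReal.ofReal_mul (Finset.prod_nonneg fun m _ => hQ _ _)]
  · rw [zero_mul]

/-- The states of the switching chain up to time `k`. -/
def history (r : ℕ → Ω → Fin N) (k : ℕ) (ω : Ω) (m : Fin (k + 1)) : Fin N := r m ω

lemma IsMarkovChain.measurable_history (hr : IsMarkovChain P Q i₀ r) (k : ℕ) :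
    Measurable (history r k) :=
  measurable_pi_lambda _ fun m => hr.measurable m

lemma IsMarkovChain.measure_history_succ (hr : IsMarkovChain P Q i₀ r) (hQ : ∀ i j, 0 ≤ Q i j)
    (k : ℕ) (t : Fin (k + 1) → Fin N) (j : Fin N) :
    P ((fun ω => (history r k ω, r (k + 1) ω)) ⁻¹' {(t, j)}) =
      P (history r k ⁻¹' {t}) * ENNReal.ofReal (Q (t (Fin.last k)) j) := by
  let s (m : ℕ) : Fin N := if hm : m < k + 1 then t ⟨m, hm⟩ else j
  have hpath : history r k ⁻¹' {t} = {ω | ∀ m ≤ k, r m ω = s m} := by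
    ext ω
    simp only [Set.mem_preimage, Set.mem_singleton_iff, funext_iff, history, Fin.forall_iff,
      Nat.lt_succ_iff, Set.mem_ofPred_eq]
    refine forall₂_congr fun m hm => ?_
    simp [s, hm]
  have hpath' : (fun ω => (history r k ω, r (k + 1) ω)) ⁻¹' {(t, j)} =
      {ω | ∀ m ≤ k + 1, r m ω = s m} := by
    ext ω
    have := Set.ext_iff.1 hpath ω
    simp only [Set.mem_preimage, Set.mem_singleton_iff, Set.mem_ofPred_eq] at this
    simp [Nat.le_succ_iff_eq_or_le, or_imp, forall_and, this, s, and_comm]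
  rw [hpath', hpath, hr.measure_path_succ hQ]
  simp [s, Fin.last]

lemma IsMarkovChain.lintegral_comp_succ [IsProbabilityMeasure P] (hr : IsMarkovChain P Q i₀ r)
    (hQ : ∀ i j, 0 ≤ Q i j) (hU : Measurable U) (hind : IndepFun U (fun ω k => r k ω) P) {k : ℕ}
    {φ : α → (Fin (k + 1) → Fin N) → Fin N → ℝ≥0∞} (hφ : ∀ t j, Measurable fun u => φ u t j) :
    ∫⁻ ω, φ (U ω) (history r k ω) (r (k + 1) ω) ∂P =
      ∫⁻ ω, ∑ j, ENNReal.ofReal (Q (r k ω) j) * φ (U ω) (history r k ω) j ∂P := by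
  have hpast : IndepFun U (history r k) P :=
    hind.comp measurable_id (ψ := fun (s : ℕ → Fin N) (m : Fin (k + 1)) => s m) (by fun_prop)
  have hnext : IndepFun U (fun ω => (history r k ω, r (k + 1) ω)) P :=
    hind.comp measurable_id
      (ψ := fun s : ℕ → Fin N => (fun m : Fin (k + 1) => s m, s (k + 1))) (by fun_prop)
  rw [lintegral_comp_eq_sum_of_indepFun (φ := fun u q => φ u q.1 q.2) hU
    ((hr.measurable_history k).prodMk (hr.measurable _)) hnext fun q => hφ q.1 q.2]
  refine .trans ?_ (lintegral_comp_eq_sum_of_indepFun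
    (φ := fun u t => ∑ j, ENNReal.ofReal (Q (t (Fin.last k)) j) * φ u t j)
    hU (hr.measurable_history k) hpast
    fun t => Finset.measurable_sum _ fun j _ => (hφ t j).const_mul _).symm
  rw [Fintype.sum_prod_type]
  refine Finset.sum_congr rfl fun t _ => ?_
  have hφU (j : Fin N) : Measurable fun ω => φ (U ω) t j := (hφ t j).comp hU
  rw [lintegral_finsetSum _ fun j _ => (hφU j).const_mul _, Finset.mul_sum]
  refine Finset.sum_congr rfl fun j _ => ?_
  rw [hr.measure_history_succ hQ, lintegral_const_mul _ (hφU j), mul_assoc]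

end Markov

section SwitchedRecursion

variable {Ω E α : Type*} [MeasurableSpace Ω] [MeasurableSpace E] [MeasurableSpace α]
  {P : Measure Ω} {N : ℕ} {Q : Matrix (Fin N) (Fin N) ℝ} {m : Measure E}
  {Θ : Fin N → Fin N → α → E → α} {i₀ : Fin N} {x₀ : α}
  {ξ : ℕ → Ω → E} {X : ℕ → Ω → α} {r : ℕ → Ω → Fin N}

/-- `X` is the recursion `X_{k+1} = Θ(r_k, r_{k+1}, X_k, ξ_k)` started from `x₀`, driven by a Markov
chain `r` with transition matrix `Q` and an independent noise `ξ` with independent entries of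
law `m`. -/
structure IsSwitchedRecursion (P : Measure Ω) (Q : Matrix (Fin N) (Fin N) ℝ) (m : Measure E)
    (Θ : Fin N → Fin N → α → E → α) (i₀ : Fin N) (x₀ : α) (ξ : ℕ → Ω → E) (X : ℕ → Ω → α)
    (r : ℕ → Ω → Fin N) : Prop where
  measurable_map : ∀ i j, Measurable (Function.uncurry (Θ i j))
  chain : IsMarkovChain P Q i₀ r
  measurable_noise : ∀ k, Measurable (ξ k)
  map_noise : ∀ k, P.map (ξ k) = m
  indep_past : ∀ k, IndepFun (fun ω (l : Fin k) => ξ l ω) (ξ k) P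
  indep_chain : IndepFun (fun ω k => ξ k ω) (fun ω k => r k ω) P
  initial : ∀ᵐ ω ∂P, X 0 ω = x₀
  step : ∀ k, ∀ᵐ ω ∂P, X (k + 1) ω = Θ (r k ω) (r (k + 1) ω) (X k ω) (ξ k ω)

lemma measurable_weighted_sum_history (Q : Matrix (Fin N) (Fin N) ℝ) {k : ℕ}
    {ψ : α → (Fin (k + 1) → Fin N) → Fin N → E → ℝ≥0∞}
    (hψ : ∀ t j, Measurable fun q : α × E => ψ q.1 t j q.2) :
    Measurable (Function.uncurry fun (q : α × (Fin (k + 1) → Fin N)) e =>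
      ∑ j, ENNReal.ofReal (Q (q.2 (Fin.last k)) j) * ψ q.1 q.2 j e) := by
  have hswap : Measurable fun q : (Fin (k + 1) → Fin N) × (α × E) =>
      ∑ j, ENNReal.ofReal (Q (q.1 (Fin.last k)) j) * ψ q.2.1 q.1 j q.2.2 :=
    measurable_from_prod_countable_right fun t => Finset.measurable_sum _ fun j _ =>
      (hψ t j).const_mul (ENNReal.ofReal (Q (t (Fin.last k)) j))
  exact hswap.comp (f := fun q : (α × (Fin (k + 1) → Fin N)) × E => (q.1.2, (q.1.1, q.2)))
    (by fun_prop)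

lemma IsSwitchedRecursion.exists_ae_eq (h : IsSwitchedRecursion P Q m Θ i₀ x₀ ξ X r) (k : ℕ) :
    ∃ F : (Fin k → E) → (Fin (k + 1) → Fin N) → α, (∀ t, Measurable fun w => F w t) ∧
      ∀ᵐ ω ∂P, X k ω = F (fun l => ξ l ω) (history r k ω) := by
  induction k with
  | zero => exact ⟨fun _ _ => x₀, fun _ => measurable_const, h.initial⟩
  | succ k ih =>
    obtain ⟨F, hF, hX⟩ := ih
    refine ⟨fun w t => Θ (t (Fin.last k).castSucc) (t (Fin.last (k + 1)))
      (F (Fin.init w) (Fin.init t)) (w (Fin.last k)), fun t => ?_, ?_⟩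
    · exact (h.measurable_map _ _).comp
        (((hF _).comp (measurable_pi_lambda _ fun l => measurable_pi_apply l.castSucc)).prodMk
          (measurable_pi_apply (Fin.last k)))
    · filter_upwards [hX, h.step k] with ω hω hstep
      rw [hstep, hω]
      rfl

lemma IsSwitchedRecursion.indepFun_noise_chain (h : IsSwitchedRecursion P Q m Θ i₀ x₀ ξ X r)
    (k : ℕ) : IndepFun (fun ω => (fun l : Fin k => ξ l ω, ξ k ω)) (fun ω k => r k ω) P :=
  h.indep_chain.comp (φ := fun w : ℕ → E => (fun l : Fin k => w l, w k)) (by fun_prop)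
    measurable_id

lemma IsSwitchedRecursion.indepFun_past_noise [IsProbabilityMeasure P]
    (h : IsSwitchedRecursion P Q m Θ i₀ x₀ ξ X r) (k : ℕ) :
    IndepFun (fun ω => (fun l : Fin k => ξ l ω, history r k ω)) (ξ k) P :=
  indepFun_prodMk_left (measurable_pi_lambda _ fun l => h.measurable_noise l)
    (h.measurable_noise k) (h.chain.measurable_history k) (h.indep_past k)
    ((h.indepFun_noise_chain k).comp measurable_id
      (ψ := fun (s : ℕ → Fin N) (m : Fin (k + 1)) => s m) (by fun_prop))

theorem IsSwitchedRecursion.lintegral_succ [IsProbabilityMeasure P]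
    (h : IsSwitchedRecursion P Q m Θ i₀ x₀ ξ X r) (hQ : ∀ i j, 0 ≤ Q i j) (k : ℕ)
    {φ : α × Fin N → ℝ≥0∞} (hφ : Measurable φ) :
    ∫⁻ ω, φ (X (k + 1) ω, r (k + 1) ω) ∂P =
      ∫⁻ ω, ∑ j, ENNReal.ofReal (Q (r k ω) j) *
        ∫⁻ e, φ (Θ (r k ω) j (X k ω) e, j) ∂m ∂P := by
  obtain ⟨F, hF, hX⟩ := h.exists_ae_eq k
  let past (ω : Ω) (l : Fin k) : E := ξ l ω
  have hpast : Measurable past := measurable_pi_lambda _ fun l => h.measurable_noise l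
  let ψ (w : Fin k → E) (t : Fin (k + 1) → Fin N) (j : Fin N) (e : E) : ℝ≥0∞ :=
    φ (Θ (t (Fin.last k)) j (F w t) e, j)
  have hψ (t : Fin (k + 1) → Fin N) (j : Fin N) :
      Measurable fun q : (Fin k → E) × E => ψ q.1 t j q.2 :=
    hφ.comp (((h.measurable_map _ j).comp
      (((hF t).comp measurable_fst).prodMk measurable_snd)).prodMk measurable_const)
  calc ∫⁻ ω, φ (X (k + 1) ω, r (k + 1) ω) ∂P
      = ∫⁻ ω, ψ (past ω) (history r k ω) (r (k + 1) ω) (ξ k ω) ∂P := by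
        refine lintegral_congr_ae ?_
        filter_upwards [hX, h.step k] with ω hω hstep
        rw [hstep, hω]
        rfl
    _ = ∫⁻ ω, ∑ j, ENNReal.ofReal (Q (r k ω) j) * ψ (past ω) (history r k ω) j (ξ k ω) ∂P :=
        h.chain.lintegral_comp_succ hQ (φ := fun q t j => ψ q.1 t j q.2)
          (hpast.prodMk (h.measurable_noise k)) (h.indepFun_noise_chain k) hψ
    _ = ∫⁻ ω, ∫⁻ e, ∑ j, ENNReal.ofReal (Q (r k ω) j) *
          ψ (past ω) (history r k ω) j e ∂m ∂P := by
        rw [← h.map_noise k]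
        exact lintegral_comp_of_indepFun (hpast.prodMk (h.chain.measurable_history k))
          (h.measurable_noise k) (h.indepFun_past_noise k) (measurable_weighted_sum_history Q hψ)
    _ = _ := by
        refine lintegral_congr_ae ?_
        filter_upwards [hX] with ω hω
        have hmeas (j : Fin N) : Measurable (ψ (past ω) (history r k ω) j) :=
          (hψ _ j).comp measurable_prodMk_left
        rw [lintegral_finsetSum _ fun j _ => (hmeas j).const_mul _]
        simp only [lintegral_const_mul _ (hmeas _)]
        rw [hω]
        rfl

end SwitchedRecursion

/-! ### The law of the scheme -/

section Noise

variable {d : ℕ} {Ω : Type*} {B : Fin d → ℝ≥0 → Ω → ℝ} {Δ : ℝ}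

/-- The coordinates of the Brownian increments, normalised to unit variance. -/
def noiseCoord (B : Fin d → ℝ≥0 → Ω → ℝ) (Δ : ℝ) (l : Fin d) (k : ℕ) (ω : Ω) : ℝ :=
  (Real.sqrt Δ)⁻¹ * (B l (Real.toNNReal ((k + 1 : ℝ) * Δ)) ω - B l (Real.toNNReal (k * Δ)) ω)

/-- The Brownian increments, normalised to identity covariance. -/
def noise (B : Fin d → ℝ≥0 → Ω → ℝ) (Δ : ℝ) (k : ℕ) (ω : Ω) : Vec d :=
  WithLp.toLp 2 fun l => noiseCoord B Δ l k ω

lemma sqrt_smul_noise (B : Fin d → ℝ≥0 → Ω → ℝ) (hΔ : 0 < Δ) (k : ℕ) (ω : Ω) :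
    Real.sqrt Δ • noise B Δ k ω = increment B Δ k ω := by
  ext l
  exact mul_inv_cancel_left₀ (Real.sqrt_pos.2 hΔ).ne' _

variable [MeasurableSpace Ω] {P : Measure Ω}

lemma IsBrownianMotion.measurable_noiseCoord (hB : IsBrownianMotion P B) (l : Fin d) (k : ℕ) :
    Measurable (noiseCoord B Δ l k) :=
  ((hB.measurable l _).sub (hB.measurable l _)).const_mul _

lemma IsBrownianMotion.measurable_noise (hB : IsBrownianMotion P B) (k : ℕ) :
    Measurable (noise B Δ k) :=
  (WithLp.measurable_toLp 2 _).comp (measurable_pi_lambda _ fun l => hB.measurable_noiseCoord l k)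

lemma IsBrownianMotion.iIndepFun_noiseCoord (hB : IsBrownianMotion P B) (hΔ : 0 ≤ Δ) :
    iIndepFun (fun (q : Fin d × ℕ) ω => noiseCoord B Δ q.1 q.2 ω) P := by
  refine iIndepFun_uncurry' (X := fun l k ω => noiseCoord B Δ l k ω)
    (fun l k => hB.measurable_noiseCoord l k) ?_ fun l => ?_
  · exact hB.indep.comp (fun _ b (k : ℕ) => (Real.sqrt Δ)⁻¹ *
      (b (Real.toNNReal ((k + 1 : ℝ) * Δ)) - b (Real.toNNReal (k * Δ)))) fun _ => by fun_prop
  · have hgrid : Monotone fun k : ℕ => Real.toNNReal (k * Δ) := fun k k' hk =>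
      Real.toNNReal_le_toNNReal (mul_le_mul_of_nonneg_right (Nat.cast_le.2 hk) hΔ)
    have hincr := (hB.brownian l).toIsPreBrownianReal.hasIndepIncrements.nat hgrid
    convert hincr.comp (fun _ x => (Real.sqrt Δ)⁻¹ * x) fun _ => by fun_prop using 3 with k ω
    simp [noiseCoord]

lemma IsBrownianMotion.map_noiseCoord (hB : IsBrownianMotion P B) (hΔ : 0 < Δ) (l : Fin d)
    (k : ℕ) : P.map (noiseCoord B Δ l k) = gaussianReal 0 1 := by
  refine (gaussianReal_const_mul ((hB.brownian l).toIsPreBrownianReal.hasLaw_sub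
    (Real.toNNReal ((k + 1 : ℝ) * Δ)) (Real.toNNReal (k * Δ))) (Real.sqrt Δ)⁻¹).map_eq.trans ?_
  have hdist : (nndist (Real.toNNReal ((k + 1 : ℝ) * Δ) : ℝ) (Real.toNNReal (k * Δ) : ℝ) : ℝ) =
      Δ := by
    rw [coe_nndist, Real.coe_toNNReal _ (by positivity), Real.coe_toNNReal _ (by positivity),
      Real.dist_eq, ← sub_mul, add_sub_cancel_left, one_mul, abs_of_pos hΔ]
  congr 1
  · simp
  · ext
    change (Real.sqrt Δ)⁻¹ ^ 2 *
      (nndist (Real.toNNReal ((k + 1 : ℝ) * Δ) : ℝ) (Real.toNNReal (k * Δ) : ℝ) : ℝ) = 1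
    rw [hdist, inv_pow, Real.sq_sqrt hΔ.le, inv_mul_cancel₀ hΔ.ne']

lemma IsBrownianMotion.map_noise [IsProbabilityMeasure P] (hB : IsBrownianMotion P B)
    (hΔ : 0 < Δ) (k : ℕ) : P.map (noise B Δ k) = stdGaussian (Vec d) := by
  have hindep : iIndepFun (fun l ω => noiseCoord B Δ l k ω) P :=
    (hB.iIndepFun_noiseCoord hΔ.le).precomp (g := fun l => (l, k)) fun _ _ h => congrArg Prod.fst h
  have hlaw := (iIndepFun_iff_map_fun_eq_pi_map
    fun l => (hB.measurable_noiseCoord l k).aemeasurable).1 hindep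
  have hcoord : (fun l => P.map fun ω => noiseCoord B Δ l k ω) = fun _ => gaussianReal 0 1 :=
    funext fun l => hB.map_noiseCoord hΔ l k
  rw [hcoord] at hlaw
  rw [← map_pi_eq_stdGaussian, ← hlaw, Measure.map_map (WithLp.measurable_toLp 2 _)
    (measurable_pi_lambda _ fun l => hB.measurable_noiseCoord l k)]
  rfl

lemma IsBrownianMotion.indepFun_noise (hB : IsBrownianMotion P B) (hΔ : 0 ≤ Δ) (k : ℕ) :
    IndepFun (fun ω (m : Fin k) => noise B Δ m ω) (noise B Δ k) P := by
  have hdisj : Disjoint ((Finset.univ : Finset (Fin d)) ×ˢ Finset.range k)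
      (Finset.univ ×ˢ {k}) :=
    Finset.disjoint_product.2 (.inr (by simp))
  let past (v : ((Finset.univ : Finset (Fin d)) ×ˢ Finset.range k : Finset (Fin d × ℕ)) → ℝ)
      (m : Fin k) : Vec d := WithLp.toLp 2 fun l => v ⟨(l, m), by simp⟩
  let present (v : ((Finset.univ : Finset (Fin d)) ×ˢ {k} : Finset (Fin d × ℕ)) → ℝ) : Vec d :=
    WithLp.toLp 2 fun l => v ⟨(l, k), by simp⟩
  have hpast : Measurable past := measurable_pi_lambda _ fun m =>
    (WithLp.measurable_toLp 2 _).comp (measurable_pi_lambda _ fun l => measurable_pi_apply _)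
  have hpresent : Measurable present :=
    (WithLp.measurable_toLp 2 _).comp (measurable_pi_lambda _ fun l => measurable_pi_apply _)
  exact ((hB.iIndepFun_noiseCoord hΔ).indepFun_finset _ _ hdisj
    fun q => hB.measurable_noiseCoord q.1 q.2).comp hpast hpresent

end Noise

section Law

variable {n d N : ℕ} {f : Vec n → Fin N → Vec n} {g : Vec n → Fin N → Matrix (Fin n) (Fin d) ℝ}
  {Γ : Matrix (Fin N) (Fin N) ℝ} {ν : Fin N → ℝ} {Δ : ℝ} {Ω : Type*} [MeasurableSpace Ω]
  {P : Measure Ω} [IsProbabilityMeasure P] {x₀ : Vec n} {i₀ : Fin N} {B : Fin d → ℝ≥0 → Ω → ℝ}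
  {X : ℕ → Ω → Vec n} {r : ℕ → Ω → Fin N}

lemma IsBEMSolution.isSwitchedRecursion (hX : IsBEMSolution P f g Γ Δ x₀ i₀ B X r)
    (hfg : MonotoneCoefficients f g ν) (hΔ : IsStepSize ν Δ) :
    IsSwitchedRecursion P (stepMatrix Γ Δ) (stdGaussian (Vec d))
      (fun i j x ξ => implicitSolve f Δ j (explicitStep g Δ (x, i) ξ)) i₀ x₀ (noise B Δ) X r where
  measurable_map i j :=
    ((hfg.continuous_implicitSolve hΔ j).comp (continuous_explicitStep hfg.continuous i)).measurable
  chain := hX.chain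
  measurable_noise := hX.brownian.measurable_noise
  map_noise := hX.brownian.map_noise hΔ.pos
  indep_past := hX.brownian.indepFun_noise hΔ.pos.le
  indep_chain := hX.indep.comp (φ := fun b k => noise (fun l t _ => b l t) Δ k ())
    (measurable_pi_lambda _ fun k => (WithLp.measurable_toLp 2 _).comp
      (measurable_pi_lambda _ fun l => by unfold noiseCoord; fun_prop)) measurable_id
  initial := hX.initial
  step k := by
    filter_upwards [hX.step k] with ω hstep
    rw [explicitStep, sqrt_smul_noise B hΔ.pos,
      ← hfg.implicitSolve_eq hΔ (r (k + 1) ω) (X (k + 1) ω)]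
    congr 1
    rw [sub_eq_iff_eq_add]
    exact hstep.trans (add_right_comm _ _ _)

lemma IsBEMSolution.map_succ (hX : IsBEMSolution P f g Γ Δ x₀ i₀ B X r)
    (hfg : MonotoneCoefficients f g ν) (hΔ : IsStepSize ν Δ) (hΓ : IsGenerator Γ) (k : ℕ) :
    P.map (fun ω => (X (k + 1) ω, r (k + 1) ω)) =
      (P.map fun ω => (X k ω, r k ω)).bind (bemStep f g Γ Δ) := by
  have hmeas (k : ℕ) : Measurable fun ω => (X k ω, r k ω) :=
    (hX.measurable k).prodMk (hX.chain.measurable k)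
  have hQ (i j : Fin N) : 0 ≤ stepMatrix Γ Δ i j :=
    Matrix.nonneg_of_mem_rowStochastic (stepMatrix_mem_rowStochastic hΓ hΔ.pos.le)
  have hkernel : Measurable (bemStep f g Γ Δ) :=
    hfg.coe_bemChain_stepMatrix hΔ hΓ ▸ Kernel.measurable _
  refine Measure.ext_of_lintegral _ fun φ hφ => ?_
  rw [lintegral_map hφ (hmeas _), Measure.lintegral_bind hkernel.aemeasurable hφ.aemeasurable,
    lintegral_map (f := fun z => ∫⁻ w, φ w ∂bemStep f g Γ Δ z)
      ((Measure.measurable_lintegral hφ).comp hkernel) (hmeas k),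
    (hX.isSwitchedRecursion hfg hΔ).lintegral_succ hQ k hφ]
  exact lintegral_congr fun ω => (hfg.lintegral_bemStep hΔ (X k ω, r k ω) hφ).symm

theorem IsBEMSolution.map_eq_bemKernel (hX : IsBEMSolution P f g Γ Δ x₀ i₀ B X r)
    (hfg : MonotoneCoefficients f g ν) (hΔ : IsStepSize ν Δ) (hΓ : IsGenerator Γ) (k : ℕ) :
    P.map (fun ω => (X k ω, r k ω)) = bemKernel f g Γ Δ k (x₀, i₀) := by
  induction k with
  | zero =>
    have hr : ∀ᵐ ω ∂P, r 0 ω = i₀ := by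
      refine (prob_compl_eq_zero_iff (hX.chain.measurable 0 (measurableSet_singleton i₀))).2 ?_
      simpa [Set.preimage] using hX.chain.law 0 fun _ => i₀
    have hinitial : (fun ω => (X 0 ω, r 0 ω)) =ᵐ[P] fun _ => (x₀, i₀) := by
      filter_upwards [hX.initial, hr] with ω hω hω'
      rw [hω, hω']
    rw [Measure.map_congr hinitial, Measure.map_const, measure_univ, one_smul]
    rfl
  | succ k ih => rw [hX.map_succ hfg hΔ hΓ, ih, bemKernel]

end Law

section Main

variable {n d N : ℕ} {f : Vec n → Fin N → Vec n} {g : Vec n → Fin N → Matrix (Fin n) (Fin d) ℝ}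
  {Γ : Matrix (Fin N) (Fin N) ℝ} {μ a ν : Fin N → ℝ} {q l₁ : ℝ}

lemma exists_isContractingWeight_stepFactor (hΓ : IsGenerator Γ) (hirr : IsIrreducibleGenerator Γ)
    (hμ : IsStationaryDistribution Γ μ)
    (hν : ∑ j, μ j * (ν j / (1 - ν j / (maxAbs ν + 2))) < 0) :
    ∃ p₀ : ℝ, 0 < p₀ ∧ p₀ ≤ 1 ∧ ∀ Δ, 0 < Δ → Δ < 1 / (maxAbs ν + 2) → ∀ p, 0 < p → p ≤ p₀ →
      ∃ h ρ, ρ < 1 ∧ IsContractingWeight (stepMatrix Γ Δ) (stepFactor ν Δ p) h ρ := by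
  obtain ⟨s₀, hs₀, hweight⟩ := exists_isContractingWeight hΓ hirr hμ hν
  refine ⟨min 1 (2 * s₀), by positivity, min_le_left _ _, fun Δ hΔ hΔ' p hp hpp₀ => ?_⟩
  have hmax := maxAbs_nonneg ν
  have hΔ1 : Δ ≤ 1 := hΔ'.le.trans (by rw [div_le_one (by positivity)]; linarith)
  obtain ⟨h, ρ, hρ, hh⟩ := hweight Δ hΔ hΔ1 (p / 2) (half_pos hp)
    (by linarith [hpp₀.trans (min_le_right _ _)])
  exact ⟨h, ρ, hρ, hh.mono (stepMatrix_mem_rowStochastic hΓ hΔ.le)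
    (stepFactor_le_exp hΔ hΔ' hp.le)⟩

lemma PolynomialLipschitz.locallyLipschitz (h : PolynomialLipschitz f g a q) (i : Fin N) :
    LocallyLipschitz fun x => f x i := by
  obtain ⟨-, -, ha, hq, hfg⟩ := h
  intro x
  let r := ‖x‖ + 1
  let K := a i * (1 + r ^ (q - 2) + r ^ (q - 2))
  have hbound {y : Vec n} (hy : y ∈ Metric.ball x 1) : ‖y‖ ≤ r := by
    have := norm_le_norm_add_norm_sub' y x
    rw [mem_ball_iff_norm] at hy
    linarith
  have hK : 0 ≤ K := mul_nonneg (ha i).le (by positivity)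
  refine ⟨(Real.sqrt K).toNNReal, Metric.ball x 1, Metric.ball_mem_nhds x one_pos,
    LipschitzOnWith.of_dist_le_mul fun y hy z hz => ?_⟩
  rw [Real.coe_toNNReal _ (Real.sqrt_nonneg K), dist_eq_norm, dist_eq_norm]
  refine abs_le_of_sq_le_sq' ?_ (by positivity) |>.2
  rw [mul_pow, Real.sq_sqrt hK]
  calc ‖f y i - f z i‖ ^ 2
      ≤ a i * (1 + ‖y‖ ^ (q - 2) + ‖z‖ ^ (q - 2)) * ‖y - z‖ ^ 2 :=
        (le_max_left _ _).trans (hfg y z i)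
    _ ≤ K * ‖y - z‖ ^ 2 := by
        refine mul_le_mul_of_nonneg_right (mul_le_mul_of_nonneg_left ?_ (ha i).le) (sq_nonneg _)
        gcongr
        exacts [hbound hy, hbound hz]

lemma KhasminskiiMonotone.monotoneCoefficients (h : KhasminskiiMonotone f g ν l₁)
    (hfg : PolynomialLipschitz f g a q) : MonotoneCoefficients f g ν where
  locallyLipschitz := hfg.locallyLipschitz
  continuous := hfg.2.1
  inner_le x y i := by nlinarith [h.1, h.2 x y i, sq_nonneg (hsNorm (g x i - g y i))]

theorem MonotoneCoefficients.exists_rate_wasserstein_bemKernel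
    (hfg : MonotoneCoefficients f g ν) {Δ p ρ : ℝ} {h : Fin N → ℝ} (hΔ : IsStepSize ν Δ)
    (hΓ : IsGenerator Γ) (hirr : IsIrreducibleGenerator Γ)
    (hh : IsContractingWeight (stepMatrix Γ Δ) (stepFactor ν Δ p) h ρ) (hρ : ρ < 1) (hp : 0 < p)
    (hp1 : p ≤ 1) (l : Fin N) {π : Measure (Vec n × Fin N)}
    (hπ : IsInvariantMeasure (bemKernel f g Γ Δ) π) :
    ∃ γ : ℝ, 0 < γ ∧ ∀ x₀ i₀, ∃ C : ℝ, 0 < C ∧ ∀ k : ℕ,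
      wasserstein p (bemKernel f g Γ Δ k (x₀, i₀)) π ≤
        ENNReal.ofReal (C * Real.exp (-(γ * (k * Δ)))) := by
  obtain ⟨_, hinv⟩ := (hfg.isInvariantMeasure_iff hΔ hΓ).1 hπ
  obtain ⟨ρ', hρ', hW⟩ := hfg.exists_wasserstein_bemChain_le hΔ
    (stepMatrix_mem_rowStochastic hΓ hΔ.pos.le) (fun k => stepMatrix_pos hΓ hirr hΔ.pos k l)
    hh hρ hp hp1 hinv
  obtain ⟨γ, hγ, hexp⟩ := exists_pow_mul_le_exp hρ' hΔ.pos
  refine ⟨γ, hγ, fun x₀ i₀ => ?_⟩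
  obtain ⟨C, hC, hWC⟩ := hW (x₀, i₀)
  obtain ⟨C', hC', hle⟩ := hexp C hC
  refine ⟨C', hC', fun k => ?_⟩
  rw [hfg.bemKernel_eq_pow hΔ hΓ]
  exact (hWC k).trans (hle k)

theorem MonotoneCoefficients.existsUnique_isInvariantMeasure
    (hfg : MonotoneCoefficients f g ν) {Δ p ρ : ℝ} {h : Fin N → ℝ} (hΔ : IsStepSize ν Δ)
    (hΓ : IsGenerator Γ) (hirr : IsIrreducibleGenerator Γ)
    (hh : IsContractingWeight (stepMatrix Γ Δ) (stepFactor ν Δ p) h ρ) (hρ : ρ < 1) (hp : 0 < p)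
    (hp1 : p ≤ 1) (l : Fin N) :
    ∃! π, IsInvariantMeasure (bemKernel f g Γ Δ) π := by
  have hQ := stepMatrix_mem_rowStochastic hΓ hΔ.pos.le
  obtain ⟨π, hπ⟩ := hfg.exists_invariant_bemChain hΔ hQ hh hρ hp hp1 l
  refine ⟨π, (hfg.isInvariantMeasure_iff hΔ hΓ).2 hπ, fun π' hπ' => ?_⟩
  obtain ⟨_, hinv⟩ := hπ
  obtain ⟨_, hinv'⟩ := (hfg.isInvariantMeasure_iff hΔ hΓ).1 hπ'
  exact hfg.bemChain_invariant_unique hΔ hQ (fun k => stepMatrix_pos hΓ hirr hΔ.pos k l)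
    hh hρ hp hp1 hinv' hinv

end Main

end HybridBEM

end

open HybridBEM in
theorem theorem3p1_general {n d N : ℕ} {f : Vec n → Fin N → Vec n}
    {g : Vec n → Fin N → Matrix (Fin n) (Fin d) ℝ} {Γ : Matrix (Fin N) (Fin N) ℝ}
    {μ ν : Fin N → ℝ} (hΓ : IsGenerator Γ) (hirr : IsIrreducibleGenerator Γ)
    (hμ : IsStationaryDistribution Γ μ) (hfg : MonotoneCoefficients f g ν)
    (hν : ∑ j, μ j * (ν j / (1 - ν j / (maxAbs ν + 2))) < 0) :
    ∃ p₀ : ℝ, 0 < p₀ ∧ p₀ ≤ 1 ∧ ∀ Δ : ℝ, 0 < Δ → Δ < 1 / (maxAbs ν + 2) →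
      (∀ (i : Fin N) (y : Vec n), ∃! u, u - Δ • f u i = y) ∧
      (∀ (Ω : Type*) [MeasurableSpace Ω] (P : Measure Ω) [IsProbabilityMeasure P]
        (x₀ : Vec n) (i₀ : Fin N) (B : Fin d → ℝ≥0 → Ω → ℝ) (X : ℕ → Ω → Vec n)
        (r : ℕ → Ω → Fin N), IsBEMSolution P f g Γ Δ x₀ i₀ B X r →
        ∀ k, P.map (fun ω => (X k ω, r k ω)) = bemKernel f g Γ Δ k (x₀, i₀)) ∧
      ∃ π : Measure (Vec n × Fin N), IsInvariantMeasure (bemKernel f g Γ Δ) π ∧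
        (∀ π', IsInvariantMeasure (bemKernel f g Γ Δ) π' → π' = π) ∧
        ∀ p : ℝ, 0 < p → p < p₀ → ∃ γ : ℝ, 0 < γ ∧
          ∀ (x₀ : Vec n) (i₀ : Fin N), ∃ C : ℝ, 0 < C ∧ ∀ k : ℕ,
            wasserstein p (bemKernel f g Γ Δ k (x₀, i₀)) π ≤
              ENNReal.ofReal (C * Real.exp (-(γ * (k * Δ)))) := by
  obtain ⟨l⟩ := hμ.nonempty
  obtain ⟨p₀, hp₀, hp₀1, hweight⟩ := exists_isContractingWeight_stepFactor hΓ hirr hμ hν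
  refine ⟨p₀, hp₀, hp₀1, fun Δ hpos hlt => ?_⟩
  have hΔ : IsStepSize ν Δ := isStepSize_of_lt hpos hlt
  obtain ⟨h₀, ρ₀, hρ₀, hh₀⟩ := hweight Δ hpos hlt p₀ hp₀ le_rfl
  obtain ⟨π, hπ, hunique⟩ :=
    hfg.existsUnique_isInvariantMeasure hΔ hΓ hirr hh₀ hρ₀ hp₀ hp₀1 l
  refine ⟨fun i => Function.Bijective.existsUnique
      ⟨hfg.injective_sub_smul hΔ i, hfg.surjective_sub_smul hΔ i⟩,
    fun Ω _ P _ x₀ i₀ B X r hX => hX.map_eq_bemKernel hfg hΔ hΓ, π, hπ, hunique,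
    fun p hp hpp₀ => ?_⟩
  obtain ⟨h, ρ, hρ, hh⟩ := hweight Δ hpos hlt p hp hpp₀.le
  exact hfg.exists_rate_wasserstein_bemKernel hΔ hΓ hirr hh hρ hp (hpp₀.le.trans hp₀1) l hπ

theorem theorem3p1 {n d N : ℕ}
    (f : HybridBEM.Vec n → Fin N → HybridBEM.Vec n)
    (g : HybridBEM.Vec n → Fin N → Matrix (Fin n) (Fin d) ℝ)
    (Γ : Matrix (Fin N) (Fin N) ℝ) (μ : Fin N → ℝ)
    (a : Fin N → ℝ) (q : ℝ) (ν : Fin N → ℝ) (l₁ : ℝ)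
    (hΓ : HybridBEM.IsGenerator Γ) (hirr : HybridBEM.IsIrreducibleGenerator Γ)
    (hμ : HybridBEM.IsStationaryDistribution Γ μ)
    (h1 : HybridBEM.PolynomialLipschitz f g a q)
    (h2 : HybridBEM.KhasminskiiMonotone f g ν l₁)
    (h3 : HybridBEM.AveragedStable μ ν) :
    ∃ p₀ : ℝ, 0 < p₀ ∧ p₀ ≤ 1 ∧
      ∀ Δ : ℝ, 0 < Δ → Δ < 1 / (HybridBEM.maxAbs ν + 2) →
        -- the implicit equation of the scheme is uniquely solvable
        (∀ (i : Fin N) (y : HybridBEM.Vec n), ∃! u, u - Δ • f u i = y) ∧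
        -- the law of `(X_k, r_k)` is `𝐏^Δ_k((x₀, i₀), ·)`
        (∀ (Ω : Type*) [MeasurableSpace Ω] (P : Measure Ω) [IsProbabilityMeasure P]
          (x₀ : HybridBEM.Vec n) (i₀ : Fin N) (B : Fin d → ℝ≥0 → Ω → ℝ)
          (X : ℕ → Ω → HybridBEM.Vec n) (r : ℕ → Ω → Fin N),
          HybridBEM.IsBEMSolution P f g Γ Δ x₀ i₀ B X r →
          ∀ k, P.map (fun ω => (X k ω, r k ω)) = HybridBEM.bemKernel f g Γ Δ k (x₀, i₀)) ∧
        -- existence and uniqueness of the invariant measure, and exponential convergence to it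
        ∃ π : Measure (HybridBEM.Vec n × Fin N),
          HybridBEM.IsInvariantMeasure (HybridBEM.bemKernel f g Γ Δ) π ∧
          (∀ π' : Measure (HybridBEM.Vec n × Fin N),
            HybridBEM.IsInvariantMeasure (HybridBEM.bemKernel f g Γ Δ) π' → π' = π) ∧
          ∀ p : ℝ, 0 < p → p < p₀ → ∃ γ : ℝ, 0 < γ ∧
            ∀ (x₀ : HybridBEM.Vec n) (i₀ : Fin N), ∃ C : ℝ, 0 < C ∧ ∀ k : ℕ,
              HybridBEM.wasserstein p (HybridBEM.bemKernel f g Γ Δ k (x₀, i₀)) π ≤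
                ENNReal.ofReal (C * Real.exp (-(γ * (k * Δ)))) := by
  obtain ⟨lam₂, hlam₂, hsum⟩ := h3.2
  exact theorem3p1_general hΓ hirr hμ (h2.monotoneCoefficients h1) (by rw [hsum]; linarith)
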